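/- For a partition $\lambda=(\lambda_1>\lambda_2>\dots>\lambda_h>0)$ with $h\ge 1$ (a nonempty strictly decreasing, i.e. $2$-regular, partition) put $n=\lambda_1$, $V=\mathbb F_2^n$ and $|\lambda|=\sum_i\lambda_i$. Let $\bar R_\lambda$ and $\bar C_\lambda$ be the sums, in the group algebra over $\mathbb F_2$ of the symmetric group on the boxes of the Young diagram of $\lambda$ (rows of lengths $\lambda_1,\dots,\lambda_h$), of the elements of the row stabilizer and of the column stabilizer, acting on $V^{\otimes|\lambda|}$ by permuting the tensor factors, and let $$S_\lambda = V^{\otimes|\lambda|}\,\bar C_\lambda\bar R_\lambda\bar C_\lambda,$$ the simple representation of $\mathrm{GL}_n(\mathbb F_2)$ indexed by $\lambda$. Let $$P_\lambda(q)=\sum_{k\ge 0}a_{\lambda,k}\,q^k\in\mathbb Z[[q]],\qquad a_{\lambda,k}=\text{the Jordan–Hölder multiplicity of } S_\lambda \text{ in the symmetric power } S^k(\mathbb F_2^n)$$ ($P_\lambda$ is the Poincaré series of the Mitchell–Priddy summand $M(\lambda)$ of $B(\mathbb Z/2)^n$). Write $[M_\lambda]$ for the class of the cohomology of $M(\lambda)$;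 a virtual module $\sum_\lambda c_\lambda[M_\lambda]$, a finite sum with $c_\lambda\in\mathbb Z$, has Poincaré series $\sum_\lambda c_\lambda P_\lambda$. Then the virtual module $$X=[M_{(2,1)}]+[M_{(3)}]-[M_{(3,2,1)}]-[M_{(4)}]-[M_{(4,1)}]-[M_{(4,3)}]+[M_{(4,2,1)}]+[M_{(4,3,2)}]+[M_{(4,3,1)}]+2\,[M_{(4,3,2,1)}]$$ has Poincaré series identically zero. In particular the Poincaré series $P_\lambda$, for $\lambda$ running over all nonempty strictly decreasing partitions, are not linearly independent over $\mathbb Z$ (equivalently, over $\mathbb Q$). -/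

import Mathlib

open scoped TensorProduct MonoidAlgebra

noncomputable section

namespace PoincareGL

/-- Jordan-Hölder multiplicity of the simple module `S` in the module `M`: the number of
composition factors isomorphic to `S` in a composition series of `M` from `⊥` to `⊤`
(and `0` if `M` has no composition series). By the Jordan-Hölder theorem the choice of the series
does not matter. -/
def multiplicity (R M S : Type*) [Ring R] [AddCommGroup M] [Module R M] [AddCommGroup S]
    [Module R S] : ℕ :=
  open Classical in
  if h : ∃ s : CompositionSeries (Submodule R M), s.head = ⊥ ∧ s.last = ⊤ then
    (Finset.univ.filter fun i : Fin h.choose.length =>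
      Nonempty ((h.choose i.succ ⧸ (h.choose i.castSucc).submoduleOf (h.choose i.succ))
        ≃ₗ[R] S)).card
  else 0

/-- The group `GL_n(𝔽₂)`. -/
abbrev GL2 (n : ℕ) : Type := Matrix.GeneralLinearGroup (Fin n) (ZMod 2)

/-- The natural representation `V = 𝔽₂ⁿ` (column vectors). -/
def stdRep (n : ℕ) : Representation (ZMod 2) (GL2 n) (Fin n → ZMod 2) where
  toFun g := Matrix.toLin' (g : Matrix (Fin n) (Fin n) (ZMod 2))
  map_one' := by simp; rfl
  map_mul' g h := by simp [Matrix.toLin'_mul]; rfl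

/-! ### Symmetric powers -/

/-- The linear substitution `x_j ↦ ∑ i, g i j • x_i`, which is the action of `g` on the symmetric
algebra of `V = 𝔽₂ⁿ`, where `x_j` stands for the `j`-th standard basis vector of `V`. -/
def symAlgHom (n : ℕ) (g : GL2 n) :
    MvPolynomial (Fin n) (ZMod 2) →ₐ[ZMod 2] MvPolynomial (Fin n) (ZMod 2) :=
  MvPolynomial.aeval fun j => ∑ i, (g : Matrix (Fin n) (Fin n) (ZMod 2)) i j • MvPolynomial.X i

theorem symAlgHom_one (n : ℕ) : symAlgHom n 1 = AlgHom.id _ _ := by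
  apply MvPolynomial.algHom_ext
  intro j
  simp [symAlgHom, Matrix.one_apply]

theorem symAlgHom_mul (n : ℕ) (g h : GL2 n) :
    symAlgHom n (g * h) = (symAlgHom n g).comp (symAlgHom n h) := by
  apply MvPolynomial.algHom_ext
  intro j
  simp only [symAlgHom, MvPolynomial.aeval_X, AlgHom.comp_apply, map_sum, map_smul,
    Units.val_mul, Matrix.mul_apply, Finset.sum_smul, Finset.smul_sum, smul_smul]
  rw [Finset.sum_comm]
  refine Finset.sum_congr rfl fun i _ => Finset.sum_congr rfl fun k _ => ?_
  rw [mul_comm]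

theorem symAlgHom_mem (n k : ℕ) (g : GL2 n) {p : MvPolynomial (Fin n) (ZMod 2)}
    (hp : p ∈ MvPolynomial.homogeneousSubmodule (Fin n) (ZMod 2) k) :
    symAlgHom n g p ∈ MvPolynomial.homogeneousSubmodule (Fin n) (ZMod 2) k := by
  rw [MvPolynomial.mem_homogeneousSubmodule] at hp ⊢
  have := hp.aeval (n := 1) (fun j => ∑ i, (g : Matrix (Fin n) (Fin n) (ZMod 2)) i j •
      (MvPolynomial.X i : MvPolynomial (Fin n) (ZMod 2))) (fun j => by
    rw [← MvPolynomial.mem_homogeneousSubmodule]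
    exact Submodule.sum_mem _ fun i _ => Submodule.smul_mem _ _
      ((MvPolynomial.mem_homogeneousSubmodule _ _).2 (MvPolynomial.isHomogeneous_X _ i)))
  simpa [symAlgHom] using this

/-- The `k`-th symmetric power `S^k(V)` of `V = 𝔽₂ⁿ`: homogeneous polynomials of degree `k`. -/
def symRep (n k : ℕ) : Representation (ZMod 2) (GL2 n)
    (MvPolynomial.homogeneousSubmodule (Fin n) (ZMod 2) k) where
  toFun g := (symAlgHom n g).toLinearMap.restrict fun _ hp => symAlgHom_mem n k g hp
  map_one' := by
    ext1 p
    apply Subtype.ext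
    simp [symAlgHom_one]
  map_mul' g h := by
    ext1 p
    apply Subtype.ext
    exact AlgHom.congr_fun (symAlgHom_mul n g h) p.1

/-! ### The simple representations -/

/-- The boxes of a Young diagram. The box `(i, j)` lies in row `i` and column `j`. -/
abbrev Box (μ : YoungDiagram) : Type := {c : ℕ × ℕ // c ∈ μ.cells}

/-- The tensor power `V^{⊗ |μ|}` of `V = 𝔽₂ⁿ`, its tensor factors indexed by the boxes of `μ`. -/
abbrev TensorPow (n : ℕ) (μ : YoungDiagram) : Type :=
  ⨂[ZMod 2] _ : Box μ, (Fin n → ZMod 2)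

/-- The diagonal action of `GL_n(𝔽₂)` on the tensor power. -/
def tensorRep (n : ℕ) (μ : YoungDiagram) :
    Representation (ZMod 2) (GL2 n) (TensorPow n μ) where
  toFun g := PiTensorProduct.map fun _ => stdRep n g
  map_one' := by simp only [map_one]; exact PiTensorProduct.map_one
  map_mul' g h := by simp only [map_mul]; exact PiTensorProduct.map_mul _ _

/-- The sum of the place permutations given by the permutations of the boxes in a set `H`. -/
def permSum (n : ℕ) (μ : YoungDiagram) (H : Set (Equiv.Perm (Box μ))) :
    Module.End (ZMod 2) (TensorPow n μ) :=
  open Classical in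
  ∑ σ : Equiv.Perm (Box μ) with σ ∈ H,
    (PiTensorProduct.reindex (ZMod 2) (fun _ : Box μ => Fin n → ZMod 2) σ).toLinearMap

/-- The row stabilizer: permutations mapping each box to a box of the same row. -/
def rowStabilizer (μ : YoungDiagram) : Set (Equiv.Perm (Box μ)) :=
  {σ | ∀ b, (σ b).1.1 = b.1.1}

/-- The column stabilizer: permutations mapping each box to a box of the same column. -/
def colStabilizer (μ : YoungDiagram) : Set (Equiv.Perm (Box μ)) :=
  {σ | ∀ b, (σ b).1.2 = b.1.2}

/-- The operator `C̄ R̄ C̄` on the tensor power, with `C̄`, `R̄` the sums of the elements of the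
column and of the row stabilizer. -/
def symmetrizer (n : ℕ) (μ : YoungDiagram) : Module.End (ZMod 2) (TensorPow n μ) :=
  permSum n μ (colStabilizer μ) * permSum n μ (rowStabilizer μ) * permSum n μ (colStabilizer μ)

theorem permSum_comm (n : ℕ) (μ : YoungDiagram) (H : Set (Equiv.Perm (Box μ))) (g : GL2 n) :
    Commute (tensorRep n μ g) (permSum n μ H) := by
  classical
  unfold permSum
  refine Commute.sum_right _ _ _ fun σ _ => ?_
  exact PiTensorProduct.map_comp_reindex_eq (R := ZMod 2)
    (fun _ : Box μ => stdRep n g) σ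

theorem symmetrizer_comm (n : ℕ) (μ : YoungDiagram) (g : GL2 n) :
    Commute (tensorRep n μ g) (symmetrizer n μ) :=
  ((permSum_comm n μ _ g).mul_right (permSum_comm n μ _ g)).mul_right (permSum_comm n μ _ g)

theorem range_symmetrizer_le (n : ℕ) (μ : YoungDiagram) (g : GL2 n) :
    LinearMap.range (symmetrizer n μ) ≤
      (LinearMap.range (symmetrizer n μ)).comap (tensorRep n μ g) := by
  rintro _ ⟨x, rfl⟩
  exact ⟨tensorRep n μ g x, (LinearMap.congr_fun (symmetrizer_comm n μ g) x).symm⟩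

/-- The representation `V^{⊗ |μ|} C̄ R̄ C̄` of `GL_n(𝔽₂)`. For `μ` strictly decreasing with first
part `n` it is the simple representation `S_μ`. -/
def simpleRep (n : ℕ) (μ : YoungDiagram) :
    Representation (ZMod 2) (GL2 n) (LinearMap.range (symmetrizer n μ)) :=
  (tensorRep n μ).subrepresentation _ (range_symmetrizer_le n μ)

/-! ### Poincaré series -/

/-- The Poincaré series `P_μ(q) = ∑ₖ a_{μ,k} qᵏ`, where `a_{μ,k}` is the multiplicity of the simple
representation `S_μ` of `GL_n(𝔽₂)`, `n` the first part of `μ`, in `S^k(𝔽₂ⁿ)`. -/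
def poincareSeries (μ : YoungDiagram) : PowerSeries ℤ :=
  PowerSeries.mk fun k =>
    (multiplicity (ZMod 2)[GL2 (μ.rowLen 0)] (symRep (μ.rowLen 0) k).asModule
      (simpleRep (μ.rowLen 0) μ).asModule : ℤ)

/-- The indexing set of the simple representations of all groups `GL_n(𝔽₂)`, `n ≥ 1`: nonempty
strictly decreasing (that is, 2-regular) partitions. -/
abbrev RegularPartition : Type := {μ : YoungDiagram // μ.rowLens.SortedGT ∧ μ ≠ ⊥}

/-- The strictly decreasing partition with a given list of (positive) parts. -/
def ofParts (w : List ℕ) (hw : w.SortedGT) (hpos : ∀ x ∈ w, 0 < x) (hne : w ≠ []) :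
    RegularPartition :=
  ⟨YoungDiagram.ofRowLens w hw.sortedGE, by
    rw [YoungDiagram.rowLens_ofRowLens_eq_self hpos]; exact hw, by
    intro h
    have := YoungDiagram.rowLens_length_ofRowLens (hw := hw.sortedGE) hpos
    rw [h] at this
    apply hne
    rw [← List.length_eq_zero_iff, ← this]
    simp [YoungDiagram.colLen]⟩

/-- Formal integral combinations of the classes `[M_μ]`. -/
abbrev VirtualModule : Type := RegularPartition →₀ ℤ

/-- The class `[M_μ]` of the partition `μ` with parts `w`. -/
def M (w : List ℕ) (hw : w.SortedGT ∧ (∀ x ∈ w, 0 < x) ∧ w ≠ []) : VirtualModule :=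
  Finsupp.single (ofParts w hw.1 hw.2.1 hw.2.2) 1

/-- The Poincaré series of a virtual module, the additive extension of `[M_μ] ↦ P_μ`. -/
def virtualPoincareSeries : VirtualModule →ₗ[ℤ] PowerSeries ℤ :=
  Finsupp.linearCombination ℤ fun μ : RegularPartition => poincareSeries μ.1

end PoincareGL

end

/-!
For a module `M` over the group algebra of `GL_n(𝔽₂)` and an element `g` with `g³ = 1`, let `d` be the
dimension of `M` and `a` the dimension of the image of the idempotent `1 + g + g²`. Both numbers are
additive on composition series (`cardSMul_eq_mul`, `cardSMul_eq_pow`), so their values on the simple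
modules turn each linear combination of `d` and `a` into a combination of multiplicities. For `n = 3`
and `n = 4` and a `3`-cycle `g` of three coordinates, `(3 a - d) / 2` is, up to sign, the part of the
relation that involves the partitions with first part `n`, and for `n = 2` the multiplicity of
`S_(2,1)` is `(d - a) / 2` (`multiplicity_relation_two`, `multiplicity_relation_three`,
`multiplicity_relation_four`).

On symmetric powers these combinations can be counted. A `3`-cycle permutes the monomials, and
Burnside's lemma gives `3 a = d + 2 f` with `f` the number of fixed monomials
(`exists_cardSMul_symRep`). For `n = 2` the symmetric powers of `𝔽₂²` are quotients of those of `𝔽₂³`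
by the multiples of the sum of the variables (`cardSMul_symRep_succ`). The coefficient of `q ^ k` of
the relation becomes `(k + 1 - [3 ∣ k] + [3 ∣ k + 2]) / 3 + [3 ∣ k] - (⌊k / 3⌋ + 1) = 0`.

The values of `d` and `a` on simple modules require the classification of the simple modules for
`n ≤ 4`, which is by weights. The vectors fixed by the upper unitriangular group `U`, a `2`-group, are
a module over the `0`-Hecke algebra, and the Hecke operators have a common eigenvector there
(`exists_common_eigenvector`, `exists_isWeightVector`). The set of eigenvalues is the weight, and a
simple module is determined by a weight (`exists_equiv_of_isWeightVector`). The module `S_μ` has a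
weight vector whose weight is the set of parts of `μ` (`simpleVector_isWeightVector`). This vector
spans the vectors fixed by `U` and generates `S_μ`, so that `S_μ` is simple
(`hasNoProperSub_simpleRep`). Its matrix coefficients are products of leading minors
(`simpleForm_eq_prod`), one for each part. Therefore `d` and `a` are ranks of explicit matrices over
`𝔽₂` indexed by lower unitriangular matrices (`finrank_range_eq_gramRank`), which are computed by
elimination on rows encoded as binary numbers.
-/

noncomputable section

namespace PoincareGL

/-! ### The general linear group over the field with two elements -/

/-- The transpose of an invertible matrix. -/
def transp {n : ℕ} (g : GL2 n) : GL2 n :=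
  ⟨(g : Matrix _ _ _).transpose, ((g⁻¹ : GL2 n) : Matrix _ _ _).transpose, by
    rw [← Matrix.transpose_mul, ← Units.val_mul]; simp, by
    rw [← Matrix.transpose_mul, ← Units.val_mul]; simp⟩

@[simp] theorem transp_val {n : ℕ} (g : GL2 n) (i j : Fin n) : (transp g).1 i j = g.1 j i := rfl

@[simp] theorem transp_transp {n : ℕ} (g : GL2 n) : transp (transp g) = g := rfl

theorem transp_mul {n : ℕ} (g h : GL2 n) : transp (g * h) = transp h * transp g := by
  apply Units.ext
  exact Matrix.transpose_mul _ _

@[simp] theorem transp_one {n : ℕ} : transp (1 : GL2 n) = 1 := by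
  apply Units.ext
  exact Matrix.transpose_one

/-- A submonoid of a finite group, as a subgroup: inverses are powers. -/
def subgroupOfFinite {G : Type*} [Group G] [Finite G] (M : Submonoid G) : Subgroup G where
  __ := M
  inv_mem' {g} hg := by
    have h : g⁻¹ ∈ Submonoid.powers g :=
      mem_powers_iff_mem_zpowers.2 (inv_mem (Subgroup.mem_zpowers g))
    exact Submonoid.powers_le.2 hg h

/-- The group of upper unitriangular matrices, a Sylow `2`-subgroup of `GL_n(𝔽₂)`. -/
def upper (n : ℕ) : Subgroup (GL2 n) := subgroupOfFinite
  { carrier := {g | ∀ i j, j ≤ i → g.1 i j = (1 : Matrix (Fin n) (Fin n) (ZMod 2)) i j}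
    one_mem' := fun _ _ _ => rfl
    mul_mem' := by
      intro g h hg hh i j hij
      rw [Units.val_mul, Matrix.mul_apply, Finset.sum_eq_single i]
      · rw [hg i i le_rfl, hh i j hij]; simp
      · intro k _ hk
        rcases lt_or_gt_of_ne hk with h1 | h1
        · rw [hg i k h1.le, Matrix.one_apply_ne h1.ne', zero_mul]
        · rw [hh k j (hij.trans h1.le),
            Matrix.one_apply_ne (by rintro rfl; exact absurd h1 (not_lt.2 hij)), mul_zero]
      · simp }

theorem mem_upper {n : ℕ} {g : GL2 n} :
    g ∈ upper n ↔ ∀ i j, j ≤ i → g.1 i j = (1 : Matrix (Fin n) (Fin n) (ZMod 2)) i j := Iff.rfl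

/-- The group of lower unitriangular matrices. -/
def lower (n : ℕ) : Subgroup (GL2 n) := subgroupOfFinite
  { carrier := {g | transp g ∈ upper n}
    one_mem' := by simp [one_mem]
    mul_mem' := by
      intro g h hg hh
      simp only [Set.mem_ofPred_eq, transp_mul] at *
      exact mul_mem hh hg }

theorem mem_lower {n : ℕ} {g : GL2 n} : g ∈ lower n ↔ transp g ∈ upper n := Iff.rfl

/-- For unitriangular `g`, the matrix `g - 1` is nilpotent, and `g ^ 2 ^ n = 1 + (g - 1) ^ 2 ^ n`.
-/
theorem isPGroup_upper (n : ℕ) : IsPGroup 2 (upper n) := by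
  rintro ⟨g, hg⟩
  set N : Matrix (Fin n) (Fin n) (ZMod 2) := g.1 - 1 with hN
  have hN0 : ∀ i j, j ≤ i → N i j = 0 := fun i j hij => by
    rw [hN, Matrix.sub_apply, mem_upper.1 hg i j hij, sub_self]
  have hnil : N ^ n = 0 := by
    have h1 := Matrix.aeval_self_charpoly N
    rw [Matrix.charpoly_of_isUpperTriangular N (fun i j hij => hN0 i j (le_of_lt hij))] at h1
    simpa [hN0] using h1
  refine ⟨n, ?_⟩
  apply Subtype.ext
  apply Units.ext
  have h2 : (g.1 : Matrix (Fin n) (Fin n) (ZMod 2)) = 1 + N := by simp [hN]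
  have h3 : N ^ 2 ^ n = 0 := pow_eq_zero_of_le (Nat.lt_two_pow_self).le hnil
  push_cast
  rw [h2]
  rcases n.eq_zero_or_pos with rfl | hn
  · exact Subsingleton.elim _ _
  · have : Nonempty (Fin n) := ⟨⟨0, hn⟩⟩
    rw [add_pow_char_pow_of_commute 2 n (Commute.one_left N), h3]
    simp

theorem isPGroup_lower (n : ℕ) : IsPGroup 2 (lower n) := by
  rintro ⟨g, hg⟩
  obtain ⟨k, hk⟩ := isPGroup_upper n ⟨transp g, hg⟩
  refine ⟨k, Subtype.ext ?_⟩
  have h : ∀ m : ℕ, transp (g ^ m) = transp g ^ m := by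
    intro m
    induction m with
    | zero => simp
    | succ m ih => rw [pow_succ, pow_succ', transp_mul, ih]
  have h2 : transp (g ^ 2 ^ k) = 1 := by
    rw [h]; exact congrArg Subtype.val hk
  have := congrArg transp h2
  simpa using this

/-- The permutation matrix that maps the basis vector `e_j` to `e_{σ j}`. -/
def permGL {n : ℕ} : Equiv.Perm (Fin n) →* GL2 n := MonoidHom.toHomUnits
  { toFun := fun σ => Matrix.of fun i j => if i = σ j then (1 : ZMod 2) else 0
    map_one' := by ext i j; simp only [Matrix.of_apply, Matrix.one_apply, Equiv.Perm.one_apply]; rfl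
    map_mul' := by
      intro σ τ
      ext i j
      rw [Matrix.mul_apply, Finset.sum_eq_single (τ j)] <;> simp +contextual; rfl }

theorem permGL_apply {n : ℕ} (σ : Equiv.Perm (Fin n)) (i j : Fin n) :
    (permGL σ).1 i j = if i = σ j then 1 else 0 := rfl

theorem permGL_mul_apply {n : ℕ} (σ : Equiv.Perm (Fin n)) (g : GL2 n) (i j : Fin n) :
    (permGL σ * g).1 i j = g.1 (σ⁻¹ i) j := by
  rw [Units.val_mul, Matrix.mul_apply, Finset.sum_eq_single (σ⁻¹ i)]
  · simp [permGL_apply]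
  · intro k _ hk
    rw [permGL_apply, if_neg, zero_mul]
    rintro rfl
    simp at hk
  · simp

theorem mul_permGL_apply {n : ℕ} (σ : Equiv.Perm (Fin n)) (g : GL2 n) (i j : Fin n) :
    (g * permGL σ).1 i j = g.1 i (σ j) := by
  rw [Units.val_mul, Matrix.mul_apply, Finset.sum_eq_single (σ j)]
  · simp [permGL_apply]
  · intro k _ hk
    rw [permGL_apply, if_neg hk, mul_zero]
  · simp

/-- The elementary transvection `1 + E_{pq}`. -/
def elemGL {n : ℕ} (p q : Fin n) (h : p ≠ q) : GL2 n :=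
  ⟨Matrix.transvection p q 1, Matrix.transvection p q 1, by
    rw [Matrix.transvection_mul_transvection_same _ _ h, CharTwo.add_self_eq_zero]; simp, by
    rw [Matrix.transvection_mul_transvection_same _ _ h, CharTwo.add_self_eq_zero]; simp⟩

theorem elemGL_apply {n : ℕ} {p q : Fin n} (h : p ≠ q) (i j : Fin n) :
    (elemGL p q h).1 i j = (1 : Matrix (Fin n) (Fin n) (ZMod 2)) i j +
      if i = p ∧ j = q then 1 else 0 := by
  simp [elemGL, Matrix.transvection, Matrix.single_apply, eq_comm]

theorem elemGL_mul_self {n : ℕ} {p q : Fin n} (h : p ≠ q) : elemGL p q h * elemGL p q h = 1 := by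
  apply Units.ext
  simp [elemGL, Matrix.transvection_mul_transvection_same _ _ h, CharTwo.add_self_eq_zero]

theorem transp_elemGL {n : ℕ} {p q : Fin n} (h : p ≠ q) :
    transp (elemGL p q h) = elemGL q p h.symm := by
  apply Units.ext
  ext i j
  simp [elemGL_apply, Matrix.one_apply, and_comm, eq_comm]

theorem permGL_conj_elemGL {n : ℕ} (σ : Equiv.Perm (Fin n)) {p q : Fin n} (h : p ≠ q) :
    permGL σ * elemGL p q h * permGL σ⁻¹ = elemGL (σ p) (σ q) (by simpa using h) := by
  apply Units.ext
  ext i j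
  rw [mul_permGL_apply, permGL_mul_apply, elemGL_apply, elemGL_apply]
  simp [Matrix.one_apply, Equiv.symm_apply_eq]

theorem elemGL_mem_lower {n : ℕ} {p q : Fin n} (h : p < q) : elemGL q p h.ne' ∈ lower n := by
  intro i j hij
  rw [transp_val, elemGL_apply, if_neg (by rintro ⟨rfl, rfl⟩; exact absurd h (not_lt.2 hij))]
  simp [Matrix.one_apply, eq_comm]

theorem elemGL_mem_upper {n : ℕ} {p q : Fin n} (h : p < q) : elemGL p q h.ne ∈ upper n := by
  have := elemGL_mem_lower h
  rwa [mem_lower, transp_elemGL] at this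

/-- `GL_n(𝔽₂)` is generated by the lower unitriangular group and the adjacent transpositions. -/
theorem eq_top_of_lower_le {n : ℕ} (H : Submonoid (GL2 n)) (hL : ∀ g ∈ lower n, g ∈ H)
    (hs : ∀ p q : Fin n, p.val + 1 = q.val → permGL (Equiv.swap p q) ∈ H) (g : GL2 n) : g ∈ H := by
  have hperm : ∀ σ : Equiv.Perm (Fin n), permGL σ ∈ H := by
    intro σ
    rcases n with _ | n
    · rw [Subsingleton.elim σ 1, map_one]; exact one_mem _
    · have h : σ ∈ Submonoid.closure (Set.range fun i : Fin n ↦ Equiv.swap i.castSucc i.succ) := by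
        rw [Equiv.Perm.mclosure_swap_castSucc_succ]; trivial
      induction h using Submonoid.closure_induction with
      | mem x hx => obtain ⟨i, rfl⟩ := hx; exact hs _ _ rfl
      | one => rw [map_one]; exact one_mem _
      | mul x y _ _ hx hy => rw [map_mul]; exact mul_mem hx hy
  have helem : ∀ p q : Fin n, ∀ h : p ≠ q, elemGL p q h ∈ H := by
    intro p q h
    rcases lt_or_gt_of_ne h with h1 | h1
    · have h2 := permGL_conj_elemGL (Equiv.swap p q) h1.ne'
      simp only [Equiv.swap_apply_right, Equiv.swap_apply_left] at h2
      rw [← h2]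
      exact mul_mem (mul_mem (hperm _) (hL _ (elemGL_mem_lower h1))) (hperm _)
    · exact hL _ (elemGL_mem_lower h1)
  have two : ∀ c : ZMod 2, c = 0 ∨ c = 1 := by decide
  have key := Matrix.diagonal_transvection_induction_of_det_ne_zero
    (P := fun M => ∀ g : GL2 n, g.1 = M → g ∈ H) g.1
    (by have := g.isUnit.map (Matrix.detMonoidHom); exact this.ne_zero)
    (by
      intro D hD g hg
      have : g = 1 := by
        apply Units.ext
        rw [hg, Units.val_one, ← Matrix.diagonal_one]
        congr 1
        funext i
        rw [Matrix.det_diagonal] at hD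
        exact (two (D i)).resolve_left (Finset.prod_ne_zero_iff.1 hD i (Finset.mem_univ i))
      rw [this]; exact one_mem _)
    (by
      rintro ⟨p, q, h, c⟩ g hg
      rcases two c with rfl | rfl
      · have : g = 1 := Units.ext (by rw [hg]; simp [Matrix.TransvectionStruct.toMatrix])
        rw [this]; exact one_mem _
      · have : g = elemGL p q h := Units.ext hg
        rw [this]; exact helem p q h)
    (by
      intro A B hA hB hPA hPB g hg
      let a := Matrix.GeneralLinearGroup.mk'' A (isUnit_iff_ne_zero.2 hA)
      let b := Matrix.GeneralLinearGroup.mk'' B (isUnit_iff_ne_zero.2 hB)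
      have : g = a * b := Units.ext hg
      rw [this]
      exact mul_mem (hPA a rfl) (hPB b rfl))
  exact key g rfl

/-- An adjacent transposition normalizes the lower unitriangular matrices with vanishing entry
at the corresponding simple root. -/
theorem swap_conj_mem_lower {n : ℕ} {p q : Fin n} (hpq : p.val + 1 = q.val) {u : GL2 n}
    (hu : u ∈ lower n) (h0 : u.1 q p = 0) :
    permGL (Equiv.swap p q) * u * permGL (Equiv.swap p q) ∈ lower n := by
  intro i j hij
  rw [transp_val, mul_permGL_apply, permGL_mul_apply, Equiv.swap_inv]
  have hu' : ∀ i j, j ≤ i → u.1 j i = (1 : Matrix (Fin n) (Fin n) (ZMod 2)) i j := hu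
  by_cases hc : Equiv.swap p q j ≤ Equiv.swap p q i
  · rw [hu' _ _ hc]; simp [Matrix.one_apply]
  · have : i = q ∧ j = p := by
      simp only [Equiv.swap_apply_def, Fin.le_def, Fin.ext_iff] at *
      split_ifs at * <;> omega
    obtain ⟨rfl, rfl⟩ := this
    rw [Equiv.swap_apply_left, Equiv.swap_apply_right, h0, Matrix.one_apply_ne]
    rintro rfl; omega

theorem transp_permGL {n : ℕ} (σ : Equiv.Perm (Fin n)) : transp (permGL σ) = permGL σ⁻¹ := by
  apply Units.ext
  ext i j
  simp only [transp_val, permGL_apply, Equiv.Perm.eq_inv_iff_eq]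
  exact if_congr eq_comm rfl rfl

theorem swap_conj_mem_upper {n : ℕ} {p q : Fin n} (hpq : p.val + 1 = q.val) {u : GL2 n}
    (hu : u ∈ upper n) (h0 : u.1 p q = 0) :
    permGL (Equiv.swap p q) * u * permGL (Equiv.swap p q) ∈ upper n := by
  have h := swap_conj_mem_lower hpq (u := transp u) (by rwa [mem_lower, transp_transp])
    (by rwa [transp_val])
  rw [mem_lower, transp_mul, transp_mul, transp_permGL, transp_transp, Equiv.swap_inv] at h
  rwa [mul_assoc]

/-! ### The `0`-Hecke algebra and its common eigenvectors -/

/-- Three idempotents that satisfy the braid relations of type `A₃` have a common eigenvector.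
They generate a quotient of the `0`-Hecke algebra of type `A₃`, and the images of a
vector under the elements of this algebra are treated by decreasing length: left multiplication by
a generator fixes an element or makes it longer. -/
theorem exists_common_eigenvector {k Q : Type*} [Field k] [AddCommGroup Q] [Module k Q]
    [Nontrivial Q]
    (a b c : Module.End k Q) (haa : ∀ v, a (a v) = a v) (hbb : ∀ v, b (b v) = b v)
    (hcc : ∀ v, c (c v) = c v) (hab : ∀ v, a (b (a v)) = b (a (b v)))
    (hbc : ∀ v, b (c (b v)) = c (b (c v))) (hac : ∀ v, a (c v) = c (a v)) :
    ∃ v : Q, v ≠ 0 ∧ (a v = 0 ∨ a v = v) ∧ (b v = 0 ∨ b v = v) ∧ (c v = 0 ∨ c v = v) := by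
  by_contra! H
  have H' : ∀ v, (a v = 0 ∨ a v = v) → (b v = 0 ∨ b v = v) → (c v = 0 ∨ c v = v) → v = 0 := by
    intro v h1 h2 h3
    by_contra h
    rcases h3 with h3 | h3
    · exact (H v h h1 h2).1 h3
    · exact (H v h h1 h2).2 h3
  clear H
  -- A generator fixes the image of `v` under a word, lengthens the word, or is moved into it by
  -- the relations: once the longer images vanish, each image is a common eigenvector.
  have h_abcaba : ∀ v, a (b (c (a (b (a v))))) = 0 := fun v => by
    apply H' <;> clear H' <;> grind
  have h_abcab : ∀ v, a (b (c (a (b v)))) = 0 := fun v => by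
    apply H' <;> clear H' <;> grind
  have h_abcba : ∀ v, a (b (c (b (a v)))) = 0 := fun v => by
    apply H' <;> clear H' h_abcab <;> grind
  have h_bcaba : ∀ v, b (c (a (b (a v)))) = 0 := fun v => by
    apply H' <;> clear H' h_abcab h_abcba <;> grind
  have h_abcb : ∀ v, a (b (c (b v))) = 0 := fun v => by
    apply H' <;> clear H' h_abcaba h_abcba h_bcaba <;> grind
  have h_bcab : ∀ v, b (c (a (b v))) = 0 := fun v => by
    apply H' <;> clear H' h_abcaba h_abcba h_abcb <;> grind
  have h_abca : ∀ v, a (b (c (a v))) = 0 := fun v => by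
    apply H' <;> clear H' h_abcaba h_abcab h_bcaba h_abcb h_bcab <;> grind
  have h_bcba : ∀ v, b (c (b (a v))) = 0 := fun v => by
    apply H' <;> clear H' h_abcaba h_abcab h_bcaba h_abcb h_bcab h_abca <;> grind
  have h_caba : ∀ v, c (a (b (a v))) = 0 := fun v => by
    apply H' <;> clear H' h_abcaba h_abcab h_abcba h_abcb h_bcab h_abca h_bcba <;> grind
  have h_abc : ∀ v, a (b (c v)) = 0 := fun v => by
    apply H' <;> clear H' h_abcaba h_abcab h_abcba h_bcaba h_bcab h_bcba h_caba <;> grind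
  have h_bcb : ∀ v, b (c (b v)) = 0 := fun v => by
    apply H' <;>
      clear H' h_abcaba h_abcab h_abcba h_bcaba h_bcab h_abca h_bcba h_caba h_abc <;>
      grind
  have h_cab : ∀ v, c (a (b v)) = 0 := fun v => by
    apply H' <;>
      clear H' h_abcaba h_abcab h_abcba h_bcaba h_abcb h_abca h_bcba h_caba h_abc h_bcb <;>
      grind
  have h_bca : ∀ v, b (c (a v)) = 0 := fun v => by
    apply H' <;>
      clear H' h_abcaba h_abcab h_abcba h_bcaba h_abcb h_bcab h_caba h_abc h_bcb h_cab <;>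
      grind
  have h_cba : ∀ v, c (b (a v)) = 0 := fun v => by
    apply H' <;>
      clear H' h_abcaba h_abcab h_abcba h_bcaba h_abcb h_bcab h_abca h_abc h_bcb h_cab h_bca <;>
      grind
  have h_aba : ∀ v, a (b (a v)) = 0 := fun v => by
    apply H' <;>
      clear H' h_abcaba h_abcab h_abcba h_bcaba h_abcb h_bcab h_abca h_bcba h_abc h_bcb h_cab
        h_bca h_cba <;>
      grind
  have h_bc : ∀ v, b (c v) = 0 := fun v => by
    apply H' <;>
      clear H' h_abcaba h_abcab h_abcba h_bcaba h_abcb h_bcab h_abca h_bcba h_caba h_cab h_bca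
        h_cba h_aba <;>
      grind
  have h_cb : ∀ v, c (b v) = 0 := fun v => by
    apply H' <;>
      clear H' h_abcaba h_abcab h_abcba h_bcaba h_abcb h_bcab h_abca h_bcba h_caba h_abc h_bca
        h_cba h_aba h_bc <;>
      grind
  have h_ab : ∀ v, a (b v) = 0 := fun v => by
    apply H' <;>
      clear H' h_abcaba h_abcab h_abcba h_bcaba h_abcb h_bcab h_abca h_bcba h_caba h_abc h_bcb
        h_bca h_cba h_bc h_cb <;>
      grind
  have h_ca : ∀ v, c (a v) = 0 := fun v => by
    apply H' <;>
      clear H' h_abcaba h_abcab h_abcba h_bcaba h_abcb h_bcab h_abca h_bcba h_caba h_abc h_bcb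
        h_cab h_cba h_aba h_bc h_cb h_ab <;>
      grind
  have h_ba : ∀ v, b (a v) = 0 := fun v => by
    apply H' <;>
      clear H' h_abcaba h_abcab h_abcba h_bcaba h_abcb h_bcab h_abca h_bcba h_caba h_abc h_bcb
        h_cab h_bca h_bc h_cb h_ab h_ca <;>
      grind
  have h_c : ∀ v, c v = 0 := fun v => by
    apply H' <;>
      clear H' h_abcaba h_abcab h_abcba h_bcaba h_abcb h_bcab h_abca h_bcba h_caba h_abc h_bcb
        h_cab h_bca h_cba h_aba h_cb h_ab h_ba <;>
      grind
  have h_b : ∀ v, b v = 0 := fun v => by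
    apply H' <;>
      clear H' h_abcaba h_abcab h_abcba h_bcaba h_abcb h_bcab h_abca h_bcba h_caba h_abc h_bcb
        h_cab h_bca h_cba h_aba h_bc h_ca h_ba h_c <;>
      grind
  have h_a : ∀ v, a v = 0 := fun v => by
    apply H' <;>
      clear H' h_abcaba h_abcab h_abcba h_bcaba h_abcb h_bcab h_abca h_bcba h_caba h_abc h_bcb
        h_cab h_bca h_cba h_aba h_bc h_cb h_ab h_c h_b <;>
      grind
  obtain ⟨v, hv⟩ := exists_ne (0 : Q)
  exact hv (H' v (.inl (h_a v)) (.inl (h_b v)) (.inl (h_c v)))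

section
variable {n : ℕ} {T : Type*} [AddCommGroup T] [Module (ZMod 2) T]
  (ρ : Representation (ZMod 2) (GL2 n) T)

theorem add_self_zmod (x : T) : x + x = 0 := by
  rw [← two_smul (ZMod 2) x]
  have : (2 : ZMod 2) = 0 := rfl
  rw [this, zero_smul]

/-- The vectors fixed by the upper unitriangular group. -/
def fixedUpper : Submodule (ZMod 2) T where
  carrier := {v | ∀ u ∈ upper n, ρ u v = v}
  add_mem' := fun ha hb u hu => by rw [map_add, ha u hu, hb u hu]
  zero_mem' := fun u _ => map_zero _
  smul_mem' := fun c x hx u hu => by rw [map_smul, hx u hu]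

variable {ρ} in
theorem mem_fixedUpper {v : T} : v ∈ fixedUpper ρ ↔ ∀ u ∈ upper n, ρ u v = v := Iff.rfl

theorem ne_of_adj {p q : Fin n} (h : p.val + 1 = q.val) : p ≠ q := by
  rintro rfl; omega

theorem lt_of_adj {p q : Fin n} (h : p.val + 1 = q.val) : p < q := by
  rw [Fin.lt_def]; omega

/-- The Hecke operator of the simple reflection that exchanges the adjacent indices `p`, `q`: the
sum over the double coset of the reflection modulo the upper unitriangular group. -/
def hecke {p q : Fin n} (h : p.val + 1 = q.val) : Module.End (ZMod 2) T :=
  ρ (permGL (Equiv.swap p q)) + ρ (elemGL p q (ne_of_adj h) * permGL (Equiv.swap p q))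

theorem hecke_apply {p q : Fin n} (h : p.val + 1 = q.val) (v : T) :
    hecke ρ h v = ρ (permGL (Equiv.swap p q)) v +
      ρ (elemGL p q (ne_of_adj h)) (ρ (permGL (Equiv.swap p q)) v) := by
  simp [hecke]

/-- The entry above the diagonal at a simple root is an additive character of the upper
unitriangular group. -/
theorem upper_adj_mul {p q : Fin n} (h : p.val + 1 = q.val) {g k : GL2 n} (hg : g ∈ upper n)
    (hk : k ∈ upper n) : (g * k).1 p q = g.1 p q + k.1 p q := by
  have hne := ne_of_adj h
  rw [Units.val_mul, Matrix.mul_apply, ← Finset.sum_subset (Finset.subset_univ {p, q}),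
    Finset.sum_pair hne, hg p p le_rfl, hk q q le_rfl]
  · simp [add_comm]
  · intro r _ hr
    simp only [Finset.mem_insert, Finset.mem_singleton, not_or] at hr
    rcases lt_or_gt_of_ne hr.1 with h1 | h1
    · rw [hg p r h1.le, Matrix.one_apply_ne (Ne.symm hr.1), zero_mul]
    · have : q ≤ r := by rw [Fin.lt_def] at h1; rw [Fin.le_def]; omega
      rw [hk r q this, Matrix.one_apply_ne hr.2, mul_zero]

theorem zmod2_cases (c : ZMod 2) : c = 0 ∨ c = 1 := by
  revert c; decide

theorem swap_mul_swap_GL (p q : Fin n) :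
    permGL (Equiv.swap p q) * permGL (Equiv.swap p q) = 1 := by
  rw [← map_mul, Equiv.swap_mul_self, map_one]

theorem rho_swap_swap (p q : Fin n) (v : T) :
    ρ (permGL (Equiv.swap p q)) (ρ (permGL (Equiv.swap p q)) v) = v := by
  rw [← Module.End.mul_apply, ← map_mul, swap_mul_swap_GL, map_one]; rfl

theorem rho_elem_elem {p q : Fin n} (h : p ≠ q) (v : T) :
    ρ (elemGL p q h) (ρ (elemGL p q h) v) = v := by
  rw [← Module.End.mul_apply, ← map_mul, elemGL_mul_self, map_one]; rfl

theorem hecke_mem_fixedUpper {p q : Fin n} (h : p.val + 1 = q.val) {v : T}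
    (hv : v ∈ fixedUpper ρ) : hecke ρ h v ∈ fixedUpper ρ := by
  set s := permGL (Equiv.swap p q) with hs
  set x := elemGL p q (ne_of_adj h) with hx
  have hxU : x ∈ upper n := elemGL_mem_upper (lt_of_adj h)
  have hxpq : x.1 p q = 1 := by
    rw [hx, elemGL_apply]; simp [ne_of_adj h]
  -- elements with vanishing entry at `(p, q)` fix both summands
  have key : ∀ u ∈ upper n, u.1 p q = 0 → ρ u (ρ s v) = ρ s v := by
    intro u hu h0
    have h1 := hv _ (swap_conj_mem_upper h hu h0)
    have h2 : u * s = s * (s * u * s) := by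
      rw [← mul_assoc, ← mul_assoc, swap_mul_swap_GL, one_mul]
    rw [← Module.End.mul_apply, ← map_mul, h2, map_mul, Module.End.mul_apply, h1]
  have key2 : ∀ u ∈ upper n, u.1 p q = 0 → ρ u (ρ x (ρ s v)) = ρ x (ρ s v) := by
    intro u hu h0
    have h2 : u * x = x * (x * u * x) := by
      rw [← mul_assoc, ← mul_assoc, elemGL_mul_self, one_mul]
    rw [← Module.End.mul_apply, ← map_mul, h2, map_mul, Module.End.mul_apply,
      key _ (mul_mem (mul_mem hxU hu) hxU)]
    rw [upper_adj_mul h (mul_mem hxU hu) hxU, upper_adj_mul h hxU hu, h0, hxpq]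
    decide
  intro u hu
  rw [hecke_apply, map_add]
  rcases zmod2_cases (u.1 p q) with h0 | h0
  · rw [key u hu h0, key2 u hu h0]
  · have h3 : u = (u * x) * x := by rw [mul_assoc, elemGL_mul_self, mul_one]
    have h4 : (u * x).1 p q = 0 := by
      rw [upper_adj_mul h hu hxU, h0, hxpq]; decide
    rw [h3, map_mul, Module.End.mul_apply, Module.End.mul_apply, rho_elem_elem,
      key _ (mul_mem hu hxU) h4, key2 _ (mul_mem hu hxU) h4, add_comm]

theorem swap_elem_swap {p q : Fin n} (h : p ≠ q) :
    permGL (Equiv.swap p q) * elemGL p q h * permGL (Equiv.swap p q) = elemGL q p h.symm := by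
  have := permGL_conj_elemGL (Equiv.swap p q) h
  simpa [Equiv.swap_inv] using this

/-- The relation `x s x = s x s` in the symmetric group `GL_2(𝔽₂)`. -/
theorem elem_swap_elem {p q : Fin n} (h : p ≠ q) :
    elemGL p q h * permGL (Equiv.swap p q) * elemGL p q h = elemGL q p h.symm := by
  apply Units.ext
  ext i j
  have h1 : ∀ (g : GL2 n) (i j : Fin n),
      (g * elemGL p q h).1 i j = g.1 i j + if j = q then g.1 i p else 0 := by
    intro g i j
    by_cases hj : j = q
    · subst hj
      simp [elemGL]
    · simp [elemGL, hj]
  have h2 : ∀ (g : GL2 n) (i j : Fin n),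
      (elemGL p q h * g).1 i j = g.1 i j + if i = p then g.1 q j else 0 := by
    intro g i j
    by_cases hj : i = p
    · subst hj
      simp [elemGL]
    · simp [elemGL, hj]
  rw [h1, h2, h2, elemGL_apply]
  simp only [permGL_apply, Matrix.one_apply]
  by_cases hip : i = p <;> by_cases hiq : i = q <;> by_cases hjp : j = p <;>
    by_cases hjq : j = q <;>
    simp [hip, hiq, hjp, hjq, h, h.symm, Equiv.swap_apply_of_ne_of_ne, @eq_comm _ q j,
      @eq_comm _ p j] <;> decide

/-- On fixed vectors the Hecke operators are idempotent: the quadratic relation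
`T ^ 2 = (q - 1) T + q` at `q = 2`, reduced modulo `2`. -/
theorem hecke_idem {p q : Fin n} (h : p.val + 1 = q.val) {v : T} (hv : v ∈ fixedUpper ρ) :
    hecke ρ h (hecke ρ h v) = hecke ρ h v := by
  have hxv : ρ (elemGL p q (ne_of_adj h)) v = v := hv _ (elemGL_mem_upper (lt_of_adj h))
  have hs : ρ (permGL (Equiv.swap p q)) (ρ (elemGL p q (ne_of_adj h))
      (ρ (permGL (Equiv.swap p q)) v)) =
      ρ (elemGL p q (ne_of_adj h)) (ρ (permGL (Equiv.swap p q)) v) := by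
    have := congrArg (fun g => ρ g v) ((swap_elem_swap (ne_of_adj h)).trans
      (elem_swap_elem (ne_of_adj h)).symm)
    simpa [hxv] using this
  simp only [hecke_apply, map_add, hs, rho_swap_swap, rho_elem_elem, hxv]
  rw [add_self_zmod, zero_add, add_comm]

/-- The commutator of two elementary transvections. -/
theorem elem_mul_elem {p q r : Fin n} (hpq : p ≠ q) (hqr : q ≠ r) (hpr : p ≠ r) :
    elemGL p q hpq * elemGL q r hqr = elemGL q r hqr * elemGL p q hpq * elemGL p r hpr := by
  apply Units.ext
  simp only [elemGL, Matrix.transvection, Units.val_mul, Matrix.mul_add, Matrix.add_mul,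
    Matrix.one_mul, Matrix.mul_one, Matrix.single_mul_single_same,
    Matrix.single_mul_single_of_ne _ _ _ _ hpr.symm, Matrix.single_mul_single_of_ne _ _ _ _ hpq.symm]
  simp only [Matrix.zero_mul, mul_one]
  abel

theorem elem_comm_elem {p q r s : Fin n} (hpq : p ≠ q) (hrs : r ≠ s) (h1 : q ≠ r) (h2 : s ≠ p) :
    elemGL p q hpq * elemGL r s hrs = elemGL r s hrs * elemGL p q hpq := by
  apply Units.ext
  simp only [elemGL, Matrix.transvection, Units.val_mul, Matrix.mul_add, Matrix.add_mul,
    Matrix.one_mul, Matrix.mul_one, Matrix.single_mul_single_of_ne _ _ _ _ h1,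
    Matrix.single_mul_single_of_ne _ _ _ _ h2]
  abel

end

/-! ### Weight vectors and the submodules that they generate -/

section
variable {n : ℕ} {T : Type*} [AddCommGroup T] [Module (ZMod 2) T]
  (ρ : Representation (ZMod 2) (GL2 n) T)

theorem hecke_comm {p q r s : Fin n} (hpq : p.val + 1 = q.val) (hrs : r.val + 1 = s.val)
    (hqr : q < r) (v : T) :
    hecke ρ hpq (hecke ρ hrs v) = hecke ρ hrs (hecke ρ hpq v) := by
  have h1 : q ≠ r := hqr.ne
  have h2 : s ≠ p := by rintro rfl; rw [Fin.lt_def] at hqr; omega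
  have h3 : p ≠ r := by rintro rfl; rw [Fin.lt_def] at hqr; omega
  have h4 : q ≠ s := by rintro rfl; rw [Fin.lt_def] at hqr; omega
  have e1 : permGL (Equiv.swap p q) * permGL (Equiv.swap r s) =
      permGL (Equiv.swap r s) * permGL (Equiv.swap p q) := by
    rw [← map_mul, ← map_mul]
    congr 1
    exact (Equiv.Perm.disjoint_swap_swap (by simp [*, ne_of_adj, h2.symm])).commute
  have e2 := elem_comm_elem (ne_of_adj hpq) (ne_of_adj hrs) h1 h2
  have e3 : permGL (Equiv.swap p q) * elemGL r s (ne_of_adj hrs) =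
      elemGL r s (ne_of_adj hrs) * permGL (Equiv.swap p q) := by
    have := permGL_conj_elemGL (Equiv.swap p q) (ne_of_adj hrs)
    simp only [Equiv.swap_apply_of_ne_of_ne h3.symm h1.symm,
      Equiv.swap_apply_of_ne_of_ne h2 h4.symm] at this
    rw [map_inv, mul_inv_eq_iff_eq_mul] at this
    exact this
  have e4 : permGL (Equiv.swap r s) * elemGL p q (ne_of_adj hpq) =
      elemGL p q (ne_of_adj hpq) * permGL (Equiv.swap r s) := by
    have := permGL_conj_elemGL (Equiv.swap r s) (ne_of_adj hpq)
    simp only [Equiv.swap_apply_of_ne_of_ne h3 h2.symm,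
      Equiv.swap_apply_of_ne_of_ne h1 h4] at this
    rw [map_inv, mul_inv_eq_iff_eq_mul] at this
    exact this
  have : Commute (hecke ρ hpq) (hecke ρ hrs) := by
    have c1 : Commute (permGL (Equiv.swap p q)) (permGL (Equiv.swap r s)) := e1
    have c2 : Commute (elemGL p q (ne_of_adj hpq)) (elemGL r s (ne_of_adj hrs)) := e2
    have c3 : Commute (permGL (Equiv.swap p q)) (elemGL r s (ne_of_adj hrs)) := e3
    have c4 : Commute (permGL (Equiv.swap r s)) (elemGL p q (ne_of_adj hpq)) := e4
    unfold hecke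
    refine ((c1.map ρ).add_right ((c3.mul_right c1).map ρ)).add_left ?_
    exact ((c4.symm.mul_left c1).map ρ).add_right (((c2.mul_left c3).mul_right
      (c4.symm.mul_left c1)).map ρ)
  exact LinearMap.congr_fun this v

/-- Both sides are the sum over the unitriangular group of the indices `p`, `q`, `r`, multiplied by
the transposition of `p` and `r`. -/
theorem hecke_braid {p q r : Fin n} (hpq : p.val + 1 = q.val) (hqr : q.val + 1 = r.val) (v : T) :
    hecke ρ hpq (hecke ρ hqr (hecke ρ hpq v)) = hecke ρ hqr (hecke ρ hpq (hecke ρ hqr v)) := by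
  have h1 := ne_of_adj hpq
  have h2 := ne_of_adj hqr
  have h3 : p ≠ r := by rintro rfl; omega
  set s := permGL (Equiv.swap p q)
  set t := permGL (Equiv.swap q r)
  set x := elemGL p q h1 with hx
  set y := elemGL q r h2 with hy
  set z := elemGL p r h3 with hz
  have ss : s * s = 1 := swap_mul_swap_GL p q
  have tt : t * t = 1 := swap_mul_swap_GL q r
  have hsy : s * y = z * s := by
    have := permGL_conj_elemGL (Equiv.swap p q) h2
    simp only [Equiv.swap_apply_right, Equiv.swap_apply_of_ne_of_ne h3.symm h2.symm] at this
    rw [map_inv, mul_inv_eq_iff_eq_mul] at this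
    exact this
  have htx : t * x = z * t := by
    have := permGL_conj_elemGL (Equiv.swap q r) h1
    simp only [Equiv.swap_apply_left, Equiv.swap_apply_of_ne_of_ne h1 h3] at this
    rw [map_inv, mul_inv_eq_iff_eq_mul] at this
    exact this
  have hsz : s * z = y * s := by
    rw [← mul_left_inj s, mul_assoc, ← hsy, ← mul_assoc, ss, one_mul, mul_assoc, ss, mul_one]
  have htz : t * z = x * t := by
    rw [← mul_left_inj t, mul_assoc, ← htx, ← mul_assoc, tt, one_mul, mul_assoc, tt, mul_one]
  have hsts : s * (t * s) = t * (s * t) := by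
    rw [← map_mul, ← map_mul, ← map_mul, ← map_mul]
    congr 1
    rw [← mul_assoc, Equiv.swap_comm p q, Equiv.swap_comm q r,
      Equiv.swap_mul_swap_mul_swap h2.symm h3.symm, ← mul_assoc,
      Equiv.swap_comm r q, Equiv.swap_comm q p, Equiv.swap_mul_swap_mul_swap h1 h3, Equiv.swap_comm]
  have hxy : x * y = y * (x * z) := by rw [← mul_assoc]; exact elem_mul_elem h1 h2 h3
  have hxz : x * z = z * x := elem_comm_elem h1 h3 h1.symm h3.symm
  have hyz : y * z = z * y := elem_comm_elem h2 h3 h3.symm h2.symm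
  have hzz : z * z = 1 := elemGL_mul_self h3
  have conj : ∀ {a b c : GL2 n}, a * b = c * a → ρ a * (1 + ρ b) = (1 + ρ c) * ρ a := by
    intro a b c h
    rw [mul_add, add_mul, ← map_mul, ← map_mul, h, mul_one, one_mul]
  have hH : ∀ {p q : Fin n} (h : p.val + 1 = q.val), hecke ρ h =
      (1 + ρ (elemGL p q (ne_of_adj h))) * ρ (permGL (Equiv.swap p q)) := by
    intro p q h
    rw [hecke, map_mul, add_mul, one_mul]
  have A : hecke ρ hpq * (hecke ρ hqr * hecke ρ hpq) =
      (1 + ρ x) * (1 + ρ z) * (1 + ρ y) * ρ (s * (t * s)) := by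
    calc _ = (1 + ρ x) * (ρ s * (1 + ρ y)) * (ρ t * (1 + ρ x)) * ρ s := by
          rw [hH, hH]; simp only [mul_assoc]; rfl
      _ = (1 + ρ x) * (1 + ρ z) * (ρ s * (1 + ρ z)) * (ρ t * ρ s) := by
          rw [conj hsy, conj htx]; simp only [mul_assoc]
      _ = _ := by rw [conj hsz]; simp only [mul_assoc, map_mul]
  have B : hecke ρ hqr * (hecke ρ hpq * hecke ρ hqr) =
      (1 + ρ y) * (1 + ρ z) * (1 + ρ x) * ρ (t * (s * t)) := by
    calc _ = (1 + ρ y) * (ρ t * (1 + ρ x)) * (ρ s * (1 + ρ y)) * ρ t := by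
          rw [hH, hH]; simp only [mul_assoc]; rfl
      _ = (1 + ρ y) * (1 + ρ z) * (ρ t * (1 + ρ z)) * (ρ s * ρ t) := by
          rw [conj hsy, conj htx]; simp only [mul_assoc]
      _ = _ := by rw [conj htz]; simp only [mul_assoc, map_mul]
  have C : (1 + ρ x) * (1 + ρ z) * (1 + ρ y) = (1 + ρ y) * (1 + ρ z) * (1 + ρ x) := by
    have n1 : x * (z * y) = y * x := by
      rw [← hyz, ← mul_assoc, hxy, mul_assoc, mul_assoc, hzz, mul_one]
    have n2 : x * y = y * (z * x) := by rw [hxy, hxz]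
    simp only [mul_add, add_mul, one_mul, mul_one, ← map_mul, mul_assoc]
    rw [n1, ← n2, hxz, hyz]
    abel
  have := congrArg (fun f : Module.End (ZMod 2) T => f v) (A.trans (by rw [C, B, hsts] :
    _ = hecke ρ hqr * (hecke ρ hpq * hecke ρ hqr)))
  exact this

/-- `v` is a weight vector of type `J` if it is fixed by the upper unitriangular group and, for
`0 < q < n`, the Hecke operator of the simple reflection of `q - 1` and `q` maps it to itself or
to zero, according to whether `q ∈ J` or not. -/
structure IsWeightVector (ρ : Representation (ZMod 2) (GL2 n) T) (J : Finset ℕ) (v : T) : Prop where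
  mem : v ∈ fixedUpper ρ
  hecke_eq : ∀ (p q : Fin n) (h : p.val + 1 = q.val),
    hecke ρ h v = if q.val ∈ J then v else 0

/-- The span of the orbit of a weight vector under the lower unitriangular group. -/
def lowerSpan (v : T) : Submodule (ZMod 2) T := Submodule.span (ZMod 2) {x | ∃ u ∈ lower n, ρ u v = x}

variable {ρ} in
/-- The lower unitriangular span of a weight vector `v` is a subrepresentation. As the lower group
and the adjacent transpositions generate everything, it has to be stable under an adjacent
transposition `s`, with lower transvection `y`. The weight condition expresses `s v` and `s y v` by
elements of the span. For `u` in the lower group, `s` conjugates `u` or `u y` into the lower group.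
-/
theorem lowerSpan_stable {J : Finset ℕ} {v : T} (hv : IsWeightVector ρ J v) (g : GL2 n) {x : T}
    (hx : x ∈ lowerSpan ρ v) : ρ g x ∈ lowerSpan ρ v := by
  let H : Submonoid (GL2 n) :=
    { carrier := {g | ∀ x ∈ lowerSpan ρ v, ρ g x ∈ lowerSpan ρ v}
      one_mem' := fun x hx => by rw [map_one]; exact hx
      mul_mem' := fun {a b} ha hb x hx => by
        rw [map_mul]; exact ha _ (hb _ hx) }
  have hL : ∀ l ∈ lower n, ∀ x ∈ lowerSpan ρ v, ρ l x ∈ lowerSpan ρ v := by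
    intro l hl x hx
    refine (Submodule.span_le (p := (lowerSpan ρ v).comap (ρ l))).2 ?_ hx
    rintro _ ⟨u, hu, rfl⟩
    refine Submodule.subset_span ⟨l * u, mul_mem hl hu, ?_⟩
    rw [map_mul]; rfl
  refine eq_top_of_lower_le H ?_ ?_ g x hx
  · exact fun l hl x hx => hL l hl x hx
  · intro p q hpq x hx
    set s := permGL (Equiv.swap p q)
    set y := elemGL q p (ne_of_adj hpq).symm with hy
    have hyL : y ∈ lower n := elemGL_mem_lower (lt_of_adj hpq)
    have hvm : v ∈ lowerSpan ρ v := Submodule.subset_span ⟨1, one_mem _, by rw [map_one]; rfl⟩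
    have hyv : ρ y v ∈ lowerSpan ρ v := Submodule.subset_span ⟨y, hyL, rfl⟩
    have hxv : ρ (elemGL p q (ne_of_adj hpq)) v = v := hv.mem _ (elemGL_mem_upper (lt_of_adj hpq))
    -- `s v + y v` is `0` or `v`
    have h1 : ρ s v + ρ y v ∈ lowerSpan ρ v := by
      have := hv.hecke_eq p q hpq
      have e : ρ y v = ρ (elemGL p q (ne_of_adj hpq)) (ρ s v) := by
        rw [hy, ← elem_swap_elem (ne_of_adj hpq), map_mul, map_mul]
        simp only [Module.End.mul_apply, hxv]
        rfl
      rw [hecke_apply] at this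
      rw [e, this]
      split_ifs
      · exact hvm
      · exact zero_mem _
    have hsv : ρ s v ∈ lowerSpan ρ v := by
      have := sub_mem h1 hyv
      rwa [add_sub_cancel_right] at this
    have hsyv : ρ s (ρ y v) ∈ lowerSpan ρ v := by
      have e : s * y = elemGL p q (ne_of_adj hpq) * s := by
        rw [hy, ← swap_elem_swap (ne_of_adj hpq), ← mul_assoc, ← mul_assoc, swap_mul_swap_GL,
          one_mul]
      have := hv.hecke_eq p q hpq
      rw [hecke_apply] at this
      have e2 : ρ s (ρ y v) = (if q.val ∈ J then v else 0) - ρ s v := by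
        rw [← this, ← Module.End.mul_apply, ← map_mul, e, map_mul, Module.End.mul_apply,
          add_sub_cancel_left]
      rw [e2]
      refine sub_mem ?_ hsv
      split_ifs
      · exact hvm
      · exact zero_mem _
    refine (Submodule.span_le (p := (lowerSpan ρ v).comap (ρ s))).2 ?_ hx
    rintro _ ⟨u, hu, rfl⟩
    change ρ s (ρ u v) ∈ lowerSpan ρ v
    have conj : ∀ u ∈ lower n, u.1 q p = 0 → ∀ x, ρ s x ∈ lowerSpan ρ v →
        ρ s (ρ u x) ∈ lowerSpan ρ v := by
      intro u hu h0 x hx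
      have e : s * u = (s * u * s) * s := by rw [mul_assoc _ s s, swap_mul_swap_GL, mul_one]
      rw [← Module.End.mul_apply, ← map_mul, e, map_mul, Module.End.mul_apply]
      exact hL _ (swap_conj_mem_lower hpq hu h0) _ hx
    rcases zmod2_cases (u.1 q p) with h0 | h0
    · exact conj u hu h0 v hsv
    · have e : u = (u * y) * y := by rw [mul_assoc, elemGL_mul_self, mul_one]
      rw [e, map_mul, Module.End.mul_apply]
      refine conj _ (mul_mem hu hyL) ?_ _ hsyv
      have := upper_adj_mul hpq (mem_lower.1 hyL) (mem_lower.1 hu)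
      rw [← transp_mul, transp_val, transp_val, transp_val, h0] at this
      rw [this, hy, elemGL_apply]
      simp [(ne_of_adj hpq).symm]
      decide

end

/-! ### Simple modules are determined by their weights -/

section
variable {n : ℕ} {T : Type*} [AddCommGroup T] [Module (ZMod 2) T]
  (ρ : Representation (ZMod 2) (GL2 n) T)

/-- A `2`-group has a nonzero fixed vector in a nonzero finite space over `𝔽₂`. -/
theorem exists_fixed_of_isPGroup [Finite T] [Nontrivial T] {H : Subgroup (GL2 n)}
    (hH : IsPGroup 2 H) : ∃ v : T, v ≠ 0 ∧ ∀ u ∈ H, ρ u v = v := by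
  let act : MulAction H T :=
    { smul := fun u x => ρ u x
      one_smul := fun x => by change ρ 1 x = x; rw [map_one]; rfl
      mul_smul := fun u w x => by change ρ (u * w) x = ρ u (ρ w x); rw [map_mul]; rfl }
  have hdvd : 2 ∣ Nat.card T := by
    obtain ⟨x, hx⟩ := exists_ne (0 : T)
    have : addOrderOf x = 2 := by
      refine addOrderOf_eq_prime ?_ hx
      rw [two_nsmul, add_self_zmod]
    rw [← this]
    exact addOrderOf_dvd_natCard x
  have h0 : (0 : T) ∈ MulAction.fixedPoints H T := fun u => map_zero (ρ u)
  have : Fact (Nat.Prime 2) := ⟨Nat.prime_two⟩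
  obtain ⟨b, hb, hne⟩ := hH.exists_fixed_point_of_prime_dvd_card_of_fixed_point T hdvd h0
  exact ⟨b, hne.symm, fun u hu => hb ⟨u, hu⟩⟩

/-- The `i`-th Hecke operator on the vectors fixed by the upper unitriangular group, and zero if
there is none. -/
def heckeRestrict (i : ℕ) : Module.End (ZMod 2) (fixedUpper ρ) :=
  if h : i + 1 < n then
    (hecke ρ (p := ⟨i, by omega⟩) (q := ⟨i + 1, h⟩) rfl).restrict
      fun _ hv => hecke_mem_fixedUpper ρ rfl hv
  else 0

theorem heckeRestrict_val {i : ℕ} (h : i + 1 < n) (v : fixedUpper ρ) :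
    (heckeRestrict ρ i v : T) = hecke ρ (p := ⟨i, by omega⟩) (q := ⟨i + 1, h⟩) rfl v := by
  rw [heckeRestrict, dif_pos h]; rfl

theorem heckeRestrict_eq_zero {i : ℕ} (h : ¬ i + 1 < n) : heckeRestrict ρ i = 0 := by
  rw [heckeRestrict, dif_neg h]

theorem heckeRestrict_idem (i : ℕ) (v : fixedUpper ρ) :
    heckeRestrict ρ i (heckeRestrict ρ i v) = heckeRestrict ρ i v := by
  by_cases h : i + 1 < n
  · apply Subtype.ext
    simp only [heckeRestrict_val ρ h]
    exact hecke_idem ρ rfl v.2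
  · simp [heckeRestrict_eq_zero ρ h]

theorem heckeRestrict_braid (i : ℕ) (v : fixedUpper ρ) :
    heckeRestrict ρ i (heckeRestrict ρ (i + 1) (heckeRestrict ρ i v)) =
      heckeRestrict ρ (i + 1) (heckeRestrict ρ i (heckeRestrict ρ (i + 1) v)) := by
  by_cases h : i + 1 + 1 < n
  · apply Subtype.ext
    simp only [heckeRestrict_val ρ h, heckeRestrict_val ρ (show i + 1 < n by omega)]
    exact hecke_braid ρ rfl rfl _
  · simp [heckeRestrict_eq_zero ρ h]

theorem heckeRestrict_comm {i j : ℕ} (hij : i + 1 < j) (v : fixedUpper ρ) :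
    heckeRestrict ρ i (heckeRestrict ρ j v) = heckeRestrict ρ j (heckeRestrict ρ i v) := by
  by_cases h : j + 1 < n
  · apply Subtype.ext
    simp only [heckeRestrict_val ρ h, heckeRestrict_val ρ (show i + 1 < n by omega)]
    exact hecke_comm ρ rfl rfl (by rw [Fin.lt_def]; exact hij) _
  · simp [heckeRestrict_eq_zero ρ h]

/-- For `n ≤ 4`, every nonzero finite representation contains a weight vector: the Hecke operators
on the nonzero space of vectors fixed by the upper unitriangular group have a common eigenvector. -/
theorem exists_isWeightVector (hn : n ≤ 4) [Finite T] [Nontrivial T] :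
    ∃ v : T, v ≠ 0 ∧ ∃ J : Finset ℕ, IsWeightVector ρ J v := by
  obtain ⟨w, hw, hwU⟩ := exists_fixed_of_isPGroup ρ (isPGroup_upper n)
  have : Nontrivial (fixedUpper ρ) := ⟨⟨w, hwU⟩, 0, fun h => hw (congrArg Subtype.val h)⟩
  obtain ⟨v, hv, h0, h1, h2⟩ := exists_common_eigenvector (heckeRestrict ρ 0) (heckeRestrict ρ 1)
    (heckeRestrict ρ 2) (heckeRestrict_idem ρ 0) (heckeRestrict_idem ρ 1) (heckeRestrict_idem ρ 2)
    (heckeRestrict_braid ρ 0) (heckeRestrict_braid ρ 1) (heckeRestrict_comm ρ (by norm_num))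
  have key : ∀ i, i + 1 < n → heckeRestrict ρ i v = 0 ∨ heckeRestrict ρ i v = v := by
    intro i hi
    have : i < 3 := by omega
    interval_cases i <;> assumption
  classical
  refine ⟨v, fun h => hv (Subtype.ext h),
    (Finset.range n).filter fun q => 0 < q ∧ heckeRestrict ρ (q - 1) v = v, v.2, ?_⟩
  rintro ⟨p, hp⟩ ⟨q, hq⟩ h
  obtain rfl : p + 1 = q := h
  rw [← heckeRestrict_val ρ hq]
  by_cases hc : heckeRestrict ρ p v = v
  · simp [hc, hq]
  · rw [(key p hq).resolve_right hc, if_neg]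
    · rfl
    · simp [(key p hq).resolve_right hc, hv.symm]

end

section
variable {n : ℕ} {S T : Type*} [AddCommGroup S] [Module (ZMod 2) S] [AddCommGroup T]
  [Module (ZMod 2) T]

/-- The only stable subspaces are zero and the whole space; the zero representation is allowed. -/
def HasNoProperSub (ρ : Representation (ZMod 2) (GL2 n) T) : Prop :=
  ∀ Y : Submodule (ZMod 2) T, (∀ g, ∀ y ∈ Y, ρ g y ∈ Y) → Y = ⊥ ∨ Y = ⊤

/-- The lower unitriangular group is a `2`-group, so it fixes a nonzero vector of the dual space. -/
theorem exists_lower_invariant_form [Finite T] (ρ : Representation (ZMod 2) (GL2 n) T) {x : T}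
    (hx : x ≠ 0) :
    ∃ l : Module.Dual (ZMod 2) T, l ≠ 0 ∧ ∀ u ∈ lower n, ∀ y, l (ρ u y) = l y := by
  have : Nontrivial T := ⟨x, 0, hx⟩
  have : Finite (Module.Dual (ZMod 2) T) := Module.finite_of_finite (ZMod 2)
  obtain ⟨l, hl, hfix⟩ := exists_fixed_of_isPGroup ρ.dual (isPGroup_lower n)
  refine ⟨l, hl, fun u hu y => ?_⟩
  have h := LinearMap.congr_fun (hfix u⁻¹ (inv_mem hu)) y
  rw [Representation.dual_apply, inv_inv] at h
  exact h

/-- The lower unitriangular span of a pair of weight vectors is not everything: an invariant linear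
form is determined on such a span by its value at the pair, but the product has two independent
invariant linear forms. -/
theorem lowerSpan_prod_ne_top [Finite S] [Finite T] (σ : Representation (ZMod 2) (GL2 n) S)
    (τ : Representation (ZMod 2) (GL2 n) T) {v : S} {w : T} (hv : v ≠ 0) (hw : w ≠ 0) :
    lowerSpan (σ.prod τ) (v, w) ≠ ⊤ := by
  intro htop
  obtain ⟨l, hl, hlu⟩ := exists_lower_invariant_form σ hv
  obtain ⟨m, hm, hmu⟩ := exists_lower_invariant_form τ hw
  have hzero : ∀ f : Module.Dual (ZMod 2) (S × T),
      (∀ u ∈ lower n, ∀ y, f (σ.prod τ u y) = f y) → f (v, w) = 0 → f = 0 := by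
    intro f hf h0
    ext1 <;> ext x
    all_goals
      have : lowerSpan (σ.prod τ) (v, w) ≤ LinearMap.ker f := by
        refine Submodule.span_le.2 ?_
        rintro _ ⟨u, hu, rfl⟩
        change f _ = 0
        rw [hf u hu, h0]
      rw [htop] at this
    · exact this (Submodule.mem_top (x := (x, 0)))
    · exact this (Submodule.mem_top (x := (0, x)))
  have hl1 : l.comp (LinearMap.fst (ZMod 2) S T) ≠ 0 := fun h => hl (by
    ext x; exact LinearMap.congr_fun h (x, 0))
  have hm1 : m.comp (LinearMap.snd (ZMod 2) S T) ≠ 0 := fun h => hm (by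
    ext x; exact LinearMap.congr_fun h (0, x))
  have hlv : l v = 1 := (zmod2_cases (l v)).resolve_left fun h =>
    hl1 (hzero _ (fun u hu y => hlu u hu y.1) h)
  have hmw : m w = 1 := (zmod2_cases (m w)).resolve_left fun h =>
    hm1 (hzero _ (fun u hu y => hmu u hu y.2) h)
  have hsum := hzero (l.comp (LinearMap.fst (ZMod 2) S T) + m.comp (LinearMap.snd (ZMod 2) S T))
    (fun u hu y => by
      simp only [LinearMap.add_apply, LinearMap.comp_apply, LinearMap.fst_apply,
        LinearMap.snd_apply]
      exact congrArg₂ _ (hlu u hu y.1) (hmu u hu y.2))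
    (by simp only [LinearMap.add_apply, LinearMap.comp_apply, LinearMap.fst_apply,
          LinearMap.snd_apply, hlv, hmw]; decide)
  apply hl1
  ext x
  · simpa using LinearMap.congr_fun hsum (x, 0)
  · simp

/-- A simple representation is determined by the type of a weight vector. The span of the pair of
weight vectors is a proper subrepresentation of the product that projects onto both factors, hence
it is the graph of an isomorphism. -/
theorem exists_equiv_of_isWeightVector [Finite S] [Finite T]
    {σ : Representation (ZMod 2) (GL2 n) S} {τ : Representation (ZMod 2) (GL2 n) T}
    (hσ : HasNoProperSub σ) (hτ : HasNoProperSub τ) {J : Finset ℕ} {v : S} {w : T} (hv : v ≠ 0)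
    (hw : w ≠ 0) (hvJ : IsWeightVector σ J v) (hwJ : IsWeightVector τ J w) :
    ∃ e : S ≃ₗ[ZMod 2] T, ∀ g x, e (σ g x) = τ g (e x) := by
  have hvw : IsWeightVector (σ.prod τ) J (v, w) := by
    refine ⟨fun u hu => Prod.ext (hvJ.mem u hu) (hwJ.mem u hu), fun p q h => ?_⟩
    have : hecke (σ.prod τ) h (v, w) = (hecke σ h v, hecke τ h w) := rfl
    rw [this, hvJ.hecke_eq, hwJ.hecke_eq]
    split_ifs <;> rfl
  set Z := lowerSpan (σ.prod τ) (v, w) with hZ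
  have hst : ∀ g, ∀ x ∈ Z, σ.prod τ g x ∈ Z := fun g x hx => lowerSpan_stable hvw g hx
  have hZtop : Z ≠ ⊤ := lowerSpan_prod_ne_top σ τ hv hw
  have hmem : (v, w) ∈ Z := Submodule.subset_span ⟨1, one_mem _, by rw [map_one]; rfl⟩
  have hfst : Z.map (LinearMap.fst (ZMod 2) S T) = ⊤ := by
    refine (hσ _ ?_).resolve_left ?_
    · rintro g _ ⟨x, hx, rfl⟩
      exact ⟨_, hst g x hx, rfl⟩
    · intro h
      have : v ∈ Z.map (LinearMap.fst (ZMod 2) S T) := ⟨_, hmem, rfl⟩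
      rw [h] at this
      exact hv this
  have hsnd : Z.map (LinearMap.snd (ZMod 2) S T) = ⊤ := by
    refine (hτ _ ?_).resolve_left ?_
    · rintro g _ ⟨x, hx, rfl⟩
      exact ⟨_, hst g x hx, rfl⟩
    · intro h
      have : w ∈ Z.map (LinearMap.snd (ZMod 2) S T) := ⟨_, hmem, rfl⟩
      rw [h] at this
      exact hw this
  -- if `Z` contains one of the factors, then it is everything
  have hker1 : Z.comap (LinearMap.inl (ZMod 2) S T) = ⊥ := by
    refine (hσ _ ?_).resolve_right ?_
    · intro g x hx
      have := hst g _ hx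
      simpa using this
    · intro h
      apply hZtop
      rw [eq_top_iff]
      rintro ⟨a, b⟩ -
      obtain ⟨⟨c, d⟩, hcd, rfl⟩ : b ∈ Z.map (LinearMap.snd (ZMod 2) S T) := by rw [hsnd]; trivial
      have : a - c ∈ Z.comap (LinearMap.inl (ZMod 2) S T) := by rw [h]; trivial
      have := Z.add_mem this hcd
      simpa using this
  have hker2 : Z.comap (LinearMap.inr (ZMod 2) S T) = ⊥ := by
    refine (hτ _ ?_).resolve_right ?_
    · intro g x hx
      have := hst g _ hx
      simpa using this
    · intro h
      apply hZtop
      rw [eq_top_iff]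
      rintro ⟨a, b⟩ -
      obtain ⟨⟨c, d⟩, hcd, rfl⟩ : a ∈ Z.map (LinearMap.fst (ZMod 2) S T) := by rw [hfst]; trivial
      have : b - d ∈ Z.comap (LinearMap.inr (ZMod 2) S T) := by rw [h]; trivial
      have := Z.add_mem this hcd
      simpa using this
  let f := (LinearMap.fst (ZMod 2) S T).domRestrict Z
  let f' := (LinearMap.snd (ZMod 2) S T).domRestrict Z
  have hf : Function.Bijective f := by
    constructor
    · rw [injective_iff_map_eq_zero]
      rintro ⟨⟨a, b⟩, hab⟩ h
      obtain rfl : a = 0 := h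
      have : b ∈ Z.comap (LinearMap.inr (ZMod 2) S T) := hab
      rw [hker2] at this
      obtain rfl : b = 0 := this
      rfl
    · intro a
      obtain ⟨x, hx, rfl⟩ : a ∈ Z.map (LinearMap.fst (ZMod 2) S T) := by rw [hfst]; trivial
      exact ⟨⟨x, hx⟩, rfl⟩
  have hf' : Function.Bijective f' := by
    constructor
    · rw [injective_iff_map_eq_zero]
      rintro ⟨⟨a, b⟩, hab⟩ h
      obtain rfl : b = 0 := h
      have : a ∈ Z.comap (LinearMap.inl (ZMod 2) S T) := hab
      rw [hker1] at this
      obtain rfl : a = 0 := this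
      rfl
    · intro b
      obtain ⟨x, hx, rfl⟩ : b ∈ Z.map (LinearMap.snd (ZMod 2) S T) := by rw [hsnd]; trivial
      exact ⟨⟨x, hx⟩, rfl⟩
  refine ⟨(LinearEquiv.ofBijective f hf).symm.trans (LinearEquiv.ofBijective f' hf'), fun g x => ?_⟩
  obtain ⟨z, rfl⟩ := (LinearEquiv.ofBijective f hf).surjective x
  have : σ g (LinearEquiv.ofBijective f hf z) =
      LinearEquiv.ofBijective f hf ⟨σ.prod τ g z, hst g z z.2⟩ := rfl
  rw [this]
  simp only [LinearEquiv.trans_apply, LinearEquiv.symm_apply_apply]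
  rfl

end

/-! ### The tensor power: invariant form, row and column sums -/

section
variable (n : ℕ) (μ : YoungDiagram)

/-- The basis of the tensor power that consists of the tensors of standard basis vectors, indexed
by the fillings of the boxes with numbers less than `n`. -/
def fillingBasis : Module.Basis (Box μ → Fin n) (ZMod 2) (TensorPow n μ) :=
  Basis.piTensorProduct fun _ => Pi.basisFun (ZMod 2) (Fin n)

variable {n μ}

/-- The tensor of standard basis vectors of a filling. -/
def fillingTensor (f : Box μ → Fin n) : TensorPow n μ :=
  PiTensorProduct.tprod (ZMod 2) fun b => Pi.single (f b) 1

theorem fillingBasis_apply (f : Box μ → Fin n) : fillingBasis n μ f = fillingTensor f := by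
  simp [fillingBasis, fillingTensor, Basis.piTensorProduct_apply]

theorem fillingBasis_repr_tprod (v : Box μ → Fin n → ZMod 2) (f : Box μ → Fin n) :
    (fillingBasis n μ).repr (PiTensorProduct.tprod (ZMod 2) v) f = ∏ b, v b (f b) := by
  simp [fillingBasis, Basis.piTensorProduct_repr_tprod_apply]

/-- The symmetric bilinear form on the tensor power for which the tensors of standard basis vectors
are orthonormal. -/
def form : TensorPow n μ →ₗ[ZMod 2] TensorPow n μ →ₗ[ZMod 2] ZMod 2 :=
  LinearMap.mk₂ (ZMod 2)
    (fun x y => ∑ f, (fillingBasis n μ).repr x f * (fillingBasis n μ).repr y f)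
    (fun x x' y => by simp [add_mul, Finset.sum_add_distrib])
    (fun c x y => by simp [mul_assoc, Finset.mul_sum])
    (fun x y y' => by simp [mul_add, Finset.sum_add_distrib])
    (fun c x y => by simp [mul_left_comm, Finset.mul_sum])

theorem form_apply (x y : TensorPow n μ) :
    form x y = ∑ f, (fillingBasis n μ).repr x f * (fillingBasis n μ).repr y f := rfl

theorem form_tprod (v w : Box μ → Fin n → ZMod 2) :
    form (PiTensorProduct.tprod (ZMod 2) v) (PiTensorProduct.tprod (ZMod 2) w) =
      ∏ b, ∑ i, v b i * w b i := by
  rw [form_apply, Finset.prod_univ_sum]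
  simp [fillingBasis_repr_tprod, Finset.prod_mul_distrib]

theorem form_fillingTensor (x : TensorPow n μ) (f : Box μ → Fin n) :
    form x (fillingTensor f) = (fillingBasis n μ).repr x f := by
  rw [form_apply, ← fillingBasis_apply]
  simp [Module.Basis.repr_self, Finsupp.single_apply]

theorem eq_zero_of_form_eq_zero {x : TensorPow n μ} (h : ∀ y, form x y = 0) : x = 0 := by
  apply (fillingBasis n μ).ext_elem
  intro f
  rw [← form_fillingTensor, h]; simp

theorem tensorRep_tprod (g : GL2 n) (v : Box μ → Fin n → ZMod 2) :
    tensorRep n μ g (PiTensorProduct.tprod (ZMod 2) v) =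
      PiTensorProduct.tprod (ZMod 2) fun b => g.1.mulVec (v b) :=
  PiTensorProduct.map_tprod _ _

/-- Two linear maps into linear forms agree if they agree on pure tensors. -/
theorem form_ext {F G : TensorPow n μ →ₗ[ZMod 2] TensorPow n μ →ₗ[ZMod 2] ZMod 2}
    (h : ∀ v w, F (PiTensorProduct.tprod (ZMod 2) v) (PiTensorProduct.tprod (ZMod 2) w) =
      G (PiTensorProduct.tprod (ZMod 2) v) (PiTensorProduct.tprod (ZMod 2) w)) : F = G := by
  apply PiTensorProduct.ext
  refine MultilinearMap.ext fun v => ?_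
  apply PiTensorProduct.ext
  refine MultilinearMap.ext fun w => ?_
  exact h v w

/-- The transpose matrix acts by the adjoint. -/
theorem form_tensorRep (g : GL2 n) (x y : TensorPow n μ) :
    form (tensorRep n μ g x) y = form x (tensorRep n μ (transp g) y) := by
  have : form ∘ₗ tensorRep n μ g = form.compl₂ (tensorRep n μ (transp g)) := by
    apply form_ext
    intro v w
    simp only [LinearMap.comp_apply, LinearMap.compl₂_apply, tensorRep_tprod, form_tprod]
    refine Finset.prod_congr rfl fun b _ => ?_
    have := Matrix.dotProduct_mulVec (w b) g.1 (v b)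
    rw [← Matrix.mulVec_transpose] at this
    simp only [dotProduct] at this
    rw [Finset.sum_congr rfl fun i _ => mul_comm _ _, this]
    exact Finset.sum_congr rfl fun i _ => mul_comm _ _
  exact LinearMap.congr_fun (LinearMap.congr_fun this x) y

open Classical in
theorem permSum_tprod (H : Set (Equiv.Perm (Box μ))) (v : Box μ → Fin n → ZMod 2) :
    permSum n μ H (PiTensorProduct.tprod (ZMod 2) v) =
      ∑ σ : Equiv.Perm (Box μ) with σ ∈ H, PiTensorProduct.tprod (ZMod 2) fun b => v (σ.symm b) := by
  rw [permSum, LinearMap.sum_apply]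
  exact Finset.sum_congr rfl fun σ _ => PiTensorProduct.reindex_tprod _ _

theorem form_permSum {H : Set (Equiv.Perm (Box μ))} (hH : ∀ σ ∈ H, σ⁻¹ ∈ H)
    (x y : TensorPow n μ) : form (permSum n μ H x) y = form x (permSum n μ H y) := by
  classical
  have : form ∘ₗ permSum n μ H = form.compl₂ (permSum n μ H) := by
    apply form_ext
    intro v w
    simp only [LinearMap.comp_apply, LinearMap.compl₂_apply, permSum_tprod, map_sum,
      LinearMap.sum_apply, form_tprod]
    refine Finset.sum_nbij' (fun σ => σ⁻¹) (fun σ => σ⁻¹) ?_ ?_ (by simp) (by simp) ?_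
    · intro σ hσ; simpa using hH σ (by simpa using hσ)
    · intro σ hσ; simpa using hH σ (by simpa using hσ)
    · intro σ _
      rw [← Equiv.prod_comp σ]
      refine Finset.prod_congr rfl fun b _ => ?_
      rw [Equiv.symm_apply_apply]
      rfl
  exact LinearMap.congr_fun (LinearMap.congr_fun this x) y

theorem inv_mem_rowStabilizer : ∀ σ ∈ rowStabilizer μ, σ⁻¹ ∈ rowStabilizer μ := by
  intro σ hσ b
  have := hσ (σ⁻¹ b)
  rw [show σ (σ⁻¹ b) = b from Equiv.apply_symm_apply σ b] at this
  exact this.symm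

theorem inv_mem_colStabilizer : ∀ σ ∈ colStabilizer μ, σ⁻¹ ∈ colStabilizer μ := by
  intro σ hσ b
  have := hσ (σ⁻¹ b)
  rw [show σ (σ⁻¹ b) = b from Equiv.apply_symm_apply σ b] at this
  exact this.symm

/-- The row symmetrization of a pure tensor is an alternating function of the entries of each
row. -/
theorem rowSum_tprod_eq_zero {v : Box μ → Fin n → ZMod 2} {b b' : Box μ} (hne : b ≠ b')
    (hrow : b.1.1 = b'.1.1) (hv : v b = v b') :
    permSum n μ (rowStabilizer μ) (PiTensorProduct.tprod (ZMod 2) v) = 0 := by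
  classical
  rw [permSum_tprod]
  have hsw : ∀ c, (Equiv.swap b b' c).1.1 = c.1.1 := by
    intro c
    rw [Equiv.swap_apply_def]
    split_ifs with h1 h2
    · rw [h1, hrow]
    · rw [h2, hrow]
    · rfl
  refine Finset.sum_involution (fun σ _ => σ * Equiv.swap b b') ?_ ?_ ?_ ?_
  · intro σ _
    rw [show (fun c => v ((σ * Equiv.swap b b').symm c)) = fun c => v (σ.symm c) from ?_,
      add_self_zmod]
    funext c
    change v (Equiv.swap b b' (σ.symm c)) = _
    rw [Equiv.swap_apply_def]
    split_ifs with h1 h2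
    · rw [h1, hv]
    · rw [h2, hv]
    · rfl
  · intro σ _ _ h
    rw [mul_eq_left] at h
    exact hne (by simpa using congrArg (· b') h)
  · intro σ hσ
    simp only [Finset.mem_filter, Finset.mem_univ, true_and] at hσ ⊢
    intro c
    rw [Equiv.Perm.mul_apply, hσ, hsw]
  · intro σ _
    rw [mul_assoc, Equiv.swap_mul_self, mul_one]

theorem rowSum_tprod_comp (v : Box μ → Fin n → ZMod 2) {τ : Equiv.Perm (Box μ)}
    (hτ : τ ∈ rowStabilizer μ) :
    permSum n μ (rowStabilizer μ) (PiTensorProduct.tprod (ZMod 2) fun b => v (τ b)) =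
      permSum n μ (rowStabilizer μ) (PiTensorProduct.tprod (ZMod 2) v) := by
  classical
  rw [permSum_tprod, permSum_tprod]
  refine Finset.sum_nbij' (fun σ => σ * τ⁻¹) (fun σ => σ * τ) ?_ ?_ (by simp) (by simp) ?_
  · intro σ hσ
    simp only [Finset.mem_filter, Finset.mem_univ, true_and] at hσ ⊢
    intro c
    rw [Equiv.Perm.mul_apply, hσ, inv_mem_rowStabilizer _ hτ]
  · intro σ hσ
    simp only [Finset.mem_filter, Finset.mem_univ, true_and] at hσ ⊢
    intro c
    rw [Equiv.Perm.mul_apply, hσ, hτ]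
  · intro σ _
    rfl

/-- In a row sum, an entry may be changed by a combination of the other entries of its row. -/
theorem rowSum_tprod_update_of_mem_span (v : Box μ → Fin n → ZMod 2) (b : Box μ)
    {z z' : Fin n → ZMod 2}
    (hz : z' - z ∈ Submodule.span (ZMod 2) {x | ∃ c : Box μ, c ≠ b ∧ c.1.1 = b.1.1 ∧ v c = x}) :
    permSum n μ (rowStabilizer μ) (PiTensorProduct.tprod (ZMod 2) (Function.update v b z')) =
      permSum n μ (rowStabilizer μ) (PiTensorProduct.tprod (ZMod 2) (Function.update v b z)) := by
  classical
  let F : (Fin n → ZMod 2) →ₗ[ZMod 2] TensorPow n μ :=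
    permSum n μ (rowStabilizer μ) ∘ₗ (PiTensorProduct.tprod (ZMod 2)).toLinearMap v b
  have h : Submodule.span (ZMod 2) {x | ∃ c : Box μ, c ≠ b ∧ c.1.1 = b.1.1 ∧ v c = x} ≤
      LinearMap.ker F := by
    refine Submodule.span_le.2 ?_
    rintro _ ⟨c, hc, hrow, rfl⟩
    refine rowSum_tprod_eq_zero hc hrow ?_
    rw [Function.update_self, Function.update_of_ne hc]
  have := h hz
  rw [LinearMap.mem_ker, map_sub, sub_eq_zero] at this
  exact this

/-- The row symmetrization of a pure tensor does not change under unitriangular column operations in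
each row. -/
theorem rowSum_tprod_congr {v x : Box μ → Fin n → ZMod 2}
    (h : ∀ b, x b - v b ∈
      Submodule.span (ZMod 2) {y | ∃ c : Box μ, c.1.2 < b.1.2 ∧ c.1.1 = b.1.1 ∧ v c = y}) :
    permSum n μ (rowStabilizer μ) (PiTensorProduct.tprod (ZMod 2) x) =
      permSum n μ (rowStabilizer μ) (PiTensorProduct.tprod (ZMod 2) v) := by
  classical
  have key : ∀ (k : ℕ) (s : Finset (Box μ)), s.card = k →
      (∀ b ∈ s, ∀ c : Box μ, b.1.2 ≤ c.1.2 → c ∈ s ∨ c.1.1 ≠ b.1.1) →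
      permSum n μ (rowStabilizer μ) (PiTensorProduct.tprod (ZMod 2) (s.piecewise x v)) =
      permSum n μ (rowStabilizer μ) (PiTensorProduct.tprod (ZMod 2) v) := by
    intro k
    induction k with
    | zero =>
      intro s hs _
      rw [Finset.card_eq_zero.1 hs, Finset.piecewise_empty]
    | succ k ih =>
      intro s hs hup
      -- replace the entry of a box in the leftmost column that meets `s`
      obtain ⟨b, hb, hmin⟩ := s.exists_min_image (fun b => b.1.2)
        (Finset.card_pos.1 (by omega))
      have h1 : s.piecewise x v = Function.update ((s.erase b).piecewise x v) b (x b) := by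
        rw [← Finset.piecewise_insert, Finset.insert_erase hb]
      have h2 : (s.erase b).piecewise x v = Function.update ((s.erase b).piecewise x v) b (v b) := by
        rw [eq_comm, Function.update_eq_self_iff]
        simp
      rw [h1, rowSum_tprod_update_of_mem_span _ b (z := v b), ← h2,
        ih (s.erase b) (by rw [Finset.card_erase_of_mem hb]; omega)]
      · intro a ha c hac
        have ha' := Finset.mem_of_mem_erase ha
        rcases hup a ha' c hac with hc | hc
        · by_cases hcb : c = b
          · subst hcb
            right
            intro hrow
            have : a = c := Subtype.ext (Prod.ext hrow.symm (le_antisymm hac (hmin a ha')))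
            exact Finset.ne_of_mem_erase ha this
          · exact .inl (Finset.mem_erase.2 ⟨hcb, hc⟩)
        · exact .inr hc
      · refine Submodule.span_mono ?_ (h b)
        rintro _ ⟨c, hc, hrow, rfl⟩
        refine ⟨c, ?_, hrow, ?_⟩
        · rintro rfl; exact absurd hc (lt_irrefl _)
        · rw [Finset.piecewise_eq_of_notMem]
          intro hcs
          exact absurd (hmin c (Finset.mem_of_mem_erase hcs)) (not_le.2 hc)
  have := key _ Finset.univ rfl (fun b _ c _ => .inl (Finset.mem_univ c))
  rwa [Finset.piecewise_univ] at this

/-- Polarization: in characteristic `2`, the column symmetrization of a pure tensor is a sum of pure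
tensors with constant columns. In the expansion of the sum over all sets of boxes, the terms are
indexed by functions from the boxes to the boxes. The image of a function that is not surjective is
contained in an even number of sets of boxes, so that only permutations contribute. -/
theorem colSum_tprod_mem_span (v : Box μ → Fin n → ZMod 2) :
    permSum n μ (colStabilizer μ) (PiTensorProduct.tprod (ZMod 2) v) ∈
      Submodule.span (ZMod 2) {t | ∃ x : ℕ → Fin n → ZMod 2,
        PiTensorProduct.tprod (ZMod 2) (fun b : Box μ => x b.1.2) = t} := by
  classical
  have key : permSum n μ (colStabilizer μ) (PiTensorProduct.tprod (ZMod 2) v) =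
      ∑ I : Finset (Box μ), PiTensorProduct.tprod (ZMod 2) fun b : Box μ =>
        ∑ c ∈ I.filter (fun c => c.1.2 = b.1.2), v c := by
    simp only [MultilinearMap.map_sum_finset]
    rw [Finset.sum_comm' (t' := Finset.univ.filter fun φ : Box μ → Box μ => ∀ b, (φ b).1.2 = b.1.2)
      (s' := fun φ => Finset.univ.filter fun I : Finset (Box μ) => Finset.univ.image φ ⊆ I)]
    · simp only [Finset.sum_const]
      have hcard : ∀ φ : Box μ → Box μ,
          (Finset.univ.filter fun I : Finset (Box μ) => Finset.univ.image φ ⊆ I).card =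
          2 ^ (Fintype.card (Box μ) - (Finset.univ.image φ).card) := by
        intro φ
        rw [← Finset.card_univ, ← Finset.card_Icc_finset (Finset.subset_univ _)]
        congr 1
        ext I
        simp only [Finset.mem_filter, Finset.mem_univ, true_and, Finset.mem_Icc]
        exact ⟨fun h => ⟨h, Finset.subset_univ _⟩, fun h => h.1⟩
      have hzero : ∀ φ : Box μ → Box μ, ¬ Function.Surjective φ → ∀ t : TensorPow n μ,
          (Finset.univ.filter fun I : Finset (Box μ) => Finset.univ.image φ ⊆ I).card • t = 0 := by
        intro φ hφ t
        have : (Finset.univ.image φ).card < Fintype.card (Box μ) := by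
          rw [Finset.card_lt_iff_ne_univ]
          intro h
          refine hφ fun c => ?_
          have hc := Finset.mem_univ c
          rw [← h] at hc
          obtain ⟨a, _, ha⟩ := Finset.mem_image.1 hc
          exact ⟨a, ha⟩
        obtain ⟨m, hm⟩ : ∃ m, Fintype.card (Box μ) - (Finset.univ.image φ).card = m + 1 :=
          ⟨_, (Nat.succ_pred_eq_of_pos (Nat.sub_pos_of_lt this)).symm⟩
        rw [hcard, hm, pow_succ, mul_smul, two_smul, add_self_zmod, nsmul_zero]
      have hone : ∀ φ : Box μ → Box μ, Function.Surjective φ → ∀ t : TensorPow n μ,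
          (Finset.univ.filter fun I : Finset (Box μ) => Finset.univ.image φ ⊆ I).card • t = t := by
        intro φ hφ t
        rw [hcard, Finset.image_univ_of_surjective hφ, Finset.card_univ]
        simp
      rw [permSum_tprod, ← Finset.sum_filter_add_sum_filter_not _ (fun φ => Function.Surjective φ),
        Finset.sum_eq_zero (s := Finset.filter _ _)
          (fun φ hφ => hzero φ (Finset.mem_filter.1 hφ).2 _), add_zero]
      refine Finset.sum_bij (fun σ _ => ⇑σ⁻¹) ?_ ?_ ?_ ?_
      · intro σ hσ
        simp only [Finset.mem_filter, Finset.mem_univ, true_and] at hσ ⊢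
        exact ⟨inv_mem_colStabilizer _ hσ, σ⁻¹.surjective⟩
      · intro σ _ τ _ h
        exact inv_injective (DFunLike.coe_injective h)
      · intro φ hφ
        simp only [Finset.mem_filter, Finset.mem_univ, true_and] at hφ
        let σ := Equiv.ofBijective φ (Finite.surjective_iff_bijective.1 hφ.2)
        refine ⟨σ⁻¹, ?_, by rw [inv_inv]; rfl⟩
        simp only [Finset.mem_filter, Finset.mem_univ, true_and]
        exact inv_mem_colStabilizer σ hφ.1
      · intro σ hσ
        rw [hone _ σ⁻¹.surjective]
        rfl
    · intro I φ
      simp only [Finset.mem_univ, Fintype.mem_piFinset, Finset.mem_filter, true_and,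
        Finset.image_subset_iff, forall_true_left]
      exact forall_and
  rw [key]
  refine Submodule.sum_mem _ fun I _ => Submodule.subset_span ⟨fun j =>
    ∑ c ∈ I.filter (fun c => c.1.2 = j), v c, rfl⟩

end

/-! ### The highest weight vector of the tensor power -/

section
variable {n : ℕ} {μ : YoungDiagram}

theorem snd_lt_rowLen (b : Box μ) : b.1.2 < μ.rowLen b.1.1 := by
  have := b.2
  rw [YoungDiagram.mem_cells] at this
  exact YoungDiagram.mem_iff_lt_rowLen.1 this

theorem snd_lt (hn : μ.rowLen 0 = n) (b : Box μ) : b.1.2 < n :=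
  (snd_lt_rowLen b).trans_le ((μ.rowLen_anti 0 _ (Nat.zero_le _)).trans_eq hn)

/-- The filling of each box with the number of its column. -/
def colFilling (hn : μ.rowLen 0 = n) (b : Box μ) : Fin n := ⟨b.1.2, snd_lt hn b⟩

/-- The highest weight vector of `⨂ᵢ Λ^{μᵢ} V`: the row symmetrization of the filling of each box
with its column. -/
def highestVector (hn : μ.rowLen 0 = n) : TensorPow n μ :=
  permSum n μ (rowStabilizer μ) (fillingTensor (colFilling hn))

theorem permSum_tensorRep (H : Set (Equiv.Perm (Box μ))) (g : GL2 n) (x : TensorPow n μ) :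
    permSum n μ H (tensorRep n μ g x) = tensorRep n μ g (permSum n μ H x) :=
  (LinearMap.congr_fun (permSum_comm n μ H g) x).symm

theorem tensorRep_highestVector (hn : μ.rowLen 0 = n) (g : GL2 n) :
    tensorRep n μ g (highestVector hn) = permSum n μ (rowStabilizer μ)
      (PiTensorProduct.tprod (ZMod 2) fun b => fun i => g.1 i (colFilling hn b)) := by
  rw [highestVector, ← permSum_tensorRep, fillingTensor, tensorRep_tprod]
  congr 2
  funext b
  exact Matrix.mulVec_single_one _ _

/-- An upper unitriangular matrix acts on the column filling by unitriangular column operations in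
each row. -/
theorem highestVector_mem_fixedUpper (hn : μ.rowLen 0 = n) :
    highestVector hn ∈ fixedUpper (tensorRep n μ) := by
  classical
  intro u hu
  rw [tensorRep_highestVector, highestVector, fillingTensor]
  refine rowSum_tprod_congr fun b => ?_
  -- the entries of the column of `u` above the diagonal are realized by boxes to the left
  have : ((fun i => u.1 i (colFilling hn b)) - Pi.single (colFilling hn b) 1 : Fin n → ZMod 2) =
      ∑ k : Fin n with k < colFilling hn b, u.1 k (colFilling hn b) • Pi.single k 1 := by
    funext i
    rw [Finset.sum_apply]
    simp only [Pi.sub_apply, Pi.smul_apply, Pi.single_apply, smul_eq_mul, mul_ite, mul_one,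
      mul_zero]
    rw [Finset.sum_ite_eq]
    by_cases hi : i < colFilling hn b
    · simp [hi, hi.ne]
    · rw [hu i _ (not_lt.1 hi)]
      simp [hi, Matrix.one_apply]
  rw [this]
  refine Submodule.sum_mem _ fun k hk => Submodule.smul_mem _ _ (Submodule.subset_span ?_)
  have hk' : k.val < b.1.2 := (Finset.mem_filter.1 hk).2
  refine ⟨⟨(b.1.1, k.val), ?_⟩, hk', rfl, ?_⟩
  · rw [YoungDiagram.mem_cells, YoungDiagram.mem_iff_lt_rowLen]
    exact hk'.trans (snd_lt_rowLen b)
  · rfl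

/-- The set of parts of a partition. -/
def parts (μ : YoungDiagram) : Finset ℕ := Finset.univ.image fun b : Box μ => μ.rowLen b.1.1

theorem mem_parts {q : ℕ} : q ∈ parts μ ↔ 0 < q ∧ ∃ i, μ.rowLen i = q := by
  simp only [parts, Finset.mem_image, Finset.mem_univ, true_and]
  constructor
  · rintro ⟨b, rfl⟩
    exact ⟨(Nat.zero_le _).trans_lt (snd_lt_rowLen b), _, rfl⟩
  · rintro ⟨h, i, rfl⟩
    exact ⟨⟨(i, 0), by rwa [YoungDiagram.mem_cells, YoungDiagram.mem_iff_lt_rowLen]⟩, rfl⟩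

/-- The permutation of the boxes that exchanges the columns `p` and `p + 1` in each row that meets
both. -/
def colSwap (μ : YoungDiagram) (p : ℕ) : Equiv.Perm (Box μ) :=
  Function.Involutive.toPerm
    (fun b => if h : p + 1 < μ.rowLen b.1.1 then
      ⟨(b.1.1, Equiv.swap p (p + 1) b.1.2), by
        have := snd_lt_rowLen b
        rw [YoungDiagram.mem_cells, YoungDiagram.mem_iff_lt_rowLen, Equiv.swap_apply_def]
        split_ifs <;> omega⟩ else b)
    (fun b => by
      by_cases h : p + 1 < μ.rowLen b.1.1
      · simp [h]
      · simp [h])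

theorem colSwap_of_lt {p : ℕ} {b : Box μ} (h : p + 1 < μ.rowLen b.1.1) :
    (colSwap μ p b).1 = (b.1.1, Equiv.swap p (p + 1) b.1.2) :=
  congrArg Subtype.val (dif_pos h)

theorem colSwap_of_not_lt {p : ℕ} {b : Box μ} (h : ¬ p + 1 < μ.rowLen b.1.1) :
    colSwap μ p b = b :=
  dif_neg h

theorem colSwap_mem (p : ℕ) : colSwap μ p ∈ rowStabilizer μ := by
  intro b
  by_cases h : p + 1 < μ.rowLen b.1.1
  · rw [colSwap_of_lt h]
  · rw [colSwap_of_not_lt h]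

theorem val_swap {p q : Fin n} (h : p.val + 1 = q.val) (i : Fin n) :
    (Equiv.swap p q i).val = Equiv.swap p.val (p.val + 1) i.val := by
  simp only [Equiv.swap_apply_def, Fin.ext_iff, ← h]
  split_ifs <;> simp [h]

theorem permGL_col (σ : Equiv.Perm (Fin n)) (j : Fin n) :
    (fun i => (permGL σ).1 i j) = Pi.single (σ j) 1 := by
  funext i
  rw [permGL_apply, Pi.single_apply]

/-- In a row of length other than `q`, the transposition of `p` and `q = p + 1` exchanges two
factors or none, so it fixes the row sum of `e_0, e_1, …`. In the row of length `q` it replaces the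
last factor `e_p` by `e_q`, and adding the translate under the transvection gives `e_q + (e_q + e_p)
= e_p`. If there is no row of length `q`, then both summands of the Hecke operator map the vector to
itself, and they cancel. -/
theorem hecke_highestVector (hn : μ.rowLen 0 = n)
    (hs : ∀ i k, i < k → 0 < μ.rowLen k → μ.rowLen k < μ.rowLen i)
    {p q : Fin n} (h : p.val + 1 = q.val) :
    hecke (tensorRep n μ) h (highestVector hn) =
      if q.val ∈ parts μ then highestVector hn else 0 := by
  classical
  have hx := highestVector_mem_fixedUpper hn _ (elemGL_mem_upper (lt_of_adj h))
  have hswap : tensorRep n μ (permGL (Equiv.swap p q)) (highestVector hn) =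
      permSum n μ (rowStabilizer μ) (PiTensorProduct.tprod (ZMod 2) fun b =>
        Pi.single (Equiv.swap p q (colFilling hn (colSwap μ p b))) 1) := by
    rw [tensorRep_highestVector]
    rw [show (fun (b : Box μ) i => (permGL (Equiv.swap p q)).1 i (colFilling hn b)) =
      fun b => Pi.single (Equiv.swap p q (colFilling hn b)) 1 from
        funext fun b => permGL_col _ _]
    exact (rowSum_tprod_comp (fun b => Pi.single (Equiv.swap p q (colFilling hn b)) 1)
      (colSwap_mem p)).symm
  have hval : ∀ b : Box μ, p.val + 1 < μ.rowLen b.1.1 →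
      Equiv.swap p q (colFilling hn (colSwap μ p b)) = colFilling hn b := by
    intro b hb
    apply Fin.ext
    rw [val_swap h]
    simp [colFilling, colSwap_of_lt hb]
  have hlow : ∀ b : Box μ, μ.rowLen b.1.1 ≤ p.val →
      Equiv.swap p q (colFilling hn (colSwap μ p b)) = colFilling hn b := by
    intro b hb
    have := snd_lt_rowLen b
    rw [colSwap_of_not_lt (by omega), Equiv.swap_apply_of_ne_of_ne]
    · intro e; have := congrArg Fin.val e; simp only [colFilling] at this; omega
    · intro e; have := congrArg Fin.val e; simp only [colFilling] at this; omega
  split_ifs with hq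
  · obtain ⟨-, i, hi⟩ := mem_parts.1 hq
    -- the last box of the unique row of length `q`; `G z` has the entry `z` in this box
    let b₀ : Box μ := ⟨(i, p), by
      rw [YoungDiagram.mem_cells, YoungDiagram.mem_iff_lt_rowLen]; omega⟩
    let G : (Fin n → ZMod 2) →ₗ[ZMod 2] TensorPow n μ := permSum n μ (rowStabilizer μ) ∘ₗ
      (PiTensorProduct.tprod (ZMod 2)).toLinearMap
        (fun b => (Pi.single (colFilling hn b) 1 : Fin n → ZMod 2)) b₀
    have hG : ∀ z, G z = permSum n μ (rowStabilizer μ) (PiTensorProduct.tprod (ZMod 2)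
        (Function.update (fun b => Pi.single (colFilling hn b) 1) b₀ z)) := fun z => rfl
    have hb₀ : colFilling hn b₀ = p := rfl
    have hrow : ∀ b : Box μ, b ≠ b₀ → p.val + 1 < μ.rowLen b.1.1 ∨ μ.rowLen b.1.1 ≤ p.val ∨
        (b.1.1 = i ∧ b.1.2 < p.val) := by
      intro b hb
      have hlt := snd_lt_rowLen b
      rcases lt_trichotomy b.1.1 i with h1 | h1 | h1
      · left; have := hs _ _ h1 (by omega); omega
      · right; right
        refine ⟨h1, ?_⟩
        have h2 : b.1.2 ≠ p.val := fun e => hb (Subtype.ext (Prod.ext h1 e))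
        rw [h1] at hlt
        omega
      · right; left; have := hs _ _ h1 (by omega); omega
    have h1 : tensorRep n μ (permGL (Equiv.swap p q)) (highestVector hn) = G (Pi.single q 1) := by
      rw [hswap, hG]
      congr 2
      funext b
      by_cases hb : b = b₀
      · subst hb
        rw [Function.update_self, colSwap_of_not_lt (by change ¬ _ < μ.rowLen i; omega), hb₀,
          Equiv.swap_apply_left]
      · rw [Function.update_of_ne hb]
        rcases hrow b hb with h1 | h1 | h1
        · rw [hval b h1]
        · rw [hlow b h1]
        · rw [colSwap_of_not_lt (by rw [h1.1]; omega), Equiv.swap_apply_of_ne_of_ne]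
          · intro e; have := congrArg Fin.val e; simp only [colFilling] at this; omega
          · intro e; have := congrArg Fin.val e; simp only [colFilling] at this; omega
    have hcol : ∀ j : Fin n, (elemGL p q (ne_of_adj h)).1.mulVec (Pi.single j 1) =
        Pi.single j 1 + if j = q then Pi.single p 1 else 0 := by
      intro j
      funext k
      rw [Matrix.mulVec_single_one, Matrix.col_apply, elemGL_apply]
      by_cases hj : j = q
      · simp [hj, Matrix.one_apply, Pi.single_apply]
      · simp [hj, Matrix.one_apply, Pi.single_apply]
    have h2 : tensorRep n μ (elemGL p q (ne_of_adj h)) (G (Pi.single q 1)) =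
        G (Pi.single q 1 + Pi.single p 1) := by
      rw [hG, hG, ← permSum_tensorRep, tensorRep_tprod]
      refine rowSum_tprod_congr fun b => ?_
      by_cases hb : b = b₀
      · subst hb
        rw [Function.update_self, Function.update_self, hcol, if_pos rfl, sub_self]
        exact zero_mem _
      · rw [Function.update_of_ne hb, Function.update_of_ne hb, hcol, add_sub_cancel_left]
        split_ifs with hbq
        · have hbq' : b.1.2 = q.val := congrArg Fin.val hbq
          have hlt := snd_lt_rowLen b
          refine Submodule.subset_span ⟨⟨(b.1.1, p), ?_⟩, ?_, rfl, ?_⟩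
          · rw [YoungDiagram.mem_cells, YoungDiagram.mem_iff_lt_rowLen]; omega
          · change p.val < b.1.2; omega
          · rw [Function.update_of_ne]
            · rfl
            · intro e
              have : b.1.1 = i := congrArg (fun c : Box μ => c.1.1) e
              rw [this] at hlt
              omega
        · exact zero_mem _
    have h3 : highestVector hn = G (Pi.single p 1) := by
      rw [hG, highestVector, fillingTensor]
      congr 2
      funext b
      by_cases hb : b = b₀
      · subst hb
        rw [Function.update_self, hb₀]
      · rw [Function.update_of_ne hb]
    rw [hecke_apply, h1, h2, map_add, ← h3, ← add_assoc, add_self_zmod, zero_add]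
  · have hne : ∀ b : Box μ, μ.rowLen b.1.1 ≠ q.val := by
      intro b hb
      exact hq (mem_parts.2 ⟨by omega, _, hb⟩)
    have h1 : tensorRep n μ (permGL (Equiv.swap p q)) (highestVector hn) = highestVector hn := by
      rw [hswap, highestVector, fillingTensor]
      congr 2
      funext b
      by_cases hb : p.val + 1 < μ.rowLen b.1.1
      · rw [hval b hb]
      · rw [hlow b (by have := hne b; omega)]
    rw [hecke_apply, h1, hx, add_self_zmod]

theorem highestVector_isWeightVector (hn : μ.rowLen 0 = n)
    (hs : ∀ i k, i < k → 0 < μ.rowLen k → μ.rowLen k < μ.rowLen i) :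
    IsWeightVector (tensorRep n μ) (parts μ) (highestVector hn) :=
  ⟨highestVector_mem_fixedUpper hn, fun _ _ h => hecke_highestVector hn hs h⟩

/-- The filling of the box `(i, j)` with `μᵢ - 1 - j`. -/
def revFilling (hn : μ.rowLen 0 = n) (b : Box μ) : Fin n :=
  ⟨μ.rowLen b.1.1 - 1 - b.1.2, by
    have := snd_lt_rowLen b
    have := (μ.rowLen_anti 0 b.1.1 (Nat.zero_le _)).trans_eq hn
    omega⟩

/-- A rearrangement of the columns of `revFilling` that has no repeated entries in its rows is
trivial. By induction on the entry and the row, all boxes keep their position. -/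
theorem eq_one_of_rowInjective (hn : μ.rowLen 0 = n)
    (hs : ∀ i k, i < k → 0 < μ.rowLen k → μ.rowLen k < μ.rowLen i)
    {σ : Equiv.Perm (Box μ)} (hσ : σ ∈ colStabilizer μ)
    (hinj : ∀ b b' : Box μ, b.1.1 = b'.1.1 →
      revFilling hn (σ b) = revFilling hn (σ b') → b = b') : σ = 1 := by
  have key : ∀ c i : ℕ, ∀ b : Box μ, (revFilling hn b).val = c → b.1.1 = i → σ b = b := by
    intro c
    induction c using Nat.strong_induction_on with
    | _ c ihc =>
    intro i
    induction i using Nat.strong_induction_on with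
    | _ i ihi =>
    intro b hbc hbi
    set b' := σ⁻¹ b with hb'
    have hσb' : σ b' = b := Equiv.apply_symm_apply σ b
    have hcol : b.1.2 = b'.1.2 := by rw [← hσb']; exact hσ b'
    have hl := snd_lt_rowLen b
    have hl' := snd_lt_rowLen b'
    simp only [revFilling] at hbc
    rcases lt_trichotomy b'.1.1 b.1.1 with h1 | h1 | h1
    · -- the row of `b'` contains the entry `c` already
      have hlen := hs _ _ h1 (by omega)
      let b'' : Box μ := ⟨(b'.1.1, μ.rowLen b'.1.1 - 1 - c), by
        rw [YoungDiagram.mem_cells, YoungDiagram.mem_iff_lt_rowLen]; omega⟩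
      have hb''c : (revFilling hn b'').val = c := by
        simp only [revFilling, b'']; omega
      have hfix : σ b'' = b'' := ihi b'.1.1 (hbi ▸ h1) b'' hb''c rfl
      have : b' = b'' := by
        refine hinj _ _ rfl ?_
        rw [hσb', hfix]
        apply Fin.ext
        rw [hb''c]
        exact hbc
      rw [← hσb', this, hfix, hfix]
    · have : b' = b := Subtype.ext (Prod.ext h1 hcol.symm)
      rw [this] at hσb'
      exact hσb'
    · -- the box `b'` has a smaller entry, hence is fixed
      have hlen := hs _ _ h1 (by omega)
      have hfix : σ b' = b' := ihc _ (by simp only [revFilling]; omega) _ b' rfl rfl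
      rw [hσb'] at hfix
      rw [hfix, hσb', hfix]
  ext1 b
  exact key _ _ b rfl rfl

/-- The permutation that reverses each row. -/
def rowReverse (μ : YoungDiagram) : Equiv.Perm (Box μ) :=
  Function.Involutive.toPerm
    (fun b => ⟨(b.1.1, μ.rowLen b.1.1 - 1 - b.1.2), by
        have := snd_lt_rowLen b
        rw [YoungDiagram.mem_cells, YoungDiagram.mem_iff_lt_rowLen]; omega⟩)
    (fun b => by
      have := snd_lt_rowLen b
      apply Subtype.ext
      apply Prod.ext
      · rfl
      · change μ.rowLen b.1.1 - 1 - (μ.rowLen b.1.1 - 1 - b.1.2) = b.1.2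
        omega)

/-- Of the rearrangements of the columns of `revFilling`, only the trivial one has a nonzero row
sum, because the row sum is alternating; its row sum is the highest weight vector. -/
theorem rowSum_colSum_revFilling (hn : μ.rowLen 0 = n)
    (hs : ∀ i k, i < k → 0 < μ.rowLen k → μ.rowLen k < μ.rowLen i) :
    permSum n μ (rowStabilizer μ) (permSum n μ (colStabilizer μ)
      (fillingTensor (revFilling hn))) = highestVector hn := by
  classical
  rw [fillingTensor, permSum_tprod, map_sum, Finset.sum_eq_single 1]
  · exact rowSum_tprod_comp (τ := rowReverse μ) (fun b => Pi.single (colFilling hn b) 1)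
      (fun b => rfl)
  · intro σ hσ hne
    have hσ' : σ⁻¹ ∈ colStabilizer μ := inv_mem_colStabilizer _ (by simpa using hσ)
    by_contra h0
    refine hne (inv_eq_one.1 (eq_one_of_rowInjective hn hs hσ' ?_))
    intro b b' hrow hbb
    by_contra hbne
    exact h0 (rowSum_tprod_eq_zero hbne hrow (congrArg (fun j => Pi.single j 1) hbb))
  · intro h
    exact absurd (by simp only [Finset.mem_filter, Finset.mem_univ, true_and]; intro b; rfl) h

end

/-! ### The weight vector of `S_μ` and its matrix coefficients -/

section
variable {n : ℕ} {μ : YoungDiagram}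

theorem form_symmetrizer (x y : TensorPow n μ) :
    form (symmetrizer n μ x) y = form x (symmetrizer n μ y) := by
  simp only [symmetrizer, Module.End.mul_apply]
  rw [form_permSum inv_mem_colStabilizer, form_permSum inv_mem_rowStabilizer,
    form_permSum inv_mem_colStabilizer]

/-- The image of the operator that takes row sums of column sums is generated by the highest weight
vector. By polarization, only tensors with constant columns are needed. If the columns are linearly
independent, the row sum is a translate of the highest weight vector, and otherwise it vanishes. -/
theorem rowSum_colSum_mem_lowerSpan (hn : μ.rowLen 0 = n)
    (hs : ∀ i k, i < k → 0 < μ.rowLen k → μ.rowLen k < μ.rowLen i) (x : TensorPow n μ) :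
    permSum n μ (rowStabilizer μ) (permSum n μ (colStabilizer μ) x) ∈
      lowerSpan (tensorRep n μ) (highestVector hn) := by
  classical
  have hw := highestVector_isWeightVector hn hs
  set W := lowerSpan (tensorRep n μ) (highestVector hn)
  have hmem : highestVector hn ∈ W := Submodule.subset_span ⟨1, one_mem _, by rw [map_one]; rfl⟩
  -- tensors with constant columns
  have hcol : ∀ x : ℕ → Fin n → ZMod 2, permSum n μ (rowStabilizer μ)
      (PiTensorProduct.tprod (ZMod 2) (fun b : Box μ => x b.1.2)) ∈ W := by
    intro x
    let X : Matrix (Fin n) (Fin n) (ZMod 2) := Matrix.of fun i j => x j i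
    by_cases hX : LinearIndependent (ZMod 2) fun j : Fin n => x j
    · -- the columns are the image of the standard basis under an invertible matrix
      have hu : IsUnit X := by
        rw [← Matrix.linearIndependent_cols_iff_isUnit]
        exact hX
      have : tensorRep n μ hu.unit (highestVector hn) = permSum n μ (rowStabilizer μ)
          (PiTensorProduct.tprod (ZMod 2) (fun b : Box μ => x b.1.2)) :=
        tensorRep_highestVector hn hu.unit
      rw [← this]
      exact lowerSpan_stable hw _ hmem
    · -- a linear dependence of the columns is seen in the row of length `n`
      obtain ⟨k, hk⟩ : ∃ k : Fin n, x k ∈ Submodule.span (ZMod 2)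
          ((fun j : Fin n => x j) '' {k}ᶜ) := by
        by_contra! hcon
        apply hX
        rw [linearIndependent_iff_notMem_span]
        intro k
        rw [← Set.compl_eq_univ_sdiff]
        exact hcon k
      let b₀ : Box μ := ⟨(0, k), by
        rw [YoungDiagram.mem_cells, YoungDiagram.mem_iff_lt_rowLen, hn]; exact k.2⟩
      have h1 := rowSum_tprod_update_of_mem_span (fun b : Box μ => x b.1.2) b₀ (z := 0)
        (z' := x k) (by
          rw [sub_zero]
          refine Submodule.span_mono ?_ hk
          rintro _ ⟨j, hj, rfl⟩
          refine ⟨⟨(0, j), ?_⟩, ?_, rfl, rfl⟩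
          · rw [YoungDiagram.mem_cells, YoungDiagram.mem_iff_lt_rowLen, hn]; exact j.2
          · intro e
            exact hj (Fin.ext (congrArg (fun c : Box μ => c.1.2) e)))
      have h2 : Function.update (fun b : Box μ => x b.1.2) b₀ (x k) = fun b => x b.1.2 := by
        rw [Function.update_eq_self_iff]
      rw [h2] at h1
      rw [h1, MultilinearMap.map_update_zero, map_zero]
      exact zero_mem _
  have h : ⊤ ≤ W.comap (permSum n μ (rowStabilizer μ) ∘ₗ permSum n μ (colStabilizer μ)) := by
    rw [← PiTensorProduct.span_tprod_eq_top, Submodule.span_le]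
    rintro _ ⟨v, rfl⟩
    have h2 : Submodule.span (ZMod 2) {t | ∃ x : ℕ → Fin n → ZMod 2,
        PiTensorProduct.tprod (ZMod 2) (fun b : Box μ => x b.1.2) = t} ≤
        W.comap (permSum n μ (rowStabilizer μ)) := by
      refine Submodule.span_le.2 ?_
      rintro _ ⟨x, rfl⟩
      exact hcol x
    exact h2 (colSum_tprod_mem_span v)
  exact h (Submodule.mem_top (x := x))

/-- The weight vector of `S_μ`. -/
def simpleVector (hn : μ.rowLen 0 = n) : LinearMap.range (symmetrizer n μ) :=
  ⟨symmetrizer n μ (fillingTensor (revFilling hn)), _, rfl⟩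

theorem simpleVector_val (hn : μ.rowLen 0 = n)
    (hs : ∀ i k, i < k → 0 < μ.rowLen k → μ.rowLen k < μ.rowLen i) :
    (simpleVector hn : TensorPow n μ) = permSum n μ (colStabilizer μ) (highestVector hn) := by
  rw [← rowSum_colSum_revFilling hn hs]
  rfl

theorem simpleRep_val (g : GL2 n) (y : LinearMap.range (symmetrizer n μ)) :
    (simpleRep n μ g y : TensorPow n μ) = tensorRep n μ g y := rfl

theorem hecke_simpleRep_val {p q : Fin n} (h : p.val + 1 = q.val)
    (y : LinearMap.range (symmetrizer n μ)) :
    (hecke (simpleRep n μ) h y : TensorPow n μ) = hecke (tensorRep n μ) h y := rfl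

theorem simpleVector_isWeightVector (hn : μ.rowLen 0 = n)
    (hs : ∀ i k, i < k → 0 < μ.rowLen k → μ.rowLen k < μ.rowLen i) :
    IsWeightVector (simpleRep n μ) (parts μ) (simpleVector hn) := by
  have hw := highestVector_isWeightVector hn hs
  constructor
  · intro u hu
    apply Subtype.ext
    rw [simpleRep_val, simpleVector_val hn hs, ← permSum_tensorRep, hw.mem u hu]
  · intro p q h
    apply Subtype.ext
    have hc : hecke (tensorRep n μ) h (permSum n μ (colStabilizer μ) (highestVector hn)) =
        permSum n μ (colStabilizer μ) (hecke (tensorRep n μ) h (highestVector hn)) := by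
      simp only [hecke_apply, map_add, permSum_tensorRep]
    rw [hecke_simpleRep_val, simpleVector_val hn hs, hc, hw.hecke_eq]
    split_ifs
    · rw [simpleVector_val hn hs]
    · rw [map_zero]; rfl

/-- `S_μ` is generated by its weight vector. -/
theorem lowerSpan_simpleVector (hn : μ.rowLen 0 = n)
    (hs : ∀ i k, i < k → 0 < μ.rowLen k → μ.rowLen k < μ.rowLen i) :
    lowerSpan (simpleRep n μ) (simpleVector hn) = ⊤ := by
  rw [eq_top_iff]
  rintro ⟨_, x, rfl⟩ -
  have h : lowerSpan (tensorRep n μ) (highestVector hn) ≤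
      ((lowerSpan (simpleRep n μ) (simpleVector hn)).map
        (LinearMap.range (symmetrizer n μ)).subtype).comap (permSum n μ (colStabilizer μ)) := by
    refine Submodule.span_le.2 ?_
    rintro _ ⟨u, hu, rfl⟩
    refine ⟨_, Submodule.subset_span ⟨u, hu, rfl⟩, ?_⟩
    rw [permSum_tensorRep, ← simpleVector_val hn hs]
    rfl
  obtain ⟨y, hy, hyx⟩ := h (rowSum_colSum_mem_lowerSpan hn hs x)
  rw [show (⟨symmetrizer n μ x, x, rfl⟩ : LinearMap.range (symmetrizer n μ)) = y from
    Subtype.ext hyx.symm]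
  exact hy

/-- The linear form on `S_μ` given by the coefficient at `revFilling`. -/
def simpleForm (hn : μ.rowLen 0 = n) : Module.Dual (ZMod 2) (LinearMap.range (symmetrizer n μ)) :=
  (form.flip (fillingTensor (revFilling hn))).domRestrict _

theorem simpleForm_apply (hn : μ.rowLen 0 = n) (y : LinearMap.range (symmetrizer n μ)) :
    simpleForm hn y = form (y : TensorPow n μ) (fillingTensor (revFilling hn)) := rfl

/-- The translates of `simpleForm` under the upper unitriangular group separate the points, because
the symmetrizer is self-adjoint and the dual translates of its weight vector generate its image. -/
theorem eq_zero_of_simpleForm (hn : μ.rowLen 0 = n)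
    (hs : ∀ i k, i < k → 0 < μ.rowLen k → μ.rowLen k < μ.rowLen i)
    {y : LinearMap.range (symmetrizer n μ)}
    (h : ∀ u ∈ lower n, simpleForm hn (simpleRep n μ (transp u) y) = 0) : y = 0 := by
  obtain ⟨_, x, rfl⟩ := y
  apply Subtype.ext
  refine eq_zero_of_form_eq_zero fun z => ?_
  rw [form_symmetrizer]
  have hle : lowerSpan (simpleRep n μ) (simpleVector hn) ≤
      LinearMap.ker ((form x).domRestrict (LinearMap.range (symmetrizer n μ))) := by
    refine Submodule.span_le.2 ?_
    rintro _ ⟨u, hu, rfl⟩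
    have h1 := h u hu
    rw [simpleForm_apply, simpleRep_val, form_tensorRep, transp_transp, form_symmetrizer] at h1
    refine LinearMap.mem_ker.2 ?_
    rw [LinearMap.domRestrict_apply, simpleRep_val]
    have h2 : tensorRep n μ u (simpleVector hn : TensorPow n μ) =
        symmetrizer n μ (tensorRep n μ u (fillingTensor (revFilling hn))) :=
      LinearMap.congr_fun (symmetrizer_comm n μ u) _
    rw [h2, h1]
  rw [lowerSpan_simpleVector hn hs] at hle
  have h3 := LinearMap.mem_ker.1 (hle (Submodule.mem_top (x := ⟨symmetrizer n μ z, z, rfl⟩)))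
  rwa [LinearMap.domRestrict_apply] at h3

/-- The matrix coefficients of `S_μ` are matrix coefficients of the highest weight vector in the
tensor power. -/
theorem simpleForm_simpleVector (hn : μ.rowLen 0 = n)
    (hs : ∀ i k, i < k → 0 < μ.rowLen k → μ.rowLen k < μ.rowLen i) (g : GL2 n) :
    simpleForm hn (simpleRep n μ g (simpleVector hn)) =
      form (tensorRep n μ g (fillingTensor (colFilling hn))) (highestVector hn) := by
  rw [simpleForm_apply, simpleRep_val, simpleVector_val hn hs, ← permSum_tensorRep,
    form_permSum inv_mem_colStabilizer, highestVector, ← permSum_tensorRep,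
    form_permSum inv_mem_rowStabilizer, rowSum_colSum_revFilling hn hs]
  rfl

/-- The leading principal minor of size `l`. -/
def leadingMinor (l : ℕ) (g : Matrix (Fin n) (Fin n) (ZMod 2)) : ZMod 2 :=
  (g.toSquareBlockProp fun i => i.val < l).det

/-- The matrix coefficient of the highest weight vector is a product of leading minors, one for each
row. -/
theorem form_highestVector (hn : μ.rowLen 0 = n)
    (hs : ∀ i k, i < k → 0 < μ.rowLen k → μ.rowLen k < μ.rowLen i) (g : GL2 n) :
    form (tensorRep n μ g (fillingTensor (colFilling hn))) (highestVector hn) =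
      ∏ l ∈ parts μ, leadingMinor l g.1 := by
  classical
  -- both sides are the determinant of a block diagonal matrix indexed by the boxes
  let K : Matrix (Box μ) (Box μ) (ZMod 2) := Matrix.of fun b c =>
    if b.1.1 = c.1.1 then g.1 (colFilling hn b) (colFilling hn c) else 0
  have h1 : form (tensorRep n μ g (fillingTensor (colFilling hn))) (highestVector hn) = K.det := by
    rw [highestVector, fillingTensor, tensorRep_tprod, permSum_tprod, map_sum, Matrix.det_apply,
      ← Finset.sum_subset (Finset.filter_subset (fun σ => σ ∈ rowStabilizer μ) Finset.univ)]
    · refine Finset.sum_nbij' (fun σ => σ⁻¹) (fun σ => σ⁻¹) ?_ ?_ (by simp) (by simp) ?_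
      · intro σ hσ
        simp only [Finset.mem_filter, Finset.mem_univ, true_and] at hσ ⊢
        exact inv_mem_rowStabilizer _ hσ
      · intro σ hσ
        simp only [Finset.mem_filter, Finset.mem_univ, true_and] at hσ ⊢
        exact inv_mem_rowStabilizer _ hσ
      · intro σ hσ
        have hσ' : σ ∈ rowStabilizer μ := by simpa using hσ
        have hsign : ∀ z : ZMod 2, (Equiv.Perm.sign σ⁻¹) • z = z := by
          intro z
          rcases Int.units_eq_one_or (Equiv.Perm.sign σ⁻¹) with h | h <;> rw [h]
          · simp
          · revert z; decide
        rw [hsign, form_tprod]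
        refine Finset.prod_congr rfl fun b _ => ?_
        have hrow := inv_mem_rowStabilizer _ hσ' b
        change _ = if (σ⁻¹ b).1.1 = b.1.1 then _ else _
        have hsum : ∀ (v : Fin n → ZMod 2) (j : Fin n),
            ∑ i, v i * (Pi.single j 1 : Fin n → ZMod 2) i = v j := by
          intro v j
          simp [Pi.single_apply]
        rw [if_pos hrow, Matrix.mulVec_single_one]
        exact hsum _ _
    · intro σ _ hσ
      have : ¬ ∀ b, (σ b).1.1 = b.1.1 := fun h =>
        hσ (Finset.mem_filter.2 ⟨Finset.mem_univ _, h⟩)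
      push Not at this
      obtain ⟨b, hb⟩ := this
      rw [Finset.prod_eq_zero (Finset.mem_univ b), smul_zero]
      exact if_neg hb
  have h2 : K.BlockTriangular fun b => b.1.1 := by
    intro b c hbc
    exact if_neg hbc.ne'
  rw [h1, h2.det]
  have himg : parts μ = (Finset.univ.image fun b : Box μ => b.1.1).image μ.rowLen := by
    rw [Finset.image_image]; rfl
  have hinj : Set.InjOn μ.rowLen (Finset.univ.image fun b : Box μ => b.1.1 : Finset ℕ) := by
    intro a ha a' ha' haa
    obtain ⟨b, -, rfl⟩ := Finset.mem_image.1 (Finset.mem_coe.1 ha)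
    obtain ⟨b', -, rfl⟩ := Finset.mem_image.1 (Finset.mem_coe.1 ha')
    have hb := snd_lt_rowLen b
    have hb' := snd_lt_rowLen b'
    rcases lt_trichotomy b.1.1 b'.1.1 with h | h | h
    · have := hs _ _ h (by omega); omega
    · exact h
    · have := hs _ _ h (by omega); omega
  rw [himg, Finset.prod_image hinj]
  refine Finset.prod_congr rfl fun a ha => ?_
  let e : {b : Box μ // b.1.1 = a} ≃ {i : Fin n // i.val < μ.rowLen a} :=
    { toFun := fun b => ⟨colFilling hn b.1, by
        have := snd_lt_rowLen b.1; rw [b.2] at this; exact this⟩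
      invFun := fun i => ⟨⟨(a, i.1), by
        rw [YoungDiagram.mem_cells, YoungDiagram.mem_iff_lt_rowLen]; exact i.2⟩, rfl⟩
      left_inv := fun b => by
        apply Subtype.ext; apply Subtype.ext; exact Prod.ext b.2.symm rfl
      right_inv := fun i => rfl }
  rw [leadingMinor, ← Matrix.det_submatrix_equiv_self e]
  congr 1
  ext b c
  change (if b.1.1.1 = c.1.1.1 then _ else _) = _
  rw [if_pos (b.2.trans c.2.symm)]
  rfl

end

/-! ### Simplicity of `S_μ` -/

section
variable {n : ℕ} {μ : YoungDiagram}

instance finite_simpleRep : Finite (LinearMap.range (symmetrizer n μ)) := by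
  have : Module.Finite (ZMod 2) (TensorPow n μ) := Module.Finite.of_basis (fillingBasis n μ)
  have : Finite (TensorPow n μ) := Module.finite_of_finite (ZMod 2)
  infer_instance

theorem leadingMinor_one (l : ℕ) : leadingMinor l (1 : Matrix (Fin n) (Fin n) (ZMod 2)) = 1 := by
  rw [leadingMinor]
  convert Matrix.det_one (n := {i : Fin n // i.val < l}) (R := ZMod 2)
  ext i j
  simp [Matrix.toSquareBlockProp, Matrix.one_apply, Subtype.ext_iff]

theorem leadingMinor_self (g : GL2 n) : leadingMinor n g.1 = 1 := by
  let e : Fin n ≃ {i : Fin n // i.val < n} :=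
    ⟨fun i => ⟨i, i.2⟩, fun i => i.1, fun _ => rfl, fun _ => rfl⟩
  have h : leadingMinor n g.1 = g.1.det := by
    rw [leadingMinor, ← Matrix.det_submatrix_equiv_self e]
    rfl
  have h1 : IsUnit g.1.det := (Matrix.isUnit_iff_isUnit_det _).1 g.isUnit
  rcases zmod2_cases g.1.det with h0 | h0
  · rw [h0] at h1; exact absurd h1 not_isUnit_zero
  · rw [h, h0]

theorem simpleForm_eq_prod (hn : μ.rowLen 0 = n)
    (hs : ∀ i k, i < k → 0 < μ.rowLen k → μ.rowLen k < μ.rowLen i) (g : GL2 n) :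
    simpleForm hn (simpleRep n μ g (simpleVector hn)) = ∏ l ∈ parts μ, leadingMinor l g.1 := by
  rw [simpleForm_simpleVector hn hs, form_highestVector hn hs]

theorem simpleForm_simpleVector_self (hn : μ.rowLen 0 = n)
    (hs : ∀ i k, i < k → 0 < μ.rowLen k → μ.rowLen k < μ.rowLen i) :
    simpleForm hn (simpleVector hn) = 1 := by
  have h := simpleForm_eq_prod hn hs 1
  rw [map_one] at h
  refine h.trans (Finset.prod_eq_one fun l _ => ?_)
  exact leadingMinor_one l

theorem simpleVector_ne_zero (hn : μ.rowLen 0 = n)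
    (hs : ∀ i k, i < k → 0 < μ.rowLen k → μ.rowLen k < μ.rowLen i) :
    (simpleVector hn : LinearMap.range (symmetrizer n μ)) ≠ 0 := by
  intro h
  have := simpleForm_simpleVector_self hn hs
  rw [h, map_zero] at this
  exact zero_ne_one this

/-- The vectors of `S_μ` fixed by the upper unitriangular group form a line: on such vectors
all translates of `simpleForm` agree, so `simpleForm` is injective on them. -/
theorem eq_simpleVector (hn : μ.rowLen 0 = n)
    (hs : ∀ i k, i < k → 0 < μ.rowLen k → μ.rowLen k < μ.rowLen i)
    {y : LinearMap.range (symmetrizer n μ)} (hy : y ∈ fixedUpper (simpleRep n μ)) (h0 : y ≠ 0) :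
    y = simpleVector hn := by
  have key : ∀ y ∈ fixedUpper (simpleRep n μ), simpleForm hn y = 0 → y = 0 := by
    intro y hy h
    refine eq_zero_of_simpleForm hn hs fun u hu => ?_
    rw [mem_fixedUpper.1 hy _ (mem_lower.1 hu), h]
  have h1 : simpleForm hn y = 1 :=
    (zmod2_cases _).resolve_left fun h => h0 (key y hy h)
  refine sub_eq_zero.1 (key _ (sub_mem hy (simpleVector_isWeightVector hn hs).mem) ?_)
  rw [map_sub, h1, simpleForm_simpleVector_self hn hs, sub_self]

/-- A nonzero stable subspace contains a nonzero vector fixed by the upper unitriangular group,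
which is the weight vector, and the weight vector generates `S_μ`. -/
theorem hasNoProperSub_simpleRep (hn : μ.rowLen 0 = n)
    (hs : ∀ i k, i < k → 0 < μ.rowLen k → μ.rowLen k < μ.rowLen i) :
    HasNoProperSub (simpleRep n μ) := by
  intro Y hY
  by_cases hbot : Y = ⊥
  · exact Or.inl hbot
  right
  have : Nontrivial Y := Submodule.nontrivial_iff_ne_bot.2 hbot
  let σ : Representation (ZMod 2) (GL2 n) Y :=
    (simpleRep n μ).subrepresentation Y fun g y hy => hY g y hy
  obtain ⟨v, hv, hfix⟩ := exists_fixed_of_isPGroup σ (isPGroup_upper n)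
  have hv' : (v : LinearMap.range (symmetrizer n μ)) = simpleVector hn := by
    refine eq_simpleVector hn hs (mem_fixedUpper.2 fun u hu => ?_) fun h => hv (Subtype.ext h)
    exact congrArg Subtype.val (hfix u hu)
  rw [eq_top_iff, ← lowerSpan_simpleVector hn hs]
  refine Submodule.span_le.2 ?_
  rintro _ ⟨u, hu, rfl⟩
  rw [← hv']
  exact hY u _ v.2

end

/-! ### Ranks over the field with two elements -/

/-- The vector over `𝔽₂` whose coordinates are the binary digits of `x`. -/
def bits (x : ℕ) : ℕ → ZMod 2 := fun k => if x.testBit k then 1 else 0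

theorem bits_zero : bits 0 = 0 := by
  funext k; simp [bits]

theorem bits_xor (x y : ℕ) : bits (x ^^^ y) = bits x + bits y := by
  funext k
  simp only [bits, Nat.testBit_xor, Pi.add_apply]
  cases x.testBit k <;> cases y.testBit k <;> decide

/-- The number with binary digits `f 0, …, f (N - 1)`. -/
def bitMask (f : ℕ → Bool) : ℕ → ℕ
  | 0 => 0
  | N + 1 => bitMask f N ^^^ (bif f N then 2 ^ N else 0)

theorem testBit_bitMask (f : ℕ → Bool) (N k : ℕ) :
    (bitMask f N).testBit k = (decide (k < N) && f k) := by
  induction N with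
  | zero => simp [bitMask]
  | succ N ih =>
    rw [bitMask, Nat.testBit_xor, ih]
    rcases lt_trichotomy k N with h | rfl | h
    · cases hf : f N <;> simp [h, h.ne', Nat.lt_succ_of_lt h]
    · cases hf : f k <;> simp
    · cases hf : f N <;> simp [h.not_gt, h.ne, show ¬ k < N + 1 by omega]

/-- Gaussian elimination on rows given by the binary digits of numbers; the first argument bounds
the number of steps. -/
def bitRank : ℕ → List ℕ → ℕ
  | 0, _ => 0
  | _ + 1, [] => 0
  | m + 1, p :: r => bif p == 0 then bitRank m r else
      bitRank m (r.map fun x => bif x.testBit p.log2 then x ^^^ p else x) + 1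

/-- Elimination of one row removes the leading digit of the pivot from the other rows, whose span
then does not contain the pivot. -/
theorem finrank_span_bits (m : ℕ) (r : List ℕ) (h : r.length ≤ m) :
    Module.finrank (ZMod 2) (Submodule.span (ZMod 2) {v | ∃ x ∈ r, bits x = v}) =
      bitRank m r := by
  have hnil : Module.finrank (ZMod 2)
      (Submodule.span (ZMod 2) {v | ∃ x ∈ ([] : List ℕ), bits x = v}) = 0 := by
    have : {v | ∃ x ∈ ([] : List ℕ), bits x = v} = ∅ := by
      ext v; simp
    rw [this, Submodule.span_empty, finrank_bot]
  induction m generalizing r with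
  | zero =>
    obtain rfl : r = [] := List.length_eq_zero_iff.1 (by omega)
    exact hnil
  | succ m ih =>
    cases r with
    | nil => exact hnil
    | cons p r =>
      by_cases hp : p = 0
      · subst hp
        rw [bitRank, beq_self_eq_true, cond_true, ← ih r (by simpa using h)]
        have : Submodule.span (ZMod 2) {v | ∃ x ∈ 0 :: r, bits x = v} =
            Submodule.span (ZMod 2) {v | ∃ x ∈ r, bits x = v} := ?_
        · rw [this]
        apply le_antisymm
        · refine Submodule.span_le.2 ?_
          rintro _ ⟨x, hx, rfl⟩
          rcases List.mem_cons.1 hx with rfl | hx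
          · rw [bits_zero]; exact zero_mem _
          · exact Submodule.subset_span ⟨x, hx, rfl⟩
        · exact Submodule.span_mono fun v ⟨x, hx, hv⟩ => ⟨x, List.mem_cons_of_mem _ hx, hv⟩
      · have hb : (p == 0) = false := by simpa using hp
        set r' := r.map fun x => bif x.testBit p.log2 then x ^^^ p else x with hr'
        rw [bitRank, hb, cond_false, ← hr', ← ih r' (by simpa [hr'] using h)]
        set W := Submodule.span (ZMod 2) {v | ∃ x ∈ r', bits x = v} with hW
        set W₁ := Submodule.span (ZMod 2) {bits p}
        have hp1 : bits p p.log2 = 1 := if_pos (Nat.testBit_log2 hp)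
        have hker : W ≤ LinearMap.ker (LinearMap.proj (R := ZMod 2) (φ := fun _ : ℕ => ZMod 2)
            p.log2) := by
          refine Submodule.span_le.2 ?_
          rintro _ ⟨x, hx, rfl⟩
          obtain ⟨y, hy, rfl⟩ := List.mem_map.1 hx
          refine LinearMap.mem_ker.2 (if_neg ?_)
          cases hyl : y.testBit p.log2
          · simp [hyl]
          · simp [hyl, Nat.testBit_xor, Nat.testBit_log2 hp]
        have hdisj : W₁ ⊓ W = ⊥ := by
          rw [eq_bot_iff]
          rintro v ⟨hv1, hv2⟩
          obtain ⟨c, rfl⟩ := Submodule.mem_span_singleton.1 hv1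
          have := LinearMap.mem_ker.1 (hker hv2)
          rw [map_smul, LinearMap.proj_apply, hp1, smul_eq_mul, mul_one] at this
          rw [this, zero_smul]; exact zero_mem _
        have hsup : Submodule.span (ZMod 2) {v | ∃ x ∈ p :: r, bits x = v} = W₁ ⊔ W := by
          apply le_antisymm
          · refine Submodule.span_le.2 ?_
            rintro _ ⟨x, hx, rfl⟩
            rcases List.mem_cons.1 hx with rfl | hx
            · exact Submodule.mem_sup_left (Submodule.mem_span_singleton_self _)
            · have hx' : bits (bif x.testBit p.log2 then x ^^^ p else x) ∈ W :=
                Submodule.subset_span ⟨_, List.mem_map_of_mem hx, rfl⟩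
              cases hxl : x.testBit p.log2
              · rw [hxl, cond_false] at hx'
                exact Submodule.mem_sup_right hx'
              · rw [hxl, cond_true, bits_xor] at hx'
                have := sub_mem (Submodule.mem_sup_right (S := W₁) hx')
                  (Submodule.mem_sup_left (Submodule.mem_span_singleton_self (bits p)))
                rwa [add_sub_cancel_right] at this
          · refine sup_le (Submodule.span_mono ?_) (Submodule.span_le.2 ?_)
            · rintro _ rfl
              exact ⟨p, List.mem_cons_self, rfl⟩
            · rintro _ ⟨x, hx, rfl⟩
              obtain ⟨y, hy, rfl⟩ := List.mem_map.1 hx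
              have hy' : bits y ∈ Submodule.span (ZMod 2) {v | ∃ x ∈ p :: r, bits x = v} :=
                Submodule.subset_span ⟨y, List.mem_cons_of_mem _ hy, rfl⟩
              cases hyl : y.testBit p.log2
              · simpa [hyl] using hy'
              · simp only [cond_true, bits_xor]
                exact add_mem hy' (Submodule.subset_span ⟨p, List.mem_cons_self, rfl⟩)
        have hfin : ∀ r : List ℕ, Module.Finite (ZMod 2)
            (Submodule.span (ZMod 2) {v | ∃ x ∈ r, bits x = v}) := fun r =>
          Module.Finite.span_of_finite (ZMod 2) ((List.finite_toSet r).image bits)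
        have : Module.Finite (ZMod 2) W := hfin r'
        have h1 := Submodule.finrank_sup_add_finrank_inf_eq W₁ W
        have h2 : Module.finrank (ZMod 2) W₁ = 1 := finrank_span_singleton fun h0 => by
          rw [h0] at hp1; exact zero_ne_one hp1
        rw [hdisj, finrank_bot, h2] at h1
        rw [hsup]; omega

theorem bits_and (x y : ℕ) : bits (x &&& y) = bits x * bits y := by
  funext k
  simp only [bits, Nat.testBit_and, Pi.mul_apply]
  cases x.testBit k <;> cases y.testBit k <;> decide

/-- The sum of the first `n` values of `f`. -/
def natSum (f : ℕ → ℕ) : ℕ → ℕ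
  | 0 => 0
  | n + 1 => natSum f n + f n

/-- The bitwise sum modulo `2` of the first `n` values of `f`. -/
def xorSum (f : ℕ → ℕ) : ℕ → ℕ
  | 0 => 0
  | n + 1 => xorSum f n ^^^ f n

/-- The entries of the lower unitriangular matrix with binary code `k`: the entries below the
diagonal, row by row, are the binary digits of `k`. -/
def lowEntry (k i j : ℕ) : ℕ :=
  bif j == i then 1 else bif Nat.blt j i then (k >>> (i * (i - 1) / 2 + j)) % 2 else 0

/-- The number whose `k`-th binary digit, for `k < N`, is the entry at `(i, j)` of the lower
unitriangular matrix with code `k`. -/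
def lowMask (N i j : ℕ) : ℕ := bitMask (fun k => (lowEntry k i j).testBit 0) N

/-- The product of `n × n` matrices with natural entries. -/
def natMul (n : ℕ) (P Q : ℕ → ℕ → ℕ) (i j : ℕ) : ℕ := natSum (fun m => P i m * Q m j) n

/-- The number whose `k`-th binary digit, for `k < N`, is the entry at `(i, j)` of `uᵀ B` modulo
`2`, where `u` is the lower unitriangular matrix with code `k`. -/
def mulMask (N n : ℕ) (B : ℕ → ℕ → ℕ) (i j : ℕ) : ℕ :=
  xorSum (fun m => bif (B m j).testBit 0 then lowMask N m i else 0) n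

/-- Bitwise leading principal minors modulo `2`. The value at sizes other than `1`, `2`, `3` is the
number with `N` digits `1`; it is used only for the determinant of an invertible `4 × 4` matrix. -/
def minorMask (N : ℕ) (A : ℕ → ℕ → ℕ) : ℕ → ℕ
  | 1 => A 0 0
  | 2 => (A 0 0 &&& A 1 1) ^^^ (A 0 1 &&& A 1 0)
  | 3 => (A 0 0 &&& ((A 1 1 &&& A 2 2) ^^^ (A 1 2 &&& A 2 1))) ^^^
      (A 0 1 &&& ((A 1 0 &&& A 2 2) ^^^ (A 1 2 &&& A 2 0))) ^^^
      (A 0 2 &&& ((A 1 0 &&& A 2 1) ^^^ (A 1 1 &&& A 2 0)))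
  | _ => bitMask (fun _ => true) N

/-- The powers of an `n × n` matrix with natural entries. -/
def natPow (n : ℕ) (C : ℕ → ℕ → ℕ) : ℕ → ℕ → ℕ → ℕ
  | 0 => fun i j => bif i == j then 1 else 0
  | e + 1 => natMul n C (natPow n C e)

/-- A row of the Gram matrix of the sum of the powers of `C` with exponents in `L`, where `w` is the
list of parts: its `k'`-th binary digit is the sum over `e` in `L` of the product over `l` in `w` of
the leading minors of size `l` of `u'ᵀ C ^ e u`, for the lower unitriangular matrices `u`, `u'` with
codes `k`, `k'`. -/
def gramRow (n N : ℕ) (w : List ℕ) (C : ℕ → ℕ → ℕ) (L : List ℕ) (k : ℕ) : ℕ :=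
  L.foldr (fun e x => w.foldr (fun l y =>
    minorMask N (mulMask N n (natMul n (natPow n C e) (lowEntry k))) l &&& y)
      (bitMask (fun _ => true) N) ^^^ x) 0

/-- The rank modulo `2` of the Gram matrix with the rows `gramRow`, computed by elimination. -/
def gramRank (n N : ℕ) (w : List ℕ) (C : ℕ → ℕ → ℕ) (L : List ℕ) : ℕ :=
  bitRank N ((List.range N).map (gramRow n N w C L))

theorem bits_bitMask (f : ℕ → Bool) (N k : ℕ) :
    bits (bitMask f N) k = if k < N then (if f k then 1 else 0) else 0 := by
  rw [bits, testBit_bitMask]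
  by_cases h : k < N <;> simp [h]

theorem cast_eq_testBit (m : ℕ) : (m : ZMod 2) = if m.testBit 0 then 1 else 0 := by
  rw [Nat.testBit_zero]
  rcases Nat.mod_two_eq_zero_or_one m with h | h
  · rw [h, if_neg (by decide)]
    exact (ZMod.natCast_eq_zero_iff m 2).2 (Nat.dvd_of_mod_eq_zero h)
  · rw [h, if_pos (by decide)]
    rw [← Nat.div_add_mod m 2, h]
    push_cast
    rw [show (2 : ZMod 2) = 0 from rfl, zero_mul, zero_add]

theorem bits_lowMask {N k : ℕ} (h : k < N) (i j : ℕ) :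
    bits (lowMask N i j) k = (lowEntry k i j : ZMod 2) := by
  rw [lowMask, bits_bitMask, if_pos h, cast_eq_testBit]

theorem bits_xorSum (f : ℕ → ℕ) (n : ℕ) : bits (xorSum f n) = ∑ m : Fin n, bits (f m) := by
  induction n with
  | zero => exact bits_zero
  | succ n ih => rw [xorSum, bits_xor, ih, Fin.sum_univ_castSucc]; rfl

theorem natSum_eq (f : ℕ → ℕ) (n : ℕ) : natSum f n = ∑ m : Fin n, f m := by
  induction n with
  | zero => rfl
  | succ n ih => rw [natSum, ih, Fin.sum_univ_castSucc]; rfl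

/-- The matrix over `𝔽₂` with given natural entries. -/
def natMatrix (n : ℕ) (A : ℕ → ℕ → ℕ) : Matrix (Fin n) (Fin n) (ZMod 2) :=
  Matrix.of fun i j => (A i j : ZMod 2)

theorem natMatrix_natMul (n : ℕ) (P Q : ℕ → ℕ → ℕ) :
    natMatrix n (natMul n P Q) = natMatrix n P * natMatrix n Q := by
  ext i j
  simp [natMatrix, natMul, natSum_eq, Matrix.mul_apply]

theorem natMatrix_natPow (n : ℕ) (C : ℕ → ℕ → ℕ) (e : ℕ) :
    natMatrix n (natPow n C e) = natMatrix n C ^ e := by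
  induction e with
  | zero =>
    ext i j
    rw [pow_zero, Matrix.one_apply]
    change (((bif i.val == j.val then 1 else 0 : ℕ)) : ZMod 2) = _
    by_cases h : i = j
    · simp [h]
    · have : (i.val == j.val) = false := by simpa [Fin.ext_iff] using h
      simp [h, this]
  | succ e ih => rw [natPow, natMatrix_natMul, ih, pow_succ']

theorem bits_mulMask {N k : ℕ} (h : k < N) {n : ℕ} (B : ℕ → ℕ → ℕ) (i j : Fin n) :
    bits (mulMask N n B i j) k = ((natMatrix n (lowEntry k)).transpose * natMatrix n B) i j := by
  rw [mulMask, bits_xorSum, Finset.sum_apply, Matrix.mul_apply]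
  refine Finset.sum_congr rfl fun m _ => ?_
  change _ = (lowEntry k m i : ZMod 2) * (B m j : ZMod 2)
  rw [cast_eq_testBit (B m j)]
  cases hB : (B m j).testBit 0
  · simp [bits_zero]
  · simp [bits_lowMask h]

section
variable {n : ℕ}

theorem leadingMinor_eq {l : ℕ} (hl : l ≤ n) (g : Matrix (Fin n) (Fin n) (ZMod 2)) :
    leadingMinor l g = (g.submatrix (Fin.castLE hl) (Fin.castLE hl)).det := by
  let e : Fin l ≃ {i : Fin n // i.val < l} :=
    ⟨fun i => ⟨Fin.castLE hl i, i.2⟩, fun i => ⟨i.1, i.2⟩, fun _ => rfl, fun _ => rfl⟩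
  rw [leadingMinor, ← Matrix.det_submatrix_equiv_self e]
  rfl

theorem bits_minorMask {N k : ℕ} (hk : k < N) (hn : n ≤ 4) {A : ℕ → ℕ → ℕ} {g : GL2 n}
    (hA : ∀ i j : Fin n, bits (A i j) k = g.1 i j) {l : ℕ} (h0 : 0 < l) (hl : l ≤ n) :
    bits (minorMask N A l) k = leadingMinor l g.1 := by
  have hA' : ∀ i j : ℕ, ∀ (hi : i < n) (hj : j < n), bits (A i j) k = g.1 ⟨i, hi⟩ ⟨j, hj⟩ :=
    fun i j hi hj => hA ⟨i, hi⟩ ⟨j, hj⟩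
  obtain rfl | rfl | rfl | rfl : l = 1 ∨ l = 2 ∨ l = 3 ∨ l = 4 := by omega
  · rw [leadingMinor_eq hl, Matrix.det_fin_one, minorMask, hA' 0 0 (by omega) (by omega)]
    rfl
  · rw [leadingMinor_eq hl, Matrix.det_fin_two, CharTwo.sub_eq_add]
    simp only [minorMask, bits_xor, bits_and, Pi.add_apply, Pi.mul_apply,
      hA' 0 0 (by omega) (by omega), hA' 0 1 (by omega) (by omega), hA' 1 0 (by omega) (by omega),
      hA' 1 1 (by omega) (by omega)]
    rfl
  · rw [leadingMinor_eq hl, Matrix.det_fin_three]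
    simp only [CharTwo.sub_eq_add]
    simp only [minorMask, bits_xor, bits_and, Pi.add_apply, Pi.mul_apply,
      hA' 0 0 (by omega) (by omega), hA' 0 1 (by omega) (by omega), hA' 0 2 (by omega) (by omega),
      hA' 1 0 (by omega) (by omega), hA' 1 1 (by omega) (by omega), hA' 1 2 (by omega) (by omega),
      hA' 2 0 (by omega) (by omega), hA' 2 1 (by omega) (by omega), hA' 2 2 (by omega) (by omega)]
    have e0 : ∀ h, (⟨0, h⟩ : Fin n) = Fin.castLE hl 0 := fun _ => rfl
    have e1 : ∀ h, (⟨1, h⟩ : Fin n) = Fin.castLE hl 1 := fun _ => rfl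
    have e2 : ∀ h, (⟨2, h⟩ : Fin n) = Fin.castLE hl 2 := fun _ => rfl
    simp only [e0, e1, e2, Matrix.submatrix_apply]
    ring
  · obtain rfl : n = 4 := by omega
    rw [leadingMinor_self, minorMask, bits_bitMask, if_pos hk, if_pos rfl]
    all_goals simp

/-- The lower unitriangular matrix with binary code `k`. -/
def low (n k : ℕ) : GL2 n :=
  Matrix.GeneralLinearGroup.mkOfDetNeZero (natMatrix n (lowEntry k)) (by
    rw [Matrix.det_of_isLowerTriangular]
    · refine Finset.prod_ne_zero_iff.2 fun i _ => ?_
      change ((lowEntry k i i : ℕ) : ZMod 2) ≠ 0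
      simp [lowEntry]
    · intro i j hij
      have hij' : i.val < j.val := hij
      change ((lowEntry k i j : ℕ) : ZMod 2) = 0
      have h1 : (j.val == i.val) = false := by simpa using hij'.ne'
      have h2 : Nat.blt j i = false := by
        rw [Bool.eq_false_iff, ne_eq, Nat.blt_eq]; omega
      simp [lowEntry, h1, h2])

theorem low_val (n k : ℕ) : (low n k).1 = natMatrix n (lowEntry k) := rfl

theorem bits_gramRow {N k k' : ℕ} (hk : k' < N) (hn : n ≤ 4) {w : List ℕ}
    (hw : ∀ l ∈ w, 0 < l ∧ l ≤ n) {C : ℕ → ℕ → ℕ} {g : GL2 n} (hC : natMatrix n C = g.1)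
    (L : List ℕ) :
    bits (gramRow n N w C L k) k' =
      (L.map fun e => (w.map fun l =>
        leadingMinor l (transp (low n k') * (g ^ e * low n k)).1).prod).sum := by
  rw [gramRow]
  induction L with
  | nil => simp [bits_zero]
  | cons e L ih =>
    rw [List.foldr_cons, bits_xor, Pi.add_apply, ih, List.map_cons, List.sum_cons]
    congr 1
    have hA : ∀ i j : Fin n, bits (mulMask N n (natMul n (natPow n C e) (lowEntry k)) i j) k' =
        (transp (low n k') * (g ^ e * low n k)).1 i j := by
      intro i j
      rw [bits_mulMask hk, natMatrix_natMul, natMatrix_natPow, hC]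
      rfl
    clear ih
    induction w with
    | nil => simp [bits_bitMask, hk]
    | cons l w ih =>
      rw [List.foldr_cons, bits_and, Pi.mul_apply, ih fun l hl => hw l (List.mem_cons_of_mem _ hl),
        List.map_cons, List.prod_cons,
        bits_minorMask hk hn hA (hw l List.mem_cons_self).1 (hw l List.mem_cons_self).2]

theorem bits_gramRow_of_le {N k k' : ℕ} (hk : N ≤ k') (w : List ℕ) (C : ℕ → ℕ → ℕ)
    (L : List ℕ) : bits (gramRow n N w C L k) k' = 0 := by
  rw [gramRow]
  induction L with
  | nil => simp [bits_zero]
  | cons e L ih =>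
    rw [List.foldr_cons, bits_xor, Pi.add_apply, ih, add_zero]
    clear ih
    induction w with
    | nil => rw [List.foldr_nil, bits_bitMask, if_neg hk.not_gt]
    | cons l w ihw =>
      rw [List.foldr_cons, bits_and, Pi.mul_apply, ihw, mul_zero]

/-- Every lower unitriangular matrix has a code with `n (n - 1) / 2` binary digits. -/
theorem exists_low (hn : n = 2 ∨ n = 3 ∨ n = 4) {u : GL2 n} (hu : u ∈ lower n) :
    ∃ k < 2 ^ (n * (n - 1) / 2), low n k = u := by
  have hdiag : ∀ i, u.1 i i = 1 := fun i => by
    have := hu i i le_rfl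
    exact this.trans (Matrix.one_apply_eq i)
  have hup : ∀ i j, i < j → u.1 i j = 0 := fun i j hij => by
    have := hu j i hij.le
    exact this.trans (Matrix.one_apply_ne hij.ne')
  have hlow : ∀ k, (∀ i j : Fin n, j < i → ((lowEntry k i j : ℕ) : ZMod 2) = u.1 i j) →
      low n k = u := by
    intro k h
    apply Units.ext
    ext i j
    rw [low_val]
    change ((lowEntry k i j : ℕ) : ZMod 2) = u.1 i j
    rcases lt_trichotomy i j with hij | rfl | hij
    · have hij' : i.val < j.val := hij
      rw [hup i j hij]
      have h1 : (j.val == i.val) = false := by simpa using hij'.ne'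
      have h2 : Nat.blt j i = false := by
        rw [Bool.eq_false_iff, ne_eq, Nat.blt_eq]; omega
      simp [lowEntry, h1, h2]
    · rw [hdiag]; simp [lowEntry]
    · exact h i j hij
  have h2 : ∀ a : ZMod 2, ∃ k < 2, ((lowEntry k 1 0 : ℕ) : ZMod 2) = a := by decide
  have h3 : ∀ a b c : ZMod 2, ∃ k < 8, ((lowEntry k 1 0 : ℕ) : ZMod 2) = a ∧
      ((lowEntry k 2 0 : ℕ) : ZMod 2) = b ∧ ((lowEntry k 2 1 : ℕ) : ZMod 2) = c := by
    decide +kernel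
  have h4 : ∀ a b c d e f : ZMod 2, ∃ k < 64, [((lowEntry k 1 0 : ℕ) : ZMod 2),
      ((lowEntry k 2 0 : ℕ) : ZMod 2), ((lowEntry k 2 1 : ℕ) : ZMod 2),
      ((lowEntry k 3 0 : ℕ) : ZMod 2), ((lowEntry k 3 1 : ℕ) : ZMod 2),
      ((lowEntry k 3 2 : ℕ) : ZMod 2)] = [a, b, c, d, e, f] := by
    decide +kernel
  rcases hn with rfl | rfl | rfl
  · obtain ⟨k, hk, e⟩ := h2 (u.1 1 0)
    refine ⟨k, hk, hlow k fun i j hij => ?_⟩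
    fin_cases i <;> fin_cases j <;> first | exact absurd hij (by decide) | assumption
  · obtain ⟨k, hk, e1, e2, e3⟩ := h3 (u.1 1 0) (u.1 2 0) (u.1 2 1)
    refine ⟨k, hk, hlow k fun i j hij => ?_⟩
    fin_cases i <;> fin_cases j <;> first | exact absurd hij (by decide) | assumption
  · obtain ⟨k, hk, e⟩ :=
      h4 (u.1 1 0) (u.1 2 0) (u.1 2 1) (u.1 3 0) (u.1 3 1) (u.1 3 2)
    simp only [List.cons.injEq, and_true] at e
    obtain ⟨e1, e2, e3, e4, e5, e6⟩ := e
    refine ⟨k, hk, hlow k fun i j hij => ?_⟩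
    fin_cases i <;> fin_cases j <;> first | exact absurd hij (by decide) | assumption

/-- The rank of a sum of powers of `g` on `S_μ` is the rank of its matrix with respect to the
translates of the highest weight vector and of the linear form `simpleForm`. -/
theorem finrank_range_eq_gramRank {μ : YoungDiagram} (hn : μ.rowLen 0 = n)
    (hs : ∀ i k, i < k → 0 < μ.rowLen k → μ.rowLen k < μ.rowLen i)
    (hn' : n = 2 ∨ n = 3 ∨ n = 4) {w : List ℕ} (hw : w.Nodup) (hμ : parts μ = w.toFinset)
    {C : ℕ → ℕ → ℕ} {g : GL2 n} (hC : natMatrix n C = g.1) (L : List ℕ) :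
    Module.finrank (ZMod 2) (LinearMap.range (L.map fun e => simpleRep n μ g ^ e).sum) =
      gramRank n (2 ^ (n * (n - 1) / 2)) w C L := by
  set N := 2 ^ (n * (n - 1) / 2)
  set E : Module.End (ZMod 2) (LinearMap.range (symmetrizer n μ)) :=
    (L.map fun e => simpleRep n μ g ^ e).sum with hE
  let T : LinearMap.range (symmetrizer n μ) →ₗ[ZMod 2] ℕ → ZMod 2 :=
    LinearMap.pi fun k => if k < N then simpleForm hn ∘ₗ simpleRep n μ (transp (low n k)) else 0
  have hT : Function.Injective T := by
    rw [injective_iff_map_eq_zero]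
    intro y hy
    refine eq_zero_of_simpleForm hn hs fun u hu => ?_
    obtain ⟨k, hk, rfl⟩ := exists_low hn' hu
    have h := congrFun hy k
    change (if k < N then simpleForm hn ∘ₗ simpleRep n μ (transp (low n k)) else 0) y = 0 at h
    rwa [if_pos hk] at h
  have hw' : ∀ l ∈ w, 0 < l ∧ l ≤ n := by
    intro l hl
    have hl' : l ∈ parts μ := by rw [hμ]; exact List.mem_toFinset.2 hl
    obtain ⟨h0, i, rfl⟩ := mem_parts.1 hl'
    exact ⟨h0, hn ▸ μ.rowLen_anti 0 i (Nat.zero_le _)⟩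
  have hrow : ∀ k, T (E (simpleRep n μ (low n k) (simpleVector hn))) =
      bits (gramRow n N w C L k) := by
    intro k
    funext k'
    change (if k' < N then simpleForm hn ∘ₗ simpleRep n μ (transp (low n k')) else 0)
      (E (simpleRep n μ (low n k) (simpleVector hn))) = _
    split_ifs with hk'
    · rw [bits_gramRow hk' (by omega) hw' hC, hE]
      clear hE
      induction L with
      | nil => simp
      | cons e L ih =>
        rw [List.map_cons, List.sum_cons, LinearMap.add_apply, map_add, ih, List.map_cons,
          List.sum_cons]
        congr 1
        rw [← List.prod_toFinset _ hw, ← hμ, ← simpleForm_eq_prod hn hs, map_mul, map_mul, map_pow]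
        rfl
    · rw [bits_gramRow_of_le (by omega)]; rfl
  have hspan : LinearMap.range E = Submodule.span (ZMod 2)
      ((fun k => E (simpleRep n μ (low n k) (simpleVector hn))) '' {k | k < N}) := by
    apply le_antisymm
    · rintro _ ⟨y, rfl⟩
      have hy : y ∈ lowerSpan (simpleRep n μ) (simpleVector hn) := by
        rw [lowerSpan_simpleVector hn hs]; exact Submodule.mem_top
      refine (Submodule.span_le (p := Submodule.comap E (Submodule.span (ZMod 2)
        ((fun k => E (simpleRep n μ (low n k) (simpleVector hn))) '' {k | k < N})))).2 ?_ hy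
      rintro _ ⟨u, hu, rfl⟩
      obtain ⟨k, hk, rfl⟩ := exists_low hn' hu
      exact Submodule.subset_span ⟨k, hk, rfl⟩
    · refine Submodule.span_le.2 ?_
      rintro _ ⟨k, -, rfl⟩
      exact ⟨_, rfl⟩
  have himage : T '' ((fun k => E (simpleRep n μ (low n k) (simpleVector hn))) '' {k | k < N}) =
      {v | ∃ x ∈ (List.range N).map (gramRow n N w C L), bits x = v} := by
    ext v
    constructor
    · rintro ⟨_, ⟨k, hk, rfl⟩, rfl⟩
      exact ⟨_, List.mem_map_of_mem (List.mem_range.2 hk), (hrow k).symm⟩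
    · rintro ⟨x, hx, rfl⟩
      obtain ⟨k, hk, rfl⟩ := List.mem_map.1 hx
      exact ⟨_, ⟨k, List.mem_range.1 hk, rfl⟩, hrow k⟩
  rw [(Submodule.equivMapOfInjective T hT _).finrank_eq, hspan, Submodule.map_span, himage,
    gramRank, finrank_span_bits N _ (by simp)]

end

/-! ### Composition multiplicities and idempotents -/

section
variable {R : Type*} [Ring R]

/-- The number of elements of the additive group `e M`. -/
def cardSMul (e : R) (M : Type*) [AddCommGroup M] [Module R M] : ℕ :=
  Nat.card (DistribSMul.toAddMonoidHom M e).range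

theorem cardSMul_congr (e : R) {M N : Type*} [AddCommGroup M] [Module R M] [AddCommGroup N]
    [Module R N] (f : M ≃ₗ[R] N) : cardSMul e M = cardSMul e N := by
  refine Nat.card_congr (f.toEquiv.subtypeEquiv fun x => ?_)
  constructor
  · rintro ⟨y, rfl⟩
    exact ⟨f y, (f.map_smul e y).symm⟩
  · rintro ⟨y, hy⟩
    refine ⟨f.symm y, f.injective ?_⟩
    change e • y = f x at hy
    change f (e • f.symm y) = f x
    rw [f.map_smul, f.apply_symm_apply, hy]

/-- Taking images under compatible endomorphisms of an exact sequence is exact if the endomorphism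
in the middle is idempotent. -/
theorem natCard_range_eq_mul {A B C : Type*} [AddCommGroup A] [AddCommGroup B] [AddCommGroup C]
    {f : A →+ B} {g : B →+ C} (hf : Function.Injective f) (hg : Function.Surjective g)
    (hfg : ∀ y, g y = 0 ↔ ∃ x, f x = y) {a : A →+ A} {b : B →+ B} {c : C →+ C}
    (hb : ∀ y, b (b y) = b y) (hfa : ∀ x, f (a x) = b (f x)) (hgb : ∀ y, g (b y) = c (g y)) :
    Nat.card b.range = Nat.card a.range * Nat.card c.range := by
  let π : b.range →+ C := g.comp b.range.subtype
  have h := AddSubgroup.card_eq_card_quotient_mul_card_addSubgroup π.ker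
  have hrange : π.range = c.range := by
    ext z
    constructor
    · rintro ⟨⟨_, y, rfl⟩, rfl⟩
      exact ⟨g y, (hgb y).symm⟩
    · rintro ⟨z, rfl⟩
      obtain ⟨y, rfl⟩ := hg z
      exact ⟨⟨_, y, rfl⟩, hgb y⟩
  have hker : Nat.card a.range = Nat.card π.ker := by
    refine Nat.card_congr (Equiv.ofBijective (fun x : a.range => (⟨⟨f x.1, ?_⟩, ?_⟩ : π.ker)) ⟨?_, ?_⟩)
    · obtain ⟨_, x, rfl⟩ := x
      exact ⟨f x, (hfa x).symm⟩
    · exact (hfg _).2 ⟨x.1, rfl⟩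
    · intro x x' hx
      exact Subtype.ext (hf (congrArg (fun y : π.ker => y.1.1) hx))
    · rintro ⟨⟨_, y, rfl⟩, hy⟩
      obtain ⟨x, hx⟩ := (hfg _).1 hy
      refine ⟨⟨a x, x, rfl⟩, Subtype.ext (Subtype.ext ?_)⟩
      change f (a x) = b y
      rw [hfa, hx]
      exact hb y
  rw [h, ← hker, Nat.card_congr (QuotientAddGroup.quotientKerEquivRange π).toEquiv, hrange,
    mul_comm]

/-- For an idempotent `e`, the number of elements of `e M` is multiplicative in short exact
sequences. -/
theorem cardSMul_eq_mul {e : R} (he : e * e = e) {M : Type*} [AddCommGroup M] [Module R M]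
    (A : Submodule R M) : cardSMul e M = cardSMul e A * cardSMul e (M ⧸ A) :=
  natCard_range_eq_mul (f := A.subtype.toAddMonoidHom) (g := A.mkQ.toAddMonoidHom)
    A.injective_subtype A.mkQ_surjective
    (fun y => (Submodule.Quotient.mk_eq_zero A).trans
      ⟨fun h => ⟨⟨y, h⟩, rfl⟩, fun ⟨x, hx⟩ => hx ▸ x.2⟩)
    (fun y => by
      change e • e • y = e • y
      rw [smul_smul, he]) (fun _ => rfl) (fun _ => rfl)

theorem eq_prod_of_telescope {m : ℕ} (f : Fin (m + 1) → ℕ) (g : Fin m → ℕ) (h0 : f 0 = 1)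
    (h : ∀ i : Fin m, f i.succ = f i.castSucc * g i) : f (Fin.last m) = ∏ i, g i := by
  induction m with
  | zero => simpa using h0
  | succ m ih =>
    rw [Fin.prod_univ_castSucc, ← ih (fun i => f i.castSucc) (fun i => g i.castSucc) h0
      fun i => h i.castSucc]
    exact h (Fin.last m)

/-- If the simple modules `S j` represent all finite simple modules, then the multiplicities in
a finite module determine the cardinality of its image under an idempotent element. -/
theorem cardSMul_eq_pow {ι : Type*} [Fintype ι] {S : ι → Type} [∀ j, AddCommGroup (S j)]
    [∀ j, Module R (S j)]
    (hS : ∀ (T : Type) [AddCommGroup T] [Module R T] [Finite T] [IsSimpleModule R T],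
      ∃ j, Nonempty (T ≃ₗ[R] S j))
    (hinj : ∀ i j, Nonempty (S i ≃ₗ[R] S j) → i = j) {e : R} (he : e * e = e) {c : ι → ℕ}
    (hc : ∀ j, cardSMul e (S j) = 2 ^ c j) (M : Type) [AddCommGroup M] [Module R M] [Finite M] :
    cardSMul e M = 2 ^ ∑ j, c j * multiplicity R M (S j) := by
  classical
  have hex := exists_compositionSeries_of_isNoetherian_isArtinian R M
  obtain ⟨hbot, htop⟩ := hex.choose_spec
  have hm : ∀ j, multiplicity R M (S j) = (Finset.univ.filter fun i : Fin hex.choose.length =>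
      Nonempty ((hex.choose i.succ ⧸ (hex.choose i.castSucc).submoduleOf (hex.choose i.succ))
        ≃ₗ[R] S j)).card := fun j => by
    rw [multiplicity, dif_pos hex]
  set s := hex.choose
  have hsimple : ∀ i : Fin s.length, IsSimpleModule R
      (s i.succ ⧸ (s i.castSucc).submoduleOf (s i.succ)) := fun i =>
    (covBy_iff_quot_is_simple (s.strictMono i.castSucc_lt_succ).le).1 (s.step i)
  have hfin : ∀ i : Fin s.length, Finite
      (s i.succ ⧸ (s i.castSucc).submoduleOf (s i.succ)) := fun i =>
    Finite.of_surjective _ (Submodule.mkQ_surjective _)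
  choose J hJ using fun i : Fin s.length =>
    hS (s i.succ ⧸ (s i.castSucc).submoduleOf (s i.succ))
  have hprod := eq_prod_of_telescope (fun i => cardSMul e (s i))
    (fun i => cardSMul e (s i.succ ⧸ (s i.castSucc).submoduleOf (s i.succ))) ?_ ?_
  · have h1 : cardSMul e (s (Fin.last _)) = cardSMul e M := by
      have : s (Fin.last _) = ⊤ := htop
      rw [this]
      exact cardSMul_congr e Submodule.topEquiv
    have h2 : ∀ i, cardSMul e (s i.succ ⧸ (s i.castSucc).submoduleOf (s i.succ)) =
        2 ^ c (J i) := fun i => by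
      rw [cardSMul_congr e (hJ i).some, hc]
    have h3 : ∀ i j, Nonempty ((s i.succ ⧸ (s i.castSucc).submoduleOf (s i.succ)) ≃ₗ[R] S j) ↔
        J i = j := fun i j =>
      ⟨fun h => hinj _ _ ⟨(hJ i).some.symm.trans h.some⟩, fun h => h ▸ hJ i⟩
    rw [← h1, hprod, Finset.prod_congr rfl fun i _ => h2 i, Finset.prod_pow_eq_pow_sum]
    congr 1
    simp only [hm, h3, Finset.card_filter, Finset.mul_sum]
    rw [Finset.sum_comm]
    simp
  · have : s 0 = ⊥ := hbot
    change cardSMul e (s 0) = 1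
    rw [this]
    exact Nat.card_of_subsingleton (0 : AddMonoidHom.range _)
  · intro i
    rw [cardSMul_eq_mul he ((s i.castSucc).submoduleOf (s i.succ))]
    congr 1
    exact cardSMul_congr e (Submodule.submoduleOfEquivOfLe
      (s.strictMono i.castSucc_lt_succ).le)

end

section
variable {G : Type} [Group G]

/-- Linearity over the group algebra of `𝔽₂` can be checked on group elements. -/
theorem map_smul_of_map_of_smul {M N : Type*} [AddCommGroup M] [Module (ZMod 2)[G] M]
    [AddCommGroup N] [Module (ZMod 2)[G] N] (f : M →+ N)
    (hf : ∀ (g : G) x, f (MonoidAlgebra.of (ZMod 2) G g • x) = MonoidAlgebra.of (ZMod 2) G g • f x)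
    (r : (ZMod 2)[G]) (x : M) : f (r • x) = r • f x := by
  induction r using MonoidAlgebra.induction_on with
  | of g => exact hf g x
  | add a b ha hb => rw [add_smul, map_add, ha, hb, add_smul]
  | smul t a ha =>
    rcases zmod2_cases t with rfl | rfl
    · simp
    · rwa [one_smul]

theorem of_smul_asModule {V : Type*} [AddCommGroup V] [Module (ZMod 2) V]
    (ρ : Representation (ZMod 2) G V) (g : G) (x : ρ.asModule) :
    MonoidAlgebra.of (ZMod 2) G g • x = (ρ g (x : V) : V) :=
  (ρ.asModuleEquiv_symm_map_rho g x).symm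

theorem finite_asModule {V : Type*} [AddCommGroup V] [Module (ZMod 2) V] [Finite V]
    (ρ : Representation (ZMod 2) G V) : Finite ρ.asModule := ‹Finite V›

/-- The representation on a module over the group algebra. -/
theorem exists_representation (T : Type) [AddCommGroup T] [Module (ZMod 2)[G] T] :
    ∃ (_ : Module (ZMod 2) T) (ρ : Representation (ZMod 2) G T),
      ∀ g x, ρ g x = MonoidAlgebra.of (ZMod 2) G g • x := by
  let _ : Module (ZMod 2) T := Module.compHom T (algebraMap (ZMod 2) (ZMod 2)[G])
  have : IsScalarTower (ZMod 2) (ZMod 2)[G] T := IsScalarTower.of_algebraMap_smul fun _ _ => rfl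
  exact ⟨inferInstance, Representation.ofModule' T, fun g x => rfl⟩

end

section
variable {n : ℕ}

/-- A finite simple module is one of given modules without proper submodules, if these have weight
vectors of all weights. -/
theorem exists_iso_of_isSimpleModule (hn : n ≤ 4) {ι : Type*} {S : ι → Type}
    [∀ j, AddCommGroup (S j)] [∀ j, Module (ZMod 2) (S j)] [∀ j, Finite (S j)]
    (ρ : ∀ j, Representation (ZMod 2) (GL2 n) (S j)) (hρ : ∀ j, HasNoProperSub (ρ j))
    (hwt : ∀ J : Finset ℕ, ∃ j, ∃ v : S j, v ≠ 0 ∧ IsWeightVector (ρ j) J v)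
    (T : Type) [AddCommGroup T] [Module (ZMod 2)[GL2 n] T] [Finite T]
    [IsSimpleModule (ZMod 2)[GL2 n] T] :
    ∃ j, Nonempty (T ≃ₗ[(ZMod 2)[GL2 n]] (ρ j).asModule) := by
  obtain ⟨_, τ, hτ⟩ := exists_representation T (G := GL2 n)
  have : Nontrivial T := IsSimpleModule.nontrivial (ZMod 2)[GL2 n] T
  have hsub : HasNoProperSub τ := by
    intro Y hY
    let Y' : Submodule (ZMod 2)[GL2 n] T :=
      { Y.toAddSubmonoid with
        smul_mem' := fun r y hy => by
          change r • y ∈ Y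
          induction r using MonoidAlgebra.induction_on with
          | of g => rw [← hτ]; exact hY g y hy
          | add a b ha hb => rw [add_smul]; exact add_mem ha hb
          | smul t a ha =>
            rcases zmod2_cases t with rfl | rfl
            · rw [zero_smul, zero_smul]; exact zero_mem _
            · rwa [one_smul] }
    rcases eq_bot_or_eq_top Y' with h | h
    · left
      ext x
      exact SetLike.ext_iff.1 h x
    · right
      ext x
      exact SetLike.ext_iff.1 h x
  obtain ⟨v, hv, J, hJ⟩ := exists_isWeightVector τ hn
  obtain ⟨j, w, hw, hwJ⟩ := hwt J
  obtain ⟨e, he⟩ := exists_equiv_of_isWeightVector hsub (hρ j) hv hw hJ hwJ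
  have hlin := map_smul_of_map_of_smul (M := T) (N := (ρ j).asModule)
    (e.toLinearMap.toAddMonoidHom) fun g x => by
      rw [of_smul_asModule, ← hτ]
      exact he g x
  exact ⟨j, ⟨{ e.toAddEquiv with map_smul' := hlin }⟩⟩

theorem powerSum_smul_asModule {V : Type*} [AddCommGroup V] [Module (ZMod 2) V]
    (ρ : Representation (ZMod 2) (GL2 n) V) (g : GL2 n) (L : List ℕ) (x : ρ.asModule) :
    (L.map fun e => MonoidAlgebra.of (ZMod 2) (GL2 n) (g ^ e)).sum • x =
      ((L.map fun e => ρ g ^ e).sum (x : V) : V) := by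
  induction L with
  | nil => exact zero_smul _ _
  | cons e L ih =>
    rw [List.map_cons, List.sum_cons, add_smul, ih, of_smul_asModule, map_pow]
    rfl

/-- On a representation, the number of elements of the image is given by a rank. -/
theorem cardSMul_asModule {V : Type} [AddCommGroup V] [Module (ZMod 2) V] [Finite V]
    (ρ : Representation (ZMod 2) (GL2 n) V) (g : GL2 n) (L : List ℕ) :
    cardSMul (L.map fun e => MonoidAlgebra.of (ZMod 2) (GL2 n) (g ^ e)).sum ρ.asModule =
      2 ^ Module.finrank (ZMod 2) (LinearMap.range (L.map fun e => ρ g ^ e).sum) := by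
  have hV : Module.Finite (ZMod 2) V := Module.Finite.of_finite
  have hcard := Module.natCard_eq_pow_finrank (K := ZMod 2)
    (V := LinearMap.range (L.map fun e => ρ g ^ e).sum)
  rw [Nat.card_zmod] at hcard
  rw [← hcard]
  refine Nat.card_congr (Equiv.subtypeEquivRight fun x => ?_)
  constructor
  · rintro ⟨y, rfl⟩
    exact ⟨y, (powerSum_smul_asModule ρ g L y).symm⟩
  · rintro ⟨y, rfl⟩
    exact ⟨y, powerSum_smul_asModule ρ g L y⟩

end

/-! ### The simple modules of partitions given by lists of parts -/

theorem rowLen_ofRowLens_of_length_le {w : List ℕ} (hw : w.SortedGE) {i : ℕ} (h : w.length ≤ i) :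
    (YoungDiagram.ofRowLens w hw).rowLen i = 0 := by
  by_contra h0
  obtain ⟨hi, -⟩ := YoungDiagram.mem_ofRowLens.1
    (YoungDiagram.mem_iff_lt_rowLen.2 (Nat.pos_of_ne_zero h0))
  exact absurd hi h.not_gt

theorem rowLen_ofRowLens_lt {w : List ℕ} (hw : w.SortedGT) (i k : ℕ) (hik : i < k)
    (h : 0 < (YoungDiagram.ofRowLens w hw.sortedGE).rowLen k) :
    (YoungDiagram.ofRowLens w hw.sortedGE).rowLen k <
      (YoungDiagram.ofRowLens w hw.sortedGE).rowLen i := by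
  have hk : k < w.length := by
    by_contra hk
    rw [rowLen_ofRowLens_of_length_le hw.sortedGE (not_lt.1 hk)] at h
    exact lt_irrefl _ h
  have h1 := YoungDiagram.rowLen_ofRowLens (hw := hw.sortedGE) ⟨k, hk⟩
  have h2 := YoungDiagram.rowLen_ofRowLens (hw := hw.sortedGE) ⟨i, hik.trans hk⟩
  simp only at h1 h2
  rw [h1, h2]
  exact hw.getElem_gt_getElem_of_lt hik

theorem parts_ofRowLens {w : List ℕ} (hw : w.SortedGE) (hpos : ∀ x ∈ w, 0 < x) :
    parts (YoungDiagram.ofRowLens w hw) = w.toFinset := by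
  ext q
  rw [mem_parts, List.mem_toFinset]
  constructor
  · rintro ⟨h0, i, rfl⟩
    have hi : i < w.length := by
      by_contra hi
      rw [rowLen_ofRowLens_of_length_le hw (not_lt.1 hi)] at h0
      exact lt_irrefl _ h0
    exact (YoungDiagram.rowLen_ofRowLens (hw := hw) ⟨i, hi⟩).symm ▸ List.getElem_mem hi
  · intro hq
    obtain ⟨i, hi, rfl⟩ := List.mem_iff_getElem.1 hq
    exact ⟨hpos _ hq, i, YoungDiagram.rowLen_ofRowLens ⟨i, hi⟩⟩

theorem rowLen_zero_ofRowLens {w : List ℕ} (hw : w.SortedGE) {n : ℕ} (h : w.head? = some n) :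
    (YoungDiagram.ofRowLens w hw).rowLen 0 = n := by
  cases w with
  | nil => simp at h
  | cons a w =>
    have := YoungDiagram.rowLen_ofRowLens (hw := hw) ⟨0, by simp⟩
    simp only [List.head?_cons, Option.some.injEq] at h
    rw [← h]
    exact this

section
variable {n : ℕ} {μ ν : YoungDiagram}

/-- Only the elements `q` of the type with `0 < q < n` matter. -/
theorem IsWeightVector.congr {T : Type*} [AddCommGroup T] [Module (ZMod 2) T]
    {ρ : Representation (ZMod 2) (GL2 n) T} {J K : Finset ℕ} {v : T} (h : IsWeightVector ρ J v)
    (hJK : ∀ q, 0 < q → q < n → (q ∈ J ↔ q ∈ K)) : IsWeightVector ρ K v :=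
  ⟨h.mem, fun p q hpq => by
    rw [h.hecke_eq p q hpq]
    exact if_congr (hJK q (by omega) q.2) rfl rfl⟩

/-- The simple modules of two partitions with the same first part `n` and different sets of other
parts are not isomorphic. -/
theorem mem_parts_iff_of_iso (hμ : μ.rowLen 0 = n) (hν : ν.rowLen 0 = n)
    (hsμ : ∀ i k, i < k → 0 < μ.rowLen k → μ.rowLen k < μ.rowLen i)
    (hsν : ∀ i k, i < k → 0 < ν.rowLen k → ν.rowLen k < ν.rowLen i)
    (f : (simpleRep n μ).asModule ≃ₗ[(ZMod 2)[GL2 n]] (simpleRep n ν).asModule) {q : ℕ}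
    (h0 : 0 < q) (hq : q < n) : q ∈ parts μ ↔ q ∈ parts ν := by
  let f' : LinearMap.range (symmetrizer n μ) → LinearMap.range (symmetrizer n ν) := f
  have hf : ∀ g x, f' (simpleRep n μ g x) = simpleRep n ν g (f' x) := by
    intro g (x : (simpleRep n μ).asModule)
    exact (congrArg f (of_smul_asModule _ g x)).symm.trans
      ((f.map_smul _ x).trans (of_smul_asModule _ g (f x)))
  have hwμ := simpleVector_isWeightVector hμ hsμ
  have hwν := simpleVector_isWeightVector hν hsν
  have hv : f' (simpleVector hμ) = simpleVector hν := by
    refine eq_simpleVector hν hsν (fun u hu => ?_) fun h => ?_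
    · rw [← hf, hwμ.mem u hu]
    · exact simpleVector_ne_zero hμ hsμ (f.map_eq_zero_iff.1 h)
  let p : Fin n := ⟨q - 1, by omega⟩
  have hpq : p.val + 1 = (⟨q, hq⟩ : Fin n).val := by
    change q - 1 + 1 = q; omega
  have h1 := hwμ.hecke_eq p ⟨q, hq⟩ hpq
  have h2 := hwν.hecke_eq p ⟨q, hq⟩ hpq
  have h3 : f' (hecke (simpleRep n μ) hpq (simpleVector hμ)) =
      hecke (simpleRep n ν) hpq (simpleVector hν) := by
    rw [hecke_apply, hecke_apply, ← hv, ← hf, ← hf]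
    exact f.map_add _ _
  rw [h1, h2] at h3
  have hne := simpleVector_ne_zero hν hsν
  by_cases ha : q ∈ parts μ <;> by_cases hb : q ∈ parts ν
  · exact iff_of_true ha hb
  · rw [if_pos ha, if_neg hb, hv] at h3
    exact absurd h3 hne
  · rw [if_neg ha, if_pos hb] at h3
    have h4 : f' 0 = 0 := f.map_zero
    exact absurd (h3.symm.trans h4) hne
  · exact iff_of_false ha hb

/-- The simple representations of partitions with first part `n` and with all possible sets of
other parts, for `n ≤ 4`, exhaust the finite simple modules. -/
theorem exists_iso_simpleRep (hn : n ≤ 4) {r : ℕ} (ν : Fin r → YoungDiagram)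
    (h0 : ∀ j, (ν j).rowLen 0 = n)
    (hs : ∀ j i k, i < k → 0 < (ν j).rowLen k → (ν j).rowLen k < (ν j).rowLen i)
    (hcov : ∀ J : Finset ℕ, ∃ j, ∀ q, 0 < q → q < n → (q ∈ parts (ν j) ↔ q ∈ J))
    (T : Type) [AddCommGroup T] [Module (ZMod 2)[GL2 n] T] [Finite T]
    [IsSimpleModule (ZMod 2)[GL2 n] T] :
    ∃ j, Nonempty (T ≃ₗ[(ZMod 2)[GL2 n]] (simpleRep n (ν j)).asModule) :=
  @exists_iso_of_isSimpleModule n hn (Fin r) (fun j => LinearMap.range (symmetrizer n (ν j)))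
    (fun _ => inferInstance) (fun _ => inferInstance) (fun _ => finite_simpleRep)
    (fun j => simpleRep n (ν j)) (fun j => hasNoProperSub_simpleRep (h0 j) (hs j))
    (fun J => by
      obtain ⟨j, hj⟩ := hcov J
      exact ⟨j, simpleVector (h0 j), simpleVector_ne_zero (h0 j) (hs j),
        (simpleVector_isWeightVector (h0 j) (hs j)).congr hj⟩) T _ _ _ _

/-- The number of elements of `e M` for partitions `ν j` that represent every set of parts less than
`n` exactly once. -/
theorem cardSMul_eq_pow_sum (hn : n = 2 ∨ n = 3 ∨ n = 4) {r : ℕ} (ν : Fin r → YoungDiagram)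
    (h0 : ∀ j, (ν j).rowLen 0 = n)
    (hs : ∀ j i k, i < k → 0 < (ν j).rowLen k → (ν j).rowLen k < (ν j).rowLen i)
    (hcov : ∀ J : Finset ℕ, ∃ j, ∀ q, 0 < q → q < n → (q ∈ parts (ν j) ↔ q ∈ J))
    (hinj : ∀ i j, (∀ q, 0 < q → q < n → (q ∈ parts (ν i) ↔ q ∈ parts (ν j))) → i = j)
    {e : (ZMod 2)[GL2 n]} (he : e * e = e) {c : Fin r → ℕ}
    (hc : ∀ j, cardSMul e (simpleRep n (ν j)).asModule = 2 ^ c j)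
    (M : Type) [AddCommGroup M] [Module (ZMod 2)[GL2 n] M] [Finite M] :
    cardSMul e M = 2 ^ ∑ j, c j * multiplicity (ZMod 2)[GL2 n] M (simpleRep n (ν j)).asModule :=
  @cardSMul_eq_pow _ _ (Fin r) _ (fun j => (simpleRep n (ν j)).asModule)
    (fun _ => inferInstance) (fun _ => inferInstance)
    (fun T _ _ _ _ => exists_iso_simpleRep (by omega) ν h0 hs hcov T)
    (fun i j ⟨f⟩ => hinj i j fun _ hq0 hqn =>
      mem_parts_iff_of_iso (h0 i) (h0 j) (hs i) (hs j) f hq0 hqn) _ he _ hc M _ _ _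

/-- The number of elements of `e M`, for an idempotent sum `e` of powers of `g`, in terms of the
composition multiplicities of `M`. -/
theorem cardSMul_eq_pow_sum_gramRank (hn : n = 2 ∨ n = 3 ∨ n = 4) {r : ℕ} (ws : Fin r → List ℕ)
    (hgt : ∀ j, (ws j).SortedGT) (hpos : ∀ j, ∀ x ∈ ws j, 0 < x)
    (hhead : ∀ j, (ws j).head? = some n)
    (hcov : ∀ J : Finset ℕ, ∃ j, ∀ q, 0 < q → q < n → (q ∈ ws j ↔ q ∈ J))
    (hinj : ∀ i j, (∀ q, 0 < q → q < n → (q ∈ ws i ↔ q ∈ ws j)) → i = j)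
    {C : ℕ → ℕ → ℕ} {g : GL2 n} (hC : natMatrix n C = g.1) {L : List ℕ}
    (he : IsIdempotentElem (L.map fun e => MonoidAlgebra.of (ZMod 2) (GL2 n) (g ^ e)).sum)
    (M : Type) [AddCommGroup M] [Module (ZMod 2)[GL2 n] M] [Finite M] :
    cardSMul (L.map fun e => MonoidAlgebra.of (ZMod 2) (GL2 n) (g ^ e)).sum M =
      2 ^ ∑ j, gramRank n (2 ^ (n * (n - 1) / 2)) (ws j) C L * multiplicity (ZMod 2)[GL2 n] M
        (simpleRep n (YoungDiagram.ofRowLens (ws j) (hgt j).sortedGE)).asModule := by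
  have h0 := fun j => rowLen_zero_ofRowLens (hgt j).sortedGE (hhead j)
  have hs := fun j => rowLen_ofRowLens_lt (hgt j)
  have hp := fun j => parts_ofRowLens (hgt j).sortedGE (hpos j)
  refine cardSMul_eq_pow_sum hn
    (fun j => YoungDiagram.ofRowLens (ws j) (hgt j).sortedGE) h0 hs ?_ ?_ he ?_ M
  · simpa only [hp, List.mem_toFinset] using hcov
  · simpa only [hp, List.mem_toFinset] using hinj
  · intro j
    rw [cardSMul_asModule, finrank_range_eq_gramRank (h0 j) (hs j) hn (hgt j).nodup (hp j) hC]

end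

section
variable {n : ℕ}

theorem isIdempotentElem_one_sum (g : GL2 n) : IsIdempotentElem
    (([0] : List ℕ).map fun e => MonoidAlgebra.of (ZMod 2) (GL2 n) (g ^ e)).sum := by
  simp [IsIdempotentElem]

/-- `1 + g + g²` is idempotent in characteristic `2` if `g³ = 1`. -/
theorem isIdempotentElem_sum {g : GL2 n} (hg : g ^ 3 = 1) : IsIdempotentElem
    (([0, 1, 2] : List ℕ).map fun e => MonoidAlgebra.of (ZMod 2) (GL2 n) (g ^ e)).sum := by
  set x := MonoidAlgebra.of (ZMod 2) (GL2 n) g with hx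
  have h3 : x ^ 3 = 1 := by rw [hx, ← map_pow, hg, map_one]
  have h : (([0, 1, 2] : List ℕ).map fun e => MonoidAlgebra.of (ZMod 2) (GL2 n) (g ^ e)).sum =
      1 + x + x ^ 2 := by
    simp [hx, add_assoc, MonoidAlgebra.one_def]
  rw [h, IsIdempotentElem]
  have h1 : x * (1 + x + x ^ 2) = 1 + x + x ^ 2 := by
    have : x * (1 + x + x ^ 2) = x + x ^ 2 + x ^ 3 := by noncomm_ring
    rw [this, h3]; abel
  have h2 : (1 + x + x ^ 2) * (1 + x + x ^ 2) =
      (1 + x + x ^ 2) + x * (1 + x + x ^ 2) + x * (x * (1 + x + x ^ 2)) := by noncomm_ring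
  rw [h2, h1, h1]
  have h4 : (1 + x + x ^ 2) + (1 + x + x ^ 2) = 0 := by
    rw [← two_nsmul, ← Nat.cast_smul_eq_nsmul (ZMod 2)]
    exact zero_smul _ _
  rw [h4, zero_add]

end

/-! ### Relations between composition multiplicities -/

/-- The sum of the powers of `g` with exponents in `L`. -/
abbrev powerSum {n : ℕ} (g : GL2 n) (L : List ℕ) : (ZMod 2)[GL2 n] :=
  (L.map fun e => MonoidAlgebra.of (ZMod 2) (GL2 n) (g ^ e)).sum

/-- The multiplicity of the simple representation of `GL_n(𝔽₂)` of the partition with parts `w`. -/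
def mult (n : ℕ) (w : List ℕ) (hw : w.SortedGT) (M : Type) [AddCommGroup M]
    [Module (ZMod 2)[GL2 n] M] : ℕ :=
  multiplicity (ZMod 2)[GL2 n] M (simpleRep n (YoungDiagram.ofRowLens w hw.sortedGE)).asModule

/-- The strictly decreasing partitions with first part `2`. -/
def regular2 : Fin 2 → List ℕ := ![[2], [2, 1]]

/-- The strictly decreasing partitions with first part `3`. -/
def regular3 : Fin 4 → List ℕ := ![[3], [3, 1], [3, 2], [3, 2, 1]]

/-- The strictly decreasing partitions with first part `4`. -/
def regular4 : Fin 8 → List ℕ :=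
  ![[4], [4, 1], [4, 2], [4, 3], [4, 2, 1], [4, 3, 1], [4, 3, 2], [4, 3, 2, 1]]

theorem regular2_sortedGT : ∀ j, (regular2 j).SortedGT := by decide

theorem regular3_sortedGT : ∀ j, (regular3 j).SortedGT := by decide

theorem regular4_sortedGT : ∀ j, (regular4 j).SortedGT := by decide

/-- The matrix of the cyclic permutation `0 ↦ 1 ↦ 2 ↦ 0`. -/
def natCyc (i j : ℕ) : ℕ := bif i == (bif Nat.blt j 3 then (j + 1) % 3 else j) then 1 else 0

/-- The `2 × 2` matrix with columns `e_1` and `e_0 + e_1`, which has order `3` modulo `2`. -/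
def natFib (i j : ℕ) : ℕ := bif i + j == 0 then 0 else 1

/-- With `d = dim M` and `a = dim (1 + g + g²) M`, the number `d - a` is `0` on the trivial module
`S_(2)` and `2` on `S_(2,1)`. -/
theorem multiplicity_relation_two {g : GL2 2} (hg : g ^ 3 = 1) (hC : natMatrix 2 natFib = g.1)
    (M : Type) [AddCommGroup M] [Module (ZMod 2)[GL2 2] M] [Finite M] {d a : ℕ}
    (hd : cardSMul (powerSum g [0]) M = 2 ^ d) (ha : cardSMul (powerSum g [0, 1, 2]) M = 2 ^ a) :
    (d : ℤ) - a = 2 * mult 2 (regular2 1) (regular2_sortedGT 1) M := by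
  have key := fun {L : List ℕ} (he : IsIdempotentElem (powerSum g L)) =>
    cardSMul_eq_pow_sum_gramRank (Or.inl rfl) regular2 regular2_sortedGT (by decide) (by decide)
      (fun J => by
        have h : ∀ a : Bool, ∃ j, decide (1 ∈ regular2 j) = a := by decide
        obtain ⟨j, h1⟩ := h (decide (1 ∈ J))
        refine ⟨j, fun q hq0 hqn => ?_⟩
        obtain rfl : q = 1 := by omega
        exact decide_eq_decide.1 h1)
      (by
        have h : ∀ i j, (1 ∈ regular2 i ↔ 1 ∈ regular2 j) → i = j := by decide
        exact fun i j hij => h i j (hij 1 (by omega) (by omega))) hC he M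
  have hd' := Nat.pow_right_injective le_rfl (hd.symm.trans (key (isIdempotentElem_one_sum g)))
  have ha' := Nat.pow_right_injective le_rfl (ha.symm.trans (key (isIdempotentElem_sum hg)))
  have rd : ∀ j, gramRank 2 (2 ^ (2 * (2 - 1) / 2)) (regular2 j) natFib [0] = ![1, 2] j := by
    decide +kernel
  have ra : ∀ j, gramRank 2 (2 ^ (2 * (2 - 1) / 2)) (regular2 j) natFib [0, 1, 2] = ![1, 0] j := by
    decide +kernel
  simp only [rd] at hd'
  simp only [ra] at ha'
  rw [Fin.sum_univ_two] at hd' ha'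
  simp only [Matrix.cons_val] at hd' ha'
  rw [hd', ha', mult]
  push_cast
  ring

/-- With `d = dim M` and `a = dim (1 + g + g²) M`, the number `3 a - d` is `2`, `0`, `0`, `-2` on
the simple modules, which have `d = 1, 3, 3, 8` and `a = 1, 1, 1, 2`. -/
theorem multiplicity_relation_three {g : GL2 3} (hg : g ^ 3 = 1) (hC : natMatrix 3 natCyc = g.1)
    (M : Type) [AddCommGroup M] [Module (ZMod 2)[GL2 3] M] [Finite M] {d a : ℕ}
    (hd : cardSMul (powerSum g [0]) M = 2 ^ d) (ha : cardSMul (powerSum g [0, 1, 2]) M = 2 ^ a) :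
    3 * (a : ℤ) - d = 2 * (mult 3 (regular3 0) (regular3_sortedGT 0) M -
      mult 3 (regular3 3) (regular3_sortedGT 3) M) := by
  have key := fun {L : List ℕ} (he : IsIdempotentElem (powerSum g L)) =>
    cardSMul_eq_pow_sum_gramRank (Or.inr (Or.inl rfl)) regular3 regular3_sortedGT (by decide)
      (by decide)
      (fun J => by
        have h : ∀ a b : Bool, ∃ j, decide (1 ∈ regular3 j) = a ∧ decide (2 ∈ regular3 j) = b := by
          decide
        obtain ⟨j, h1, h2⟩ := h (decide (1 ∈ J)) (decide (2 ∈ J))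
        refine ⟨j, fun q hq0 hqn => ?_⟩
        obtain rfl | rfl : q = 1 ∨ q = 2 := by omega
        · exact decide_eq_decide.1 h1
        · exact decide_eq_decide.1 h2)
      (by
        have h : ∀ i j, (1 ∈ regular3 i ↔ 1 ∈ regular3 j) → (2 ∈ regular3 i ↔ 2 ∈ regular3 j) →
          i = j := by decide
        exact fun i j hij => h i j (hij 1 (by omega) (by omega)) (hij 2 (by omega) (by omega)))
      hC he M
  have hd' := Nat.pow_right_injective le_rfl (hd.symm.trans (key (isIdempotentElem_one_sum g)))
  have ha' := Nat.pow_right_injective le_rfl (ha.symm.trans (key (isIdempotentElem_sum hg)))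
  have rd : ∀ j, gramRank 3 (2 ^ (3 * (3 - 1) / 2)) (regular3 j) natCyc [0] =
      ![1, 3, 3, 8] j := by
    decide +kernel
  have ra : ∀ j, gramRank 3 (2 ^ (3 * (3 - 1) / 2)) (regular3 j) natCyc [0, 1, 2] =
      ![1, 1, 1, 2] j := by
    decide +kernel
  simp only [rd] at hd'
  simp only [ra] at ha'
  rw [Fin.sum_univ_four] at hd' ha'
  simp only [Matrix.cons_val] at hd' ha'
  rw [hd', ha', mult, mult]
  push_cast
  ring

/-- With `d = dim M` and `a = dim (1 + g + g²) M`, the number `3 a - d` is `2`, `2`, `0`, `2`, `-2`,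
`-2`, `-2`, `-4` on the simple modules, by the values of `d` and `a` computed below. -/
theorem multiplicity_relation_four {g : GL2 4} (hg : g ^ 3 = 1) (hC : natMatrix 4 natCyc = g.1)
    (M : Type) [AddCommGroup M] [Module (ZMod 2)[GL2 4] M] [Finite M] {d a : ℕ}
    (hd : cardSMul (powerSum g [0]) M = 2 ^ d) (ha : cardSMul (powerSum g [0, 1, 2]) M = 2 ^ a) :
    3 * (a : ℤ) - d = 2 * (mult 4 (regular4 0) (regular4_sortedGT 0) M +
      mult 4 (regular4 1) (regular4_sortedGT 1) M + mult 4 (regular4 3) (regular4_sortedGT 3) M -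
      mult 4 (regular4 4) (regular4_sortedGT 4) M - mult 4 (regular4 5) (regular4_sortedGT 5) M -
      mult 4 (regular4 6) (regular4_sortedGT 6) M -
      2 * mult 4 (regular4 7) (regular4_sortedGT 7) M) := by
  have key := fun {L : List ℕ} (he : IsIdempotentElem (powerSum g L)) =>
    cardSMul_eq_pow_sum_gramRank (Or.inr (Or.inr rfl)) regular4 regular4_sortedGT (by decide)
      (by decide)
      (fun J => by
        have h : ∀ a b c : Bool, ∃ j, decide (1 ∈ regular4 j) = a ∧ decide (2 ∈ regular4 j) = b ∧
          decide (3 ∈ regular4 j) = c := by decide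
        obtain ⟨j, h1, h2, h3⟩ := h (decide (1 ∈ J)) (decide (2 ∈ J)) (decide (3 ∈ J))
        refine ⟨j, fun q hq0 hqn => ?_⟩
        obtain rfl | rfl | rfl : q = 1 ∨ q = 2 ∨ q = 3 := by omega
        · exact decide_eq_decide.1 h1
        · exact decide_eq_decide.1 h2
        · exact decide_eq_decide.1 h3)
      (by
        have h : ∀ i j, (1 ∈ regular4 i ↔ 1 ∈ regular4 j) → (2 ∈ regular4 i ↔ 2 ∈ regular4 j) →
          (3 ∈ regular4 i ↔ 3 ∈ regular4 j) → i = j := by decide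
        exact fun i j hij => h i j (hij 1 (by omega) (by omega)) (hij 2 (by omega) (by omega))
          (hij 3 (by omega) (by omega)))
      hC he M
  have hd' := Nat.pow_right_injective le_rfl (hd.symm.trans (key (isIdempotentElem_one_sum g)))
  have ha' := Nat.pow_right_injective le_rfl (ha.symm.trans (key (isIdempotentElem_sum hg)))
  have rd : ∀ j, gramRank 4 (2 ^ (4 * (4 - 1) / 2)) (regular4 j) natCyc [0] =
      ![1, 4, 6, 4, 20, 14, 20, 64] j := by
    decide +kernel
  have ra : ∀ j, gramRank 4 (2 ^ (4 * (4 - 1) / 2)) (regular4 j) natCyc [0, 1, 2] =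
      ![1, 2, 2, 2, 6, 4, 6, 20] j := by
    decide +kernel
  simp only [rd] at hd'
  simp only [ra] at ha'
  rw [Fin.sum_univ_eight] at hd' ha'
  simp only [Matrix.cons_val] at hd' ha'
  rw [hd', ha']
  simp only [mult]
  push_cast
  ring

/-! ### Symmetric powers as permutation modules -/

/-- For a permutation with cube `1`, Burnside's lemma counts the functions to `𝔽₂` that are constant
on the orbits. -/
theorem exists_card_invariant {ι : Type*} [Finite ι] {π : Equiv.Perm ι} (hπ : π ^ 3 = 1) :
    ∃ q, 3 * q = Nat.card ι + 2 * Nat.card {i // π i = i} ∧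
      Nat.card {c : ι → ZMod 2 // ∀ i, c (π i) = c i} = 2 ^ q := by
  classical
  have := Fintype.ofFinite ι
  let act : AddAction (ZMod 3) ι :=
    { vadd := fun g i => (π ^ g.val) i
      zero_vadd := fun i => by change (π ^ (0 : ZMod 3).val) i = i; simp
      add_vadd := fun g h i => by
        change (π ^ (g + h).val) i = (π ^ g.val) ((π ^ h.val) i)
        rw [← Equiv.Perm.mul_apply, ← pow_add, ZMod.val_add, ← pow_eq_pow_mod _ hπ] }
  have hvadd : ∀ (g : ZMod 3) i, g +ᵥ i = (π ^ g.val) i := fun _ _ => rfl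
  have hfix : ∀ i, (π ^ 2) i = i ↔ π i = i := by
    intro i
    constructor
    · intro h
      have h3 : π ((π ^ 2) i) = i := by
        rw [← Equiv.Perm.mul_apply, ← pow_succ', hπ]; rfl
      rwa [h] at h3
    · intro h
      rw [pow_two, Equiv.Perm.mul_apply, h, h]
  have : Fintype (Quotient (AddAction.orbitRel (ZMod 3) ι)) := Fintype.ofFinite _
  have hb := AddAction.sum_card_fixedBy_eq_card_orbits_mul_card_addGroup (ZMod 3) ι
  have hF : ∀ g : ZMod 3, Fintype.card (AddAction.fixedBy ι g) =
      Nat.card {i // (π ^ g.val) i = i} := fun g => (Nat.card_eq_fintype_card).symm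
  simp only [hF] at hb
  rw [ZMod.card, show (∑ g : ZMod 3, Nat.card {i // (π ^ g.val) i = i}) =
    Nat.card {i // (π ^ 0) i = i} + Nat.card {i // (π ^ 1) i = i} + Nat.card {i // (π ^ 2) i = i}
    from Fin.sum_univ_three _] at hb
  have h0 : Nat.card {i // (π ^ 0) i = i} = Nat.card ι :=
    Nat.card_congr (Equiv.subtypeUnivEquiv fun i => rfl)
  have h2 : Nat.card {i // (π ^ 2) i = i} = Nat.card {i // π i = i} :=
    Nat.card_congr (Equiv.subtypeEquivRight hfix)
  rw [h0, h2, pow_one] at hb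
  refine ⟨Fintype.card (Quotient (AddAction.orbitRel (ZMod 3) ι)), by omega, ?_⟩
  have hpow : ∀ c : ι → ZMod 2, (∀ i, c (π i) = c i) → ∀ (m : ℕ) i, c ((π ^ m) i) = c i := by
    intro c hc m
    induction m with
    | zero => exact fun i => rfl
    | succ m ih => exact fun i => by rw [pow_succ', Equiv.Perm.mul_apply, hc, ih]
  have e : {c : ι → ZMod 2 // ∀ i, c (π i) = c i} ≃
      (Quotient (AddAction.orbitRel (ZMod 3) ι) → ZMod 2) :=
    { toFun := fun c x => Quotient.liftOn x c.1 (by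
        rintro _ i ⟨g, rfl⟩
        exact hpow c.1 c.2 _ i)
      invFun := fun f => ⟨fun i => f (Quotient.mk _ i), fun i =>
        congrArg f (Quotient.sound ⟨1, rfl⟩)⟩
      left_inv := fun c => rfl
      right_inv := fun f => by
        funext x
        induction x using Quotient.inductionOn
        rfl }
  rw [Nat.card_congr e, Nat.card_fun, Nat.card_zmod, Nat.card_eq_fintype_card]

section
variable {n k : ℕ}

/-- The exponents of the monomials of degree `k` in `n` variables. -/
abbrev Exponent (n k : ℕ) : Type := {f : Fin n → ℕ // ∑ i, f i = k}

instance finite_exponent : Finite (Exponent n k) := by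
  refine Finite.of_injective (fun f : Exponent n k => fun i => (⟨f.1 i, by
    have := Finset.single_le_sum (f := f.1) (fun _ _ => Nat.zero_le _) (Finset.mem_univ i)
    rw [f.2] at this
    omega⟩ : Fin (k + 1))) fun f g h => ?_
  apply Subtype.ext
  funext i
  exact congrArg Fin.val (congrFun h i)

/-- A form of degree `k` is given by its coefficients. -/
def coeffEquiv (n k : ℕ) : MvPolynomial.homogeneousSubmodule (Fin n) (ZMod 2) k ≃
    (Exponent n k → ZMod 2) :=
  Equiv.ofBijective (fun p f => MvPolynomial.coeff (Finsupp.equivFunOnFinite.symm f.1) p.1) (by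
    classical
    constructor
    · intro p p' h
      apply Subtype.ext
      ext d
      by_cases hd : d.degree = k
      · have h1 := congrFun h ⟨d, by rw [← Finsupp.degree_eq_sum, hd]⟩
        have h2 : Finsupp.equivFunOnFinite.symm (d : Fin n → ℕ) = d :=
          Finsupp.equivFunOnFinite.symm_apply_apply d
        dsimp only at h1
        rwa [h2] at h1
      · rw [((MvPolynomial.mem_homogeneousSubmodule _ _).1 p.2).coeff_eq_zero hd,
          ((MvPolynomial.mem_homogeneousSubmodule _ _).1 p'.2).coeff_eq_zero hd]
    · intro c
      have := Fintype.ofFinite (Exponent n k)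
      refine ⟨⟨∑ f : Exponent n k, MvPolynomial.monomial (Finsupp.equivFunOnFinite.symm f.1) (c f),
        Submodule.sum_mem _ fun f _ => ?_⟩, ?_⟩
      · rw [MvPolynomial.mem_homogeneousSubmodule]
        refine MvPolynomial.isHomogeneous_monomial _ ?_
        rw [Finsupp.degree_eq_sum]
        exact f.2
      · funext f
        simp only [MvPolynomial.coeff_sum, MvPolynomial.coeff_monomial]
        rw [Finset.sum_eq_single f]
        · simp
        · intro b _ hb
          exact if_neg fun h => hb (Subtype.ext (Finsupp.equivFunOnFinite.symm.injective h))
        · simp)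

instance finite_homogeneousSubmodule :
    Finite (MvPolynomial.homogeneousSubmodule (Fin n) (ZMod 2) k) :=
  Finite.of_equiv _ (coeffEquiv n k).symm

/-- The permutation of the exponents induced by a permutation of the variables. -/
def exponentPerm (σ : Equiv.Perm (Fin n)) : Equiv.Perm (Exponent n k) where
  toFun f := ⟨fun i => f.1 (σ.symm i), by rw [Equiv.sum_comp σ.symm f.1]; exact f.2⟩
  invFun f := ⟨fun i => f.1 (σ i), by rw [Equiv.sum_comp σ f.1]; exact f.2⟩
  left_inv f := by apply Subtype.ext; funext i; simp
  right_inv f := by apply Subtype.ext; funext i; simp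

theorem symAlgHom_permGL (σ : Equiv.Perm (Fin n)) (p : MvPolynomial (Fin n) (ZMod 2)) :
    symAlgHom n (permGL σ) p = MvPolynomial.rename σ p := by
  have : symAlgHom n (permGL σ) = MvPolynomial.rename σ := by
    apply MvPolynomial.algHom_ext
    intro j
    rw [symAlgHom, MvPolynomial.aeval_X, MvPolynomial.rename_X, Finset.sum_eq_single (σ j)]
    · rw [permGL_apply, if_pos rfl, one_smul]
    · intro i _ hi
      rw [permGL_apply, if_neg hi, zero_smul]
    · simp
  rw [this]

theorem coeffEquiv_permGL (σ : Equiv.Perm (Fin n))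
    (p : MvPolynomial.homogeneousSubmodule (Fin n) (ZMod 2) k) (f : Exponent n k) :
    coeffEquiv n k (symRep n k (permGL σ) p) (exponentPerm σ f) = coeffEquiv n k p f := by
  change MvPolynomial.coeff (Finsupp.equivFunOnFinite.symm (exponentPerm σ f).1)
    (symAlgHom n (permGL σ) p.1) = MvPolynomial.coeff (Finsupp.equivFunOnFinite.symm f.1) p.1
  rw [symAlgHom_permGL, ← MvPolynomial.coeff_rename_mapDomain σ σ.injective p.1
    (Finsupp.equivFunOnFinite.symm f.1)]
  congr 1
  ext i
  rw [Finsupp.mapDomain_equiv_apply]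
  rfl

/-- If `g³ = 1`, the image of the idempotent `1 + g + g²` consists of the vectors fixed by `g`. -/
theorem mem_range_powerSum {g : GL2 n} (hg : g ^ 3 = 1) {V : Type} [AddCommGroup V]
    [Module (ZMod 2) V] (ρ : Representation (ZMod 2) (GL2 n) V) (x : V) :
    (∃ y : ρ.asModule, powerSum g [0, 1, 2] • y = x) ↔ ρ g x = x := by
  have hE : (([0, 1, 2] : List ℕ).map fun e => ρ g ^ e).sum = 1 + (ρ g + ρ g * ρ g) := by
    simp [pow_two]
  have hact : ∀ y : ρ.asModule, powerSum g [0, 1, 2] • y =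
      ((1 + (ρ g + ρ g * ρ g) : Module.End (ZMod 2) V) (y : V) : V) := fun y => by
    rw [← hE]
    exact powerSum_smul_asModule ρ g [0, 1, 2] y
  constructor
  · rintro ⟨y, rfl⟩
    let z : V := y
    rw [hact]
    change ρ g (z + (ρ g z + ρ g (ρ g z))) = z + (ρ g z + ρ g (ρ g z))
    rw [map_add, map_add]
    have h3 : ρ g (ρ g (ρ g z)) = z := by
      rw [← Module.End.mul_apply, ← Module.End.mul_apply, ← map_mul, ← map_mul, ← pow_two,
        ← pow_succ, hg, map_one]
      rfl
    rw [h3]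
    abel
  · intro h
    refine ⟨x, ?_⟩
    refine (hact x).trans ?_
    change (x + (ρ g x + ρ g (ρ g x)) : V) = x
    rw [h, h, add_self_zmod, add_zero]

theorem cardSMul_powerSum_zero (g : GL2 n) (M : Type) [AddCommGroup M]
    [Module (ZMod 2)[GL2 n] M] : cardSMul (powerSum g [0]) M = Nat.card M := by
  refine Nat.card_congr (Equiv.subtypeUnivEquiv fun x => ⟨x, ?_⟩)
  change powerSum g [0] • x = x
  rw [show powerSum g [0] = 1 by simp [powerSum, MonoidAlgebra.one_def], one_smul]

/-- The numbers of elements of the symmetric power and of its image under `1 + g + g²`, for a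
permutation `g` of the variables with cube `1`. The monomials are permuted, so that the image
consists of the coefficient functions that are constant on the orbits of `g`. -/
theorem exists_cardSMul_symRep {σ : Equiv.Perm (Fin n)} (hσ : σ ^ 3 = 1) (k : ℕ) :
    ∃ d a, cardSMul (powerSum (permGL σ) [0]) (symRep n k).asModule = 2 ^ d ∧
      cardSMul (powerSum (permGL σ) [0, 1, 2]) (symRep n k).asModule = 2 ^ a ∧
      3 * a = d + 2 * Nat.card {f : Exponent n k // ∀ i, f.1 (σ i) = f.1 i} := by
  have hperm : (exponentPerm σ : Equiv.Perm (Exponent n k)) ^ 3 = 1 := by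
    ext f i
    change f.1 (σ.symm (σ.symm (σ.symm i))) = f.1 i
    refine congrArg f.1 ?_
    rw [Equiv.symm_apply_eq, Equiv.symm_apply_eq, Equiv.symm_apply_eq]
    exact (congrArg (fun τ : Equiv.Perm (Fin n) => τ i) hσ).symm
  obtain ⟨q, hq, hcard⟩ := exists_card_invariant hperm
  refine ⟨Nat.card (Exponent n k), q, ?_, ?_, ?_⟩
  · rw [cardSMul_powerSum_zero]
    refine (Nat.card_congr (coeffEquiv n k)).trans ?_
    rw [Nat.card_fun, Nat.card_zmod]
  · rw [← hcard]
    refine Nat.card_congr ((coeffEquiv n k).subtypeEquiv fun p => ?_)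
    refine (mem_range_powerSum (by rw [← map_pow, hσ, map_one]) (symRep n k) p).trans ?_
    rw [← (coeffEquiv n k).injective.eq_iff, funext_iff]
    constructor
    · intro h f
      exact (h _).symm.trans (coeffEquiv_permGL σ p f)
    · intro h f
      obtain ⟨f, rfl⟩ := (exponentPerm σ).surjective f
      rw [coeffEquiv_permGL]
      exact (h f).symm
  · rw [hq]
    congr 2
    refine Nat.card_congr (Equiv.subtypeEquivRight fun f => ?_)
    rw [Subtype.ext_iff, funext_iff]
    constructor
    · intro h i
      have := h (σ i)
      change f.1 (σ.symm (σ i)) = _ at this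
      rw [← this, Equiv.symm_apply_apply]
    · intro h i
      change f.1 (σ.symm i) = _
      rw [← h, Equiv.apply_symm_apply]

end

/-! ### The exact sequence of symmetric powers of `𝔽₂³` and `𝔽₂²` -/

section
open MvPolynomial

/-- The cyclic permutation `0 ↦ 1 ↦ 2 ↦ 0` of the coordinates, as an element of `GL₃(𝔽₂)`. -/
abbrev cyc3 : GL2 3 := permGL (finRotate 3)

/-- The element of order `3` of `GL₂(𝔽₂)` that maps `e_0 ↦ e_1 ↦ e_0 + e_1 ↦ e_0`. -/
def fib2 : GL2 2 :=
  Matrix.GeneralLinearGroup.mkOfDetNeZero (natMatrix 2 natFib) (by rw [Matrix.det_fin_two]; decide)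

theorem fib2_pow : fib2 ^ 3 = 1 := by
  apply Units.ext
  rw [Units.val_pow_eq_pow_val]
  change natMatrix 2 natFib ^ 3 = 1
  rw [← natMatrix_natPow]
  ext i j
  change ((natPow 2 natFib 3 i j : ℕ) : ZMod 2) = _
  rw [Matrix.one_apply]
  revert i j
  decide

/-- Evaluation of ternary polynomials at the three nonzero linear forms in two variables. -/
def evalLines : MvPolynomial (Fin 3) (ZMod 2) →ₐ[ZMod 2] MvPolynomial (Fin 2) (ZMod 2) :=
  aeval ![X 0, X 1, X 0 + X 1]

/-- The sum of the three variables. -/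
def sumVars : MvPolynomial (Fin 3) (ZMod 2) := X 0 + X 1 + X 2

theorem sumVars_mem : sumVars ∈ homogeneousSubmodule (Fin 3) (ZMod 2) 1 :=
  add_mem (add_mem (isHomogeneous_X _ _) (isHomogeneous_X _ _)) (isHomogeneous_X _ _)

theorem add_self_mvPolynomial {σ : Type*} (p : MvPolynomial σ (ZMod 2)) : p + p = 0 :=
  CharTwo.add_self_eq_zero p

theorem evalLines_sumVars : evalLines sumVars = 0 := by
  simp only [evalLines, sumVars, map_add, aeval_X]
  exact add_self_mvPolynomial _

theorem symAlgHom_cyc3_X (j : Fin 3) : symAlgHom 3 cyc3 (X j) = X (finRotate 3 j) := by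
  rw [symAlgHom_permGL, rename_X]

theorem symAlgHom_cyc3_sumVars : symAlgHom 3 cyc3 sumVars = sumVars := by
  simp only [sumVars, map_add, symAlgHom_cyc3_X]
  change X 1 + X 2 + X 0 = _
  ring

/-- `fib2` permutes the three nonzero linear forms cyclically. -/
theorem evalLines_symAlgHom (p : MvPolynomial (Fin 3) (ZMod 2)) :
    evalLines (symAlgHom 3 cyc3 p) = symAlgHom 2 fib2 (evalLines p) := by
  have h0 : symAlgHom 2 fib2 (X 0) = X 1 := by
    rw [symAlgHom, aeval_X, Fin.sum_univ_two]
    change ((0 : ℕ) : ZMod 2) • X 0 + ((1 : ℕ) : ZMod 2) • X 1 = _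
    simp
  have h1 : symAlgHom 2 fib2 (X 1) = X 0 + X 1 := by
    rw [symAlgHom, aeval_X, Fin.sum_univ_two]
    change ((1 : ℕ) : ZMod 2) • X 0 + ((1 : ℕ) : ZMod 2) • X 1 = _
    simp
  have h : evalLines.comp (symAlgHom 3 cyc3) = (symAlgHom 2 fib2).comp evalLines := by
    apply algHom_ext
    intro j
    rw [AlgHom.comp_apply, AlgHom.comp_apply, symAlgHom_cyc3_X, evalLines, aeval_X, aeval_X]
    fin_cases j
    · exact h0.symm
    · exact h1.symm
    · change X 0 = symAlgHom 2 fib2 (X 0 + X 1)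
      rw [map_add, h0, h1, add_left_comm, add_self_mvPolynomial, add_zero]
  exact DFunLike.congr_fun h p

theorem evalLines_mem {k : ℕ} {p : MvPolynomial (Fin 3) (ZMod 2)}
    (hp : p ∈ homogeneousSubmodule (Fin 3) (ZMod 2) k) :
    evalLines p ∈ homogeneousSubmodule (Fin 2) (ZMod 2) k := by
  have := ((mem_homogeneousSubmodule _ _).1 hp).aeval (n := 1)
    (![X 0, X 1, X 0 + X 1] : Fin 3 → MvPolynomial (Fin 2) (ZMod 2)) (fun j => by
      fin_cases j
      · exact isHomogeneous_X _ _
      · exact isHomogeneous_X _ _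
      · exact (isHomogeneous_X _ _).add (isHomogeneous_X _ _))
  rw [one_mul] at this
  exact this

theorem evalLines_rename (p : MvPolynomial (Fin 2) (ZMod 2)) :
    evalLines (rename Fin.castSucc p) = p := by
  have : evalLines.comp (rename Fin.castSucc) = AlgHom.id _ _ := by
    apply algHom_ext
    intro j
    rw [AlgHom.comp_apply, rename_X, evalLines, aeval_X]
    fin_cases j <;> rfl
  exact DFunLike.congr_fun this p

/-- Modulo the sum of the variables, a polynomial is determined by `evalLines`, because the third
variable is the sum of the others. -/
theorem sumVars_dvd {p : MvPolynomial (Fin 3) (ZMod 2)} (hp : evalLines p = 0) :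
    sumVars ∣ p := by
  let I : Ideal (MvPolynomial (Fin 3) (ZMod 2)) := Ideal.span {sumVars}
  have h : (Ideal.Quotient.mkₐ (ZMod 2) I).comp ((rename Fin.castSucc).comp evalLines) =
      Ideal.Quotient.mkₐ (ZMod 2) I := by
    apply algHom_ext
    intro j
    rw [AlgHom.comp_apply, AlgHom.comp_apply, evalLines, aeval_X]
    fin_cases j
    · change Ideal.Quotient.mk I (rename Fin.castSucc (X 0)) = _
      rw [rename_X]; rfl
    · change Ideal.Quotient.mk I (rename Fin.castSucc (X 1)) = _
      rw [rename_X]; rfl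
    · change Ideal.Quotient.mk I (rename Fin.castSucc (X 0 + X 1)) = Ideal.Quotient.mk I (X 2)
      rw [map_add, rename_X, rename_X, Ideal.Quotient.eq, Ideal.mem_span_singleton, CharTwo.sub_eq_add]
      exact dvd_rfl
  have h1 := DFunLike.congr_fun h p
  rw [AlgHom.comp_apply, AlgHom.comp_apply, hp, map_zero, map_zero] at h1
  exact Ideal.mem_span_singleton.1 (Ideal.Quotient.eq_zero_iff_mem.1 h1.symm)

theorem sumVars_ne_zero : sumVars ≠ 0 := by
  intro h
  have h1 : aeval (![1, 0, 0] : Fin 3 → ZMod 2) sumVars = 0 := by rw [h, map_zero]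
  simp [sumVars] at h1

attribute [local instance] MvPolynomial.gradedAlgebra in
theorem exists_eq_sumVars_mul {k : ℕ} {p : MvPolynomial (Fin 3) (ZMod 2)}
    (hp : p ∈ homogeneousSubmodule (Fin 3) (ZMod 2) (k + 1)) (h0 : evalLines p = 0) :
    ∃ q ∈ homogeneousSubmodule (Fin 3) (ZMod 2) k, sumVars * q = p := by
  obtain ⟨q, rfl⟩ := sumVars_dvd h0
  refine ⟨(DirectSum.decompose (homogeneousSubmodule (Fin 3) (ZMod 2)) q k : _),
    SetLike.coe_mem _, ?_⟩
  rw [← DirectSum.coe_decompose_mul_add_of_left_mem _ sumVars_mem, add_comm 1 k]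
  exact DirectSum.decompose_of_mem_same _ hp

/-- Multiplication by the sum of the variables. -/
def mulSumVars (k : ℕ) :
    homogeneousSubmodule (Fin 3) (ZMod 2) k →+ homogeneousSubmodule (Fin 3) (ZMod 2) (k + 1) where
  toFun p := ⟨sumVars * p.1, by
    have := ((mem_homogeneousSubmodule _ _).1 sumVars_mem).mul
      ((mem_homogeneousSubmodule _ _).1 p.2)
    rwa [add_comm 1 k] at this⟩
  map_zero' := Subtype.ext (mul_zero _)
  map_add' _ _ := Subtype.ext (mul_add _ _ _)

/-- Restriction of `evalLines` to the forms of degree `k`. -/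
def evalLinesHom (k : ℕ) :
    homogeneousSubmodule (Fin 3) (ZMod 2) k →+ homogeneousSubmodule (Fin 2) (ZMod 2) k where
  toFun p := ⟨evalLines p.1, evalLines_mem p.2⟩
  map_zero' := Subtype.ext (map_zero _)
  map_add' _ _ := Subtype.ext (map_add _ _ _)

/-- A map that intertwines `g` and `h` intertwines the sums of their powers. -/
theorem map_powerSum_smul {m n : ℕ} {V W : Type} [AddCommGroup V] [Module (ZMod 2) V]
    [AddCommGroup W] [Module (ZMod 2) W] {ρ : Representation (ZMod 2) (GL2 m) V}
    {τ : Representation (ZMod 2) (GL2 n) W} {g : GL2 m} {h : GL2 n} (f : V →+ W)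
    (hf : ∀ x, f (ρ g x) = τ h (f x)) (L : List ℕ) (x : V) :
    f ((L.map fun e => ρ g ^ e).sum x) = (L.map fun e => τ h ^ e).sum (f x) := by
  induction L with
  | nil => exact map_zero f
  | cons e L ih =>
    rw [List.map_cons, List.map_cons, List.sum_cons, List.sum_cons, LinearMap.add_apply,
      LinearMap.add_apply, map_add, ih]
    congr 1
    clear ih
    induction e with
    | zero => rfl
    | succ e ih =>
      rw [pow_succ', pow_succ', Module.End.mul_apply, Module.End.mul_apply, hf, ih]

/-- The exact sequence `0 → S^k(𝔽₂³) → S^(k+1)(𝔽₂³) → S^(k+1)(𝔽₂²) → 0` of multiplication by the sum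
of the variables and evaluation at the three nonzero linear forms, compatible with the elements
`cyc3` and `fib2` of order `3`. -/
theorem cardSMul_symRep_succ (k : ℕ) {L : List ℕ} (hL : IsIdempotentElem (powerSum cyc3 L)) :
    cardSMul (powerSum cyc3 L) (symRep 3 (k + 1)).asModule =
      cardSMul (powerSum cyc3 L) (symRep 3 k).asModule *
        cardSMul (powerSum fib2 L) (symRep 2 (k + 1)).asModule := by
  refine natCard_range_eq_mul (A := (symRep 3 k).asModule) (B := (symRep 3 (k + 1)).asModule)
    (C := (symRep 2 (k + 1)).asModule) (f := mulSumVars k) (g := evalLinesHom (k + 1))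
    ?_ ?_ ?_ ?_ ?_ ?_
  · intro p q h
    exact Subtype.ext (mul_left_cancel₀ sumVars_ne_zero (congrArg Subtype.val h))
  · intro p
    refine ⟨⟨rename Fin.castSucc p.1, ?_⟩, Subtype.ext (evalLines_rename p.1)⟩
    exact ((mem_homogeneousSubmodule _ _).1 p.2).rename_isHomogeneous
  · intro p
    constructor
    · intro h
      obtain ⟨q, hq, e⟩ := exists_eq_sumVars_mul p.2 (congrArg Subtype.val h)
      exact ⟨⟨q, hq⟩, Subtype.ext e⟩
    · rintro ⟨q, rfl⟩
      refine Subtype.ext ?_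
      change evalLines (sumVars * q.1) = 0
      rw [map_mul, evalLines_sumVars, zero_mul]
  · intro p
    change powerSum cyc3 L • powerSum cyc3 L • p = powerSum cyc3 L • p
    rw [smul_smul, hL]
  · intro p
    have h := map_powerSum_smul (ρ := symRep 3 k) (τ := symRep 3 (k + 1)) (g := cyc3) (h := cyc3)
      (mulSumVars k) (fun x => Subtype.ext (by
        change sumVars * symAlgHom 3 cyc3 x.1 = symAlgHom 3 cyc3 (sumVars * x.1)
        rw [map_mul, symAlgHom_cyc3_sumVars])) L p
    exact (congrArg (mulSumVars k) (powerSum_smul_asModule _ _ L p)).trans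
      (h.trans (powerSum_smul_asModule (symRep 3 (k + 1)) _ L _).symm)
  · intro p
    have h := map_powerSum_smul (ρ := symRep 3 (k + 1)) (τ := symRep 2 (k + 1)) (g := cyc3)
      (h := fib2) (evalLinesHom (k + 1)) (fun x => Subtype.ext (evalLines_symAlgHom x.1)) L p
    exact (congrArg (evalLinesHom (k + 1)) (powerSum_smul_asModule _ _ L p)).trans
      (h.trans (powerSum_smul_asModule (symRep 2 (k + 1)) _ L _).symm)

end

/-! ### The relation between the Poincaré series -/

theorem natCard_exponent_two (k : ℕ) : Nat.card (Exponent 2 k) = k + 1 := by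
  rw [← Nat.card_fin (k + 1)]
  refine Nat.card_congr
    { toFun := fun f => ⟨f.1 0, by have := f.2; rw [Fin.sum_univ_two] at this; omega⟩
      invFun := fun a => ⟨![a.1, k - a.1], by
        have := a.2
        rw [Fin.sum_univ_two]
        change a.1 + (k - a.1) = k
        omega⟩
      left_inv := fun f => by
        apply Subtype.ext
        have := f.2
        rw [Fin.sum_univ_two] at this
        funext i
        fin_cases i
        · rfl
        · change k - f.1 0 = f.1 1
          omega
      right_inv := fun a => rfl }

/-- The fixed exponents are constant. -/
theorem natCard_fixed_exponent_three (k : ℕ) :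
    Nat.card {f : Exponent 3 k // ∀ i, f.1 (finRotate 3 i) = f.1 i} = if 3 ∣ k then 1 else 0 := by
  have hf : ∀ f : {f : Exponent 3 k // ∀ i, f.1 (finRotate 3 i) = f.1 i},
      ∀ i, 3 * f.1.1 i = k := by
    intro f i
    have h := f.1.2
    rw [Fin.sum_univ_three] at h
    have h0 : f.1.1 1 = f.1.1 0 := f.2 0
    have h1 : f.1.1 2 = f.1.1 1 := f.2 1
    fin_cases i
    · change 3 * f.1.1 0 = k; omega
    · change 3 * f.1.1 1 = k; omega
    · change 3 * f.1.1 2 = k; omega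
  split_ifs with h
  · obtain ⟨a, rfl⟩ := h
    rw [Nat.card_eq_one_iff_unique]
    refine ⟨⟨fun f g => ?_⟩, ⟨⟨⟨fun _ => a, by simp⟩, fun _ => rfl⟩⟩⟩
    apply Subtype.ext; apply Subtype.ext
    funext i
    have h1 := hf f i
    have h2 := hf g i
    omega
  · have : IsEmpty {f : Exponent 3 k // ∀ i, f.1 (finRotate 3 i) = f.1 i} :=
      ⟨fun f => h ⟨_, (hf f 0).symm⟩⟩
    exact Nat.card_of_isEmpty

/-- The cyclic permutation `0 ↦ 1 ↦ 2 ↦ 0` of four coordinates. -/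
def cycle4 : Equiv.Perm (Fin 4) := Equiv.swap 0 1 * Equiv.swap 1 2

/-- The fixed exponents are `(a, a, a, k - 3 a)`. -/
theorem natCard_fixed_exponent_four (k : ℕ) :
    Nat.card {f : Exponent 4 k // ∀ i, f.1 (cycle4 i) = f.1 i} = k / 3 + 1 := by
  have h01 : cycle4 0 = 1 := by decide
  have h12 : cycle4 1 = 2 := by decide
  have hf : ∀ f : {f : Exponent 4 k // ∀ i, f.1 (cycle4 i) = f.1 i},
      f.1.1 1 = f.1.1 0 ∧ f.1.1 2 = f.1.1 0 ∧ f.1.1 3 + 3 * f.1.1 0 = k := by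
    intro f
    have h := f.1.2
    rw [Fin.sum_univ_four] at h
    have h0 := f.2 0
    have h1 := f.2 1
    rw [h01] at h0
    rw [h12] at h1
    exact ⟨h0, h1.trans h0, by omega⟩
  rw [← Nat.card_fin (k / 3 + 1)]
  refine Nat.card_congr
    { toFun := fun f => ⟨f.1.1 0, by have := hf f; omega⟩
      invFun := fun a => ⟨⟨![a.1, a.1, a.1, k - 3 * a.1], by
        have := a.2
        rw [Fin.sum_univ_four]
        change a.1 + a.1 + a.1 + (k - 3 * a.1) = k
        omega⟩, fun i => by
          fin_cases i
          · change ![a.1, a.1, a.1, k - 3 * a.1] (cycle4 0) = _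
            rw [h01]; rfl
          · change ![a.1, a.1, a.1, k - 3 * a.1] (cycle4 1) = _
            rw [h12]; rfl
          · change ![a.1, a.1, a.1, k - 3 * a.1] (cycle4 2) = _
            rw [show cycle4 2 = 0 by decide]; rfl
          · change ![a.1, a.1, a.1, k - 3 * a.1] (cycle4 3) = _
            rw [show cycle4 3 = 3 by decide]; rfl⟩
      left_inv := fun f => by
        apply Subtype.ext; apply Subtype.ext
        obtain ⟨h1, h2, h3⟩ := hf f
        funext i
        fin_cases i
        · rfl
        · exact h1.symm
        · exact h2.symm
        · change k - 3 * f.1.1 0 = f.1.1 3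
          omega
      right_inv := fun a => rfl }

theorem natMatrix_natCyc_three : natMatrix 3 natCyc = cyc3.1 := by
  ext i j
  rw [permGL_apply]
  change ((natCyc i j : ℕ) : ZMod 2) = _
  revert i j
  decide

theorem natMatrix_natCyc_four : natMatrix 4 natCyc = (permGL cycle4).1 := by
  ext i j
  rw [permGL_apply]
  change ((natCyc i j : ℕ) : ZMod 2) = _
  revert i j
  decide

theorem finRotate_pow : finRotate 3 ^ 3 = 1 := by decide

theorem cycle4_pow : cycle4 ^ 3 = 1 := by decide

theorem mult_symRep_three (k : ℕ) :
    (mult 3 (regular3 0) (regular3_sortedGT 0) (symRep 3 k).asModule : ℤ) -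
      mult 3 (regular3 3) (regular3_sortedGT 3) (symRep 3 k).asModule =
        if 3 ∣ k then 1 else 0 := by
  obtain ⟨d, a, hd, ha, hda⟩ := exists_cardSMul_symRep finRotate_pow k
  rw [natCard_fixed_exponent_three] at hda
  have := finite_asModule (symRep 3 k)
  have h := multiplicity_relation_three (by rw [← map_pow, finRotate_pow, map_one])
    natMatrix_natCyc_three (symRep 3 k).asModule hd ha
  split_ifs at hda ⊢ <;> omega

theorem mult_symRep_four (k : ℕ) :
    (mult 4 (regular4 0) (regular4_sortedGT 0) (symRep 4 k).asModule : ℤ) +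
      mult 4 (regular4 1) (regular4_sortedGT 1) (symRep 4 k).asModule +
      mult 4 (regular4 3) (regular4_sortedGT 3) (symRep 4 k).asModule -
      mult 4 (regular4 4) (regular4_sortedGT 4) (symRep 4 k).asModule -
      mult 4 (regular4 5) (regular4_sortedGT 5) (symRep 4 k).asModule -
      mult 4 (regular4 6) (regular4_sortedGT 6) (symRep 4 k).asModule -
      2 * mult 4 (regular4 7) (regular4_sortedGT 7) (symRep 4 k).asModule = k / 3 + 1 := by
  obtain ⟨d, a, hd, ha, hda⟩ := exists_cardSMul_symRep cycle4_pow k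
  rw [natCard_fixed_exponent_four] at hda
  have := finite_asModule (symRep 4 k)
  have h := multiplicity_relation_four (by rw [← map_pow, cycle4_pow, map_one])
    natMatrix_natCyc_four (symRep 4 k).asModule hd ha
  omega

theorem symRep_zero (n : ℕ) (g : GL2 n)
    (p : MvPolynomial.homogeneousSubmodule (Fin n) (ZMod 2) 0) : symRep n 0 g p = p := by
  apply Subtype.ext
  change symAlgHom n g p.1 = p.1
  obtain ⟨c, hc⟩ : ∃ c, p.1 = MvPolynomial.C c :=
    ⟨_, MvPolynomial.totalDegree_eq_zero_iff_eq_C.1 (Nat.le_zero.1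
      ((MvPolynomial.mem_homogeneousSubmodule _ _).1 p.2).totalDegree_le)⟩
  rw [hc]
  exact (symAlgHom n g).commutes c

/-- The elements of order `3` of `GL₂(𝔽₂)` do not permute the monomials in two variables; the exact
sequence of `cardSMul_symRep_succ` reduces the count to two symmetric powers of `𝔽₂³`. -/
theorem mult_symRep_two (k : ℕ) :
    3 * (mult 2 (regular2 1) (regular2_sortedGT 1) (symRep 2 k).asModule : ℤ) =
      k + 1 - (if 3 ∣ k then 1 else 0) + if 3 ∣ k + 2 then 1 else 0 := by
  have := finite_asModule (symRep 2 k)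
  have hd : cardSMul (powerSum fib2 [0]) (symRep 2 k).asModule = 2 ^ (k + 1) := by
    rw [cardSMul_powerSum_zero]
    refine (Nat.card_congr (coeffEquiv 2 k)).trans ?_
    rw [Nat.card_fun, Nat.card_zmod, natCard_exponent_two]
  cases k with
  | zero =>
    have ha : cardSMul (powerSum fib2 [0, 1, 2]) (symRep 2 0).asModule = 2 ^ 1 := by
      rw [← zero_add 1, ← hd, cardSMul_powerSum_zero]
      refine Nat.card_congr (Equiv.subtypeUnivEquiv fun x => ?_)
      exact (mem_range_powerSum fib2_pow (symRep 2 0) x).2 (symRep_zero 2 fib2 x)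
    have h := multiplicity_relation_two fib2_pow rfl _ hd ha
    simp at h ⊢
    omega
  | succ k =>
    have hg : cyc3 ^ 3 = 1 := by rw [← map_pow, finRotate_pow, map_one]
    obtain ⟨d, a, hd0, ha0, hda0⟩ := exists_cardSMul_symRep finRotate_pow k
    obtain ⟨d', a', hd1, ha1, hda1⟩ := exists_cardSMul_symRep finRotate_pow (k + 1)
    rw [natCard_fixed_exponent_three] at hda0 hda1
    have e1 := cardSMul_symRep_succ k (isIdempotentElem_one_sum cyc3)
    have e2 := cardSMul_symRep_succ k (isIdempotentElem_sum hg)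
    rw [hd0, hd1, hd, ← pow_add] at e1
    have e1' := Nat.pow_right_injective le_rfl e1
    rw [ha0, ha1] at e2
    obtain ⟨c, -, hc⟩ := (Nat.dvd_prime_pow Nat.prime_two).1 (Dvd.intro_left _ e2.symm)
    rw [hc, ← pow_add] at e2
    have e2' := Nat.pow_right_injective le_rfl e2
    have h := multiplicity_relation_two fib2_pow rfl _ hd hc
    push_cast at h ⊢
    split_ifs at hda0 hda1 ⊢ <;> omega

theorem coeff_poincareSeries {n : ℕ} {w : List ℕ} (hw : w.SortedGT) (h : w.head? = some n)
    (k : ℕ) : PowerSeries.coeff k (poincareSeries (YoungDiagram.ofRowLens w hw.sortedGE)) =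
      mult n w hw (symRep n k).asModule := by
  obtain rfl := rowLen_zero_ofRowLens hw.sortedGE h
  exact PowerSeries.coeff_mk _ _

theorem virtualPoincareSeries_M (w : List ℕ) (hw : w.SortedGT ∧ (∀ x ∈ w, 0 < x) ∧ w ≠ []) :
    virtualPoincareSeries (M w hw) =
      poincareSeries (YoungDiagram.ofRowLens w hw.1.sortedGE) := by
  rw [virtualPoincareSeries, M, Finsupp.linearCombination_single, one_smul]
  rfl

theorem M_apply_of_ne {w w' : List ℕ} (hw : w.SortedGT ∧ (∀ x ∈ w, 0 < x) ∧ w ≠ [])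
    (hw' : w'.SortedGT ∧ (∀ x ∈ w', 0 < x) ∧ w' ≠ []) (h : w ≠ w') :
    M w hw (ofParts w' hw'.1 hw'.2.1 hw'.2.2) = 0 := by
  refine Finsupp.single_eq_of_ne fun e => h ?_
  have := congrArg (fun μ : RegularPartition => μ.1.rowLens) e
  exact ((YoungDiagram.rowLens_ofRowLens_eq_self (hw := hw'.1.sortedGE) hw'.2.1).symm.trans
    (this.trans (YoungDiagram.rowLens_ofRowLens_eq_self (hw := hw.1.sortedGE) hw.2.1))).symm

/-- Coefficientwise, with `[·]` equal to `1` or `0` according to the truth of a condition, this is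
`(k + 1 - [3 ∣ k] + [3 ∣ k + 2]) / 3 + [3 ∣ k] - (⌊k / 3⌋ + 1) = 0`. -/
theorem virtualPoincareSeries_eq_zero :
    virtualPoincareSeries
        (M [2, 1] (by decide) + M [3] (by decide) - M [3, 2, 1] (by decide) - M [4] (by decide)
          - M [4, 1] (by decide) - M [4, 3] (by decide) + M [4, 2, 1] (by decide)
          + M [4, 3, 2] (by decide) + M [4, 3, 1] (by decide)
          + 2 • M [4, 3, 2, 1] (by decide)) = 0 := by
  ext k
  simp only [map_add, map_sub, map_nsmul, virtualPoincareSeries_M]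
  rw [coeff_poincareSeries (n := 2) (w := [2, 1]) (by decide) rfl,
    coeff_poincareSeries (n := 3) (w := [3]) (by decide) rfl,
    coeff_poincareSeries (n := 3) (w := [3, 2, 1]) (by decide) rfl,
    coeff_poincareSeries (n := 4) (w := [4]) (by decide) rfl,
    coeff_poincareSeries (n := 4) (w := [4, 1]) (by decide) rfl,
    coeff_poincareSeries (n := 4) (w := [4, 3]) (by decide) rfl,
    coeff_poincareSeries (n := 4) (w := [4, 2, 1]) (by decide) rfl,
    coeff_poincareSeries (n := 4) (w := [4, 3, 2]) (by decide) rfl,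
    coeff_poincareSeries (n := 4) (w := [4, 3, 1]) (by decide) rfl,
    coeff_poincareSeries (n := 4) (w := [4, 3, 2, 1]) (by decide) rfl]
  have h2 := mult_symRep_two k
  have h3 := mult_symRep_three k
  have h4 := mult_symRep_four k
  simp only [regular2, regular3, regular4, Matrix.cons_val] at h2 h3 h4
  rw [map_zero, nsmul_eq_mul]
  push_cast
  split_ifs at h2 h3 <;> omega

end PoincareGL

end

theorem mainTheorem1 :
    PoincareGL.virtualPoincareSeries
        (PoincareGL.M [2, 1] (by decide) + PoincareGL.M [3] (by decide) - PoincareGL.M [3, 2, 1] (by decide) - PoincareGL.M [4] (by decide)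
          - PoincareGL.M [4, 1] (by decide) - PoincareGL.M [4, 3] (by decide) + PoincareGL.M [4, 2, 1] (by decide)
          + PoincareGL.M [4, 3, 2] (by decide) + PoincareGL.M [4, 3, 1] (by decide)
          + 2 • PoincareGL.M [4, 3, 2, 1] (by decide)) = 0 ∧
      ¬ LinearIndependent ℤ
        (fun μ : PoincareGL.RegularPartition => PoincareGL.poincareSeries μ.1) := by
  refine ⟨PoincareGL.virtualPoincareSeries_eq_zero, fun hli => ?_⟩
  have h := linearIndependent_iff.1 hli _ PoincareGL.virtualPoincareSeries_eq_zero
  -- the coefficient of the relation at `(2, 1)` is `1`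
  have h1 := DFunLike.congr_fun h (PoincareGL.ofParts [2, 1] (by decide) (by decide) (by decide))
  simp only [Finsupp.add_apply, Finsupp.sub_apply, Finsupp.smul_apply, Finsupp.zero_apply] at h1
  rw [PoincareGL.M_apply_of_ne (w := [3]) (w' := [2, 1]) (by decide) (by decide) (by decide),
    PoincareGL.M_apply_of_ne (w := [3, 2, 1]) (w' := [2, 1]) (by decide) (by decide) (by decide),
    PoincareGL.M_apply_of_ne (w := [4]) (w' := [2, 1]) (by decide) (by decide) (by decide),
    PoincareGL.M_apply_of_ne (w := [4, 1]) (w' := [2, 1]) (by decide) (by decide) (by decide),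
    PoincareGL.M_apply_of_ne (w := [4, 3]) (w' := [2, 1]) (by decide) (by decide) (by decide),
    PoincareGL.M_apply_of_ne (w := [4, 2, 1]) (w' := [2, 1]) (by decide) (by decide) (by decide),
    PoincareGL.M_apply_of_ne (w := [4, 3, 2]) (w' := [2, 1]) (by decide) (by decide) (by decide),
    PoincareGL.M_apply_of_ne (w := [4, 3, 1]) (w' := [2, 1]) (by decide) (by decide) (by decide),
    PoincareGL.M_apply_of_ne (w := [4, 3, 2, 1]) (w' := [2, 1]) (by decide) (by decide)
      (by decide), PoincareGL.M, Finsupp.single_eq_same] at h1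
  simp at h1
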